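/- **Definitions.** Let $M$ be a connected, Hausdorff, second countable complex manifold of finite dimension, with Kobayashi pseudo-distance $k_M$. Fix a smooth Hermitian metric $\|\cdot\|$ on $TM$ and let $d_M$ be the induced distance. $M$ is *complete hyperbolic* if $k_M$ is a distance and $(M,k_M)$ is a complete metric space. Let $1\le d\le\infty$. Assume that $k_M$ is of class $C^1$ on $\{(z,w)\in M\times M: z\ne w\}$. A *Herglotz vector field of order $d$* on $M$ is a map $G:M\times[0,+\infty)\to TM$, $G(z,t)\in T_zM$, such that 1. $t\mapsto G(z,t)$ is (Lebesgue) measurable for every $z\in M$; 2. $z\mapsto G(z,t)$ is holomorphic for every $t\ge 0$; 3. for every compact $K\subset M$ and $T>0$ there is a non-negative $C_{K,T}\in L^d([0,T])$ such that, for a.e. $t\in[0,T]$, $\|G(z,t)\|\le C_{K,T}(t)$ for all $z\in K$; 4. for a.e. $t\ge0$, $(dk_M)_{(z,w)}(G(z,t),G(w,t))\le 0$ for all $z\ne w$ in $M$. An *evolution family of order $d$* on $M$ is a family $(\varphi_{s,t})_{0\le s\le t<+\infty}$ of holomorphic maps $\varphi_{s,t}:M\to M$ such that $\varphi_{s,s}=\mathrm{id}_M$,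 $\varphi_{s,t}=\varphi_{u,t}\circ\varphi_{s,u}$ for $0\le s\le u\le t$, and, for every $T>0$ and every compact $K\subset M$, there is a non-negative $c_{T,K}\in L^d([0,T])$ with $$\sup_{z\in K}d_M(\varphi_{s,t'}(z),\varphi_{s,t}(z))\le\int_{t'}^{t}c_{T,K}(\xi)\,d\xi\qquad\text{for all }0\le s\le t'\le t\le T.$$ For $s\ge0$, $z\in M$ and $b\in(s,+\infty]$, a *Carathéodory solution on $[s,b)$ with initial value $z$* is a continuous curve $x:[s,b)\to M$ with $x(s)=z$ which is locally absolutely continuous (in charts) and satisfies $x'(t)=G(x(t),t)$ for a.e. $t\in[s,b)$. **Proposition 3.1.** Let $M$ be complete hyperbolic with $k_M\in C^1(M\times M\setminus\mathrm{Diag})$, let $1\le d\le\infty$ and let $G$ be a Herglotz vector field of order $d$ on $M$. Then there is a unique evolution family $(\varphi_{s,t})$ of order $d$ on $M$ such that, for all $s\ge 0$ and $z\in M$, $$\frac{\partial\varphi_{s,t}(z)}{\partial t}=G(\varphi_{s,t}(z),t)\qquad\text{for a.e. }t\in[s,+\infty).$$ Moreover, for all $s\ge0$ and $z\in M$, the curve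 $t\mapsto\varphi_{s,t}(z)$ is a Carathéodory solution on $[s,+\infty)$ with initial value $z$, and every Carathéodory solution on some $[s,b)$, $s<b\le+\infty$, with initial value $z$ coincides with it on $[s,b)$; thus all maximal Carathéodory solutions exist for all time. -/

import Mathlib

open Set Filter MeasureTheory
open scoped Manifold ContDiff Topology ENNReal

noncomputable section

/-- The real manifold underlying a complex manifold: holomorphic transition maps are real
analytic. -/
instance IsManifold.realOfComplex {E : Type*} [NormedAddCommGroup E] [NormedSpace ℂ E]
    {M : Type*} [TopologicalSpace M] [ChartedSpace E M] [h : IsManifold 𝓘(ℂ, E) ω M] :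
    IsManifold 𝓘(ℝ, E) ω M := by
  refine isManifold_of_contDiffOn 𝓘(ℝ, E) ω M fun e e' he he' => ?_
  exact (contDiffGroupoid ω 𝓘(ℂ, E)).compatible he he' |>.1.restrict_scalars ℝ

/-- A tangent vector of the complex manifold `M`, seen as a tangent vector of the underlying real
manifold (both tangent spaces are the model space, read in the preferred chart). -/
def toRealTangent {E : Type*} [NormedAddCommGroup E] [NormedSpace ℂ E]
    {M : Type*} [TopologicalSpace M] [ChartedSpace E M] {z : M}
    (v : TangentSpace 𝓘(ℂ, E) z) : TangentSpace 𝓘(ℝ, E) z := v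

/-- A smooth Hermitian metric on the tangent bundle of a complex manifold, given by its real part:
a smooth Riemannian metric for which multiplication by `i` is an isometry of every tangent space. -/
structure HermitianMetric (E : Type*) [NormedAddCommGroup E] [NormedSpace ℂ E]
    (M : Type*) [TopologicalSpace M] [ChartedSpace E M] [IsManifold 𝓘(ℂ, E) ω M] extends
    Bundle.ContMDiffRiemannianMetric 𝓘(ℝ, E) ∞ E (fun z : M => TangentSpace 𝓘(ℝ, E) z) where
  inner_I_smul (z : M) (v w : TangentSpace 𝓘(ℂ, E) z) :
    inner z (toRealTangent (Complex.I • v)) (toRealTangent (Complex.I • w)) =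
      inner z (toRealTangent v) (toRealTangent w)

namespace HermitianMetric

variable {E : Type*} [NormedAddCommGroup E] [NormedSpace ℂ E]
  {M : Type*} [TopologicalSpace M] [ChartedSpace E M] [IsManifold 𝓘(ℂ, E) ω M]

/-- The length `‖v‖` of a tangent vector. -/
def norm (h : HermitianMetric E M) {z : M} (v : TangentSpace 𝓘(ℂ, E) z) : ℝ :=
  √(h.inner z (toRealTangent v) (toRealTangent v))

open scoped Bundle in
/-- The distance on `M` induced by the Hermitian metric: the infimum of the lengths of the
`C^1` paths between two points. -/
def edist (h : HermitianMetric E M) (z w : M) : ℝ≥0∞ :=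
  letI : Bundle.RiemannianBundle (fun z : M => TangentSpace 𝓘(ℝ, E) z) :=
    ⟨h.toContMDiffRiemannianMetric.toRiemannianMetric⟩
  Manifold.riemannianEDist 𝓘(ℝ, E) z w

end HermitianMetric

/-- The Poincaré distance of the unit disc of `ℂ`. -/
def poincareDist (a b : ℂ) : ℝ := Real.artanh (‖a - b‖ / ‖1 - starRingEnd ℂ b * a‖)

/-- The infimum of the Poincaré distances of two points of the unit disc which some holomorphic
map from the unit disc to `M` sends to `p` and `q` (`∞` if there is no such map). -/
def discEDist (E : Type*) [NormedAddCommGroup E] [NormedSpace ℂ E]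
    {M : Type*} [TopologicalSpace M] [ChartedSpace E M] (p q : M) : ℝ≥0∞ :=
  ⨅ (f : ℂ → M) (_ : MDifferentiableOn 𝓘(ℂ) 𝓘(ℂ, E) f (Metric.ball 0 1))
    (a ∈ Metric.ball (0 : ℂ) 1) (b ∈ Metric.ball (0 : ℂ) 1) (_ : f a = p) (_ : f b = q),
    ENNReal.ofReal (poincareDist a b)

/-- The Kobayashi pseudo-distance: the infimum over all chains of holomorphic discs from `p` to
`q` of the sum of the Poincaré lengths. It is finite when `M` is connected. -/
def kobayashiEDist (E : Type*) [NormedAddCommGroup E] [NormedSpace ℂ E]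
    {M : Type*} [TopologicalSpace M] [ChartedSpace E M] (p q : M) : ℝ≥0∞ :=
  ⨅ (m : ℕ) (x : ℕ → M) (_ : x 0 = p) (_ : x m = q),
    ∑ i ∈ Finset.range m, discEDist E (x i) (x (i + 1))

/-- The Kobayashi pseudo-distance of a connected complex manifold, as a real number. -/
def kobayashiDist (E : Type*) [NormedAddCommGroup E] [NormedSpace ℂ E]
    {M : Type*} [TopologicalSpace M] [ChartedSpace E M] (p q : M) : ℝ :=
  (kobayashiEDist E p q).toReal

/-- `M` is complete hyperbolic: the Kobayashi pseudo-distance is a distance, and every Cauchy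
sequence for this distance converges for this distance. -/
structure IsCompleteHyperbolic (E : Type*) [NormedAddCommGroup E] [NormedSpace ℂ E]
    (M : Type*) [TopologicalSpace M] [ChartedSpace E M] : Prop where
  eq_of_kobayashiEDist_eq_zero : ∀ p q : M, kobayashiEDist E p q = 0 → p = q
  complete : ∀ u : ℕ → M,
    (∀ ε > 0, ∃ N, ∀ m ≥ N, ∀ n ≥ N, kobayashiEDist E (u m) (u n) < ε) →
      ∃ p, Tendsto (fun n => kobayashiEDist E (u n) p) atTop (𝓝 0)

/-- The Kobayashi distance is of class `C^1` on `M × M` off the diagonal. -/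
def KobayashiC1OffDiag (E : Type*) [NormedAddCommGroup E] [NormedSpace ℂ E]
    (M : Type*) [TopologicalSpace M] [ChartedSpace E M] : Prop :=
  ContMDiffOn (𝓘(ℝ, E).prod 𝓘(ℝ, E)) 𝓘(ℝ, ℝ) 1
    (fun p : M × M => kobayashiDist E p.1 p.2) {p : M × M | p.1 ≠ p.2}

/-- `(dk_M)_{(z,w)}(v, v')`. -/
def kobayashiDifferential {E : Type*} [NormedAddCommGroup E] [NormedSpace ℂ E]
    {M : Type*} [TopologicalSpace M] [ChartedSpace E M] {z w : M}
    (v : TangentSpace 𝓘(ℂ, E) z) (v' : TangentSpace 𝓘(ℂ, E) w) : ℝ :=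
  mfderiv (𝓘(ℝ, E).prod 𝓘(ℝ, E)) 𝓘(ℝ, ℝ) (fun p : M × M => kobayashiDist E p.1 p.2) (z, w)
    (toRealTangent v, toRealTangent v')

/-- A weak holomorphic vector field `G(z, t)`, `z ∈ M`, `t ≥ 0`, of order `d` on `M` (the values
for `t < 0` play no role). -/
structure IsWeakHolomorphicVectorField {E : Type*} [NormedAddCommGroup E] [NormedSpace ℂ E]
    {M : Type*} [TopologicalSpace M] [ChartedSpace E M] [IsManifold 𝓘(ℂ, E) ω M]
    (h : HermitianMetric E M) (d : ℝ≥0∞) (G : (z : M) → ℝ → TangentSpace 𝓘(ℂ, E) z) : Prop where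
  measurable : ∀ z : M, AEStronglyMeasurable (G z) (volume.restrict (Ici (0 : ℝ)))
  holomorphic : ∀ t : ℝ, 0 ≤ t → MDifferentiable 𝓘(ℂ, E) 𝓘(ℂ, E).tangent
    (fun z : M => (⟨z, G z t⟩ : TangentBundle 𝓘(ℂ, E) M))
  bound : ∀ K : Set M, IsCompact K → ∀ T : ℝ, 0 < T → ∃ C : ℝ → ℝ,
    (∀ t, 0 ≤ C t) ∧ MemLp C d (volume.restrict (Icc 0 T)) ∧
      ∀ᵐ t ∂(volume.restrict (Icc 0 T)), ∀ z ∈ K, h.norm (G z t) ≤ C t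

/-- A Herglotz vector field of order `d` on `M`. -/
structure IsHerglotzVectorField {E : Type*} [NormedAddCommGroup E] [NormedSpace ℂ E]
    {M : Type*} [TopologicalSpace M] [ChartedSpace E M] [IsManifold 𝓘(ℂ, E) ω M]
    (h : HermitianMetric E M) (d : ℝ≥0∞) (G : (z : M) → ℝ → TangentSpace 𝓘(ℂ, E) z) : Prop
    extends IsWeakHolomorphicVectorField h d G where
  nonexpansive : ∀ᵐ t ∂(volume.restrict (Ici (0 : ℝ))), ∀ z w : M, z ≠ w →
    kobayashiDifferential (G z t) (G w t) ≤ 0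

/-- An evolution family `φ s t`, `0 ≤ s ≤ t`, of order `d` on `M` (the values for other `s, t`
play no role). -/
structure IsEvolutionFamily {E : Type*} [NormedAddCommGroup E] [NormedSpace ℂ E]
    {M : Type*} [TopologicalSpace M] [ChartedSpace E M] [IsManifold 𝓘(ℂ, E) ω M]
    (h : HermitianMetric E M) (d : ℝ≥0∞) (φ : ℝ → ℝ → M → M) : Prop where
  refl : ∀ s, 0 ≤ s → φ s s = id
  comp : ∀ s u t, 0 ≤ s → s ≤ u → u ≤ t → φ s t = φ u t ∘ φ s u
  holomorphic : ∀ s t, 0 ≤ s → s ≤ t → MDifferentiable 𝓘(ℂ, E) 𝓘(ℂ, E) (φ s t)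
  bound : ∀ T : ℝ, 0 < T → ∀ K : Set M, IsCompact K → ∃ c : ℝ → ℝ,
    (∀ t, 0 ≤ c t) ∧ MemLp c d (volume.restrict (Icc 0 T)) ∧
      ∀ s t' t, 0 ≤ s → s ≤ t' → t' ≤ t → t ≤ T →
        ∀ z ∈ K, h.edist (φ s t' z) (φ s t z) ≤ ENNReal.ofReal (∫ ξ in t'..t, c ξ)

/-- The curve `x` has velocity `G(x(t), t)` at the time `t`. -/
def HasVelocityAt {E : Type*} [NormedAddCommGroup E] [NormedSpace ℂ E]
    {M : Type*} [TopologicalSpace M] [ChartedSpace E M]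
    (G : (z : M) → ℝ → TangentSpace 𝓘(ℂ, E) z) (x : ℝ → M) (t : ℝ) : Prop :=
  HasMFDerivAt 𝓘(ℝ, ℝ) 𝓘(ℝ, E) x t
    ((1 : ℝ →L[ℝ] ℝ).smulRight (toRealTangent (G (x t) t)))

/-- The family `φ` solves the Loewner equation `∂φ_{s,t}(z)/∂t = G(φ_{s,t}(z), t)`. -/
def SolvesLoewner {E : Type*} [NormedAddCommGroup E] [NormedSpace ℂ E]
    {M : Type*} [TopologicalSpace M] [ChartedSpace E M]
    (G : (z : M) → ℝ → TangentSpace 𝓘(ℂ, E) z) (φ : ℝ → ℝ → M → M) : Prop :=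
  ∀ s, 0 ≤ s → ∀ z : M, ∀ᵐ t ∂(volume.restrict (Ici s)), HasVelocityAt G (fun τ => φ s τ z) t

/-- The curve `x` is a Carathéodory solution on `[s, b)`, `b ≤ ∞`, of the Cauchy problem
`x'(t) = G(x(t), t)` a.e., `x(s) = z`: it is continuous, it is absolutely continuous in charts,
and it satisfies the equation at almost every time (the values off `[s, b)` play no role). -/
structure IsCaratheodorySolution {E : Type*} [NormedAddCommGroup E] [NormedSpace ℂ E]
    {M : Type*} [TopologicalSpace M] [ChartedSpace E M]
    (G : (z : M) → ℝ → TangentSpace 𝓘(ℂ, E) z) (s : ℝ) (b : EReal) (z : M) (x : ℝ → M) :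
    Prop where
  continuousOn : ContinuousOn x {t : ℝ | s ≤ t ∧ (t : EReal) < b}
  absolutelyContinuous : ∀ p : M, ∀ t t' : ℝ, s ≤ t → t ≤ t' → (t' : EReal) < b →
    MapsTo x (Icc t t') (chartAt E p).source →
      AbsolutelyContinuousOnInterval (fun τ => chartAt E p (x τ)) t t'
  initial : x s = z
  equation : ∀ᵐ t ∂(volume.restrict {t : ℝ | s ≤ t ∧ (t : EReal) < b}), HasVelocityAt G x t

end

/-- A transitive relation between times which holds locally holds between the endpoints of a
compact interval. -/
theorem rel_of_locally {R : ℝ → ℝ → Prop} {a b : ℝ} (hab : a ≤ b)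
    (trans : ∀ x y z, a ≤ x → x ≤ y → y ≤ z → z ≤ b → R x y → R y z → R x z)
    (loc : ∀ t ∈ Icc a b, ∃ δ > 0, ∀ x y, a ≤ x → x ≤ y → y ≤ b → t - δ < x → y < t + δ → R x y) :
    R a b := by
  set S : Set ℝ := {t | t ∈ Icc a b ∧ R a t} with hS
  have haS : a ∈ S := by
    obtain ⟨δ, hδ, h⟩ := loc a ⟨le_rfl, hab⟩
    exact ⟨⟨le_rfl, hab⟩, h a a le_rfl le_rfl hab (by linarith) (by linarith)⟩
  have hbdd : BddAbove S := ⟨b, fun t ht => ht.1.2⟩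
  have hc : sSup S ∈ Icc a b := ⟨le_csSup hbdd haS, csSup_le ⟨a, haS⟩ fun t ht => ht.1.2⟩
  obtain ⟨δ, hδ, h⟩ := loc _ hc
  obtain ⟨t, htS, ht⟩ := exists_lt_of_lt_csSup ⟨a, haS⟩ (show sSup S - δ < sSup S by linarith)
  have htc : t ≤ sSup S := le_csSup hbdd htS
  -- The relation is pushed past the supremum: either this contradicts maximality, or the minimum is
  -- `b`.
  have key : R a (min (sSup S + δ / 2) b) := by
    have h1 : t ≤ min (sSup S + δ / 2) b := le_min (by linarith) htS.1.2
    refine trans a t _ le_rfl htS.1.1 h1 (min_le_right _ _) htS.2 ?_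
    exact h t _ htS.1.1 h1 (min_le_right _ _) ht ((min_le_left _ _).trans_lt (by linarith))
  rcases le_total (sSup S + δ / 2) b with h2 | h2
  · rw [min_eq_left h2] at key
    have : sSup S + δ / 2 ≤ sSup S := le_csSup hbdd ⟨⟨by linarith [hc.1], h2⟩, key⟩
    linarith
  · rwa [min_eq_right h2] at key

/-! ### Curves of dominated variation and the fundamental theorem of calculus -/

/-- The increments of `f` on `[a, b]` are dominated by the integrals of an integrable function. -/
def HasDominatedVariation {X : Type*} [PseudoMetricSpace X] (f : ℝ → X) (a b : ℝ) : Prop :=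
  ∃ c : ℝ → ℝ, (∀ t, 0 ≤ c t) ∧ IntegrableOn c (Icc a b) ∧
    ∀ x y, a ≤ x → x ≤ y → y ≤ b → dist (f x) (f y) ≤ ∫ t in x..y, c t

theorem intervalIntegrable_of_integrableOn_Icc {E : Type*} [NormedAddCommGroup E] {c : ℝ → E}
    {a b x y : ℝ} (h : IntegrableOn c (Icc a b)) (hx : x ∈ Icc a b) (hy : y ∈ Icc a b) :
    IntervalIntegrable c volume x y := by
  rw [intervalIntegrable_iff']
  exact h.mono_set (uIcc_subset_Icc hx hy)

namespace HasDominatedVariation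

variable {X Y : Type*} [PseudoMetricSpace X] [PseudoMetricSpace Y] {f g : ℝ → X} {a b : ℝ}

theorem mono (h : HasDominatedVariation f a b) {a' b' : ℝ} (ha : a ≤ a') (hb : b' ≤ b) :
    HasDominatedVariation f a' b' := by
  obtain ⟨c, hc0, hc, hle⟩ := h
  exact ⟨c, hc0, hc.mono_set (Icc_subset_Icc ha hb), fun x y hx hxy hy =>
    hle x y (ha.trans hx) hxy (hy.trans hb)⟩

theorem congr (h : HasDominatedVariation f a b) (hfg : EqOn f g (Icc a b)) :
    HasDominatedVariation g a b := by
  obtain ⟨c, hc0, hc, hle⟩ := h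
  refine ⟨c, hc0, hc, fun x y hx hxy hy => ?_⟩
  rw [← hfg ⟨hx, hxy.trans hy⟩, ← hfg ⟨hx.trans hxy, hy⟩]
  exact hle x y hx hxy hy

theorem trans {m : ℝ} (h : HasDominatedVariation f a m) (h' : HasDominatedVariation f m b) :
    HasDominatedVariation f a b := by
  obtain ⟨c, hc0, hc, hle⟩ := h
  obtain ⟨c', hc0', hc', hle'⟩ := h'
  -- Extension by zero gives one integrable function on the line; the sum dominates each piece where
  -- that piece is needed.
  set C : ℝ → ℝ := (Icc a m).indicator c + (Icc m b).indicator c' with hC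
  have i1 : Integrable ((Icc a m).indicator c) := (integrable_indicator_iff measurableSet_Icc).2 hc
  have i2 : Integrable ((Icc m b).indicator c') :=
    (integrable_indicator_iff measurableSet_Icc).2 hc'
  have hCi : Integrable C := i1.add i2
  have hC0 : ∀ t, 0 ≤ C t := fun t =>
    add_nonneg (indicator_nonneg (fun t _ => hc0 t) t) (indicator_nonneg (fun t _ => hc0' t) t)
  have k1 : ∀ x y, a ≤ x → x ≤ y → y ≤ m → dist (f x) (f y) ≤ ∫ t in x..y, C t := by
    intro x y hx hxy hy
    refine (hle x y hx hxy hy).trans (intervalIntegral.integral_mono_on hxy ?_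
      hCi.intervalIntegrable fun t ht => ?_)
    · exact intervalIntegrable_of_integrableOn_Icc hc ⟨hx, hxy.trans hy⟩ ⟨hx.trans hxy, hy⟩
    · have : (Icc a m).indicator c t = c t :=
        indicator_of_mem (mem_Icc.2 ⟨hx.trans ht.1, ht.2.trans hy⟩) _
      simp only [hC, Pi.add_apply, this]
      exact le_add_of_nonneg_right (indicator_nonneg (fun t _ => hc0' t) t)
  have k2 : ∀ x y, m ≤ x → x ≤ y → y ≤ b → dist (f x) (f y) ≤ ∫ t in x..y, C t := by
    intro x y hx hxy hy
    refine (hle' x y hx hxy hy).trans (intervalIntegral.integral_mono_on hxy ?_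
      hCi.intervalIntegrable fun t ht => ?_)
    · exact intervalIntegrable_of_integrableOn_Icc hc' ⟨hx, hxy.trans hy⟩ ⟨hx.trans hxy, hy⟩
    · have : (Icc m b).indicator c' t = c' t :=
        indicator_of_mem (mem_Icc.2 ⟨hx.trans ht.1, ht.2.trans hy⟩) _
      simp only [hC, Pi.add_apply, this]
      exact le_add_of_nonneg_left (indicator_nonneg (fun t _ => hc0 t) t)
  refine ⟨C, hC0, hCi.integrableOn, fun x y hx hxy hy => ?_⟩
  rcases le_total y m with h1 | h1
  · exact k1 x y hx hxy h1
  rcases le_total m x with h2 | h2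
  · exact k2 x y h2 hxy hy
  refine (dist_triangle _ (f m) _).trans ((add_le_add (k1 x m hx h2 le_rfl)
    (k2 m y le_rfl h1 hy)).trans_eq ?_)
  exact intervalIntegral.integral_add_adjacent_intervals hCi.intervalIntegrable
    hCi.intervalIntegrable

theorem of_locally (hab : a ≤ b) (loc : ∀ t ∈ Icc a b, ∃ δ > 0, ∀ x y, a ≤ x → x ≤ y → y ≤ b →
    t - δ < x → y < t + δ → HasDominatedVariation f x y) : HasDominatedVariation f a b :=
  rel_of_locally hab (fun _ _ _ _ _ _ _ h3 h4 => h3.trans h4) loc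

theorem lipschitz_comp {K : NNReal} {s : Set X} {F : X → Y} (h : HasDominatedVariation f a b)
    (hF : LipschitzOnWith K F s) (hs : MapsTo f (Icc a b) s) :
    HasDominatedVariation (fun t => F (f t)) a b := by
  obtain ⟨c, hc0, hc, hle⟩ := h
  refine ⟨fun t => K * c t, fun t => mul_nonneg K.2 (hc0 t), hc.const_mul _,
    fun x y hx hxy hy => ?_⟩
  rw [intervalIntegral.integral_const_mul]
  exact (hF.dist_le_mul _ (hs ⟨hx, hxy.trans hy⟩) _ (hs ⟨hx.trans hxy, hy⟩)).trans
    (mul_le_mul_of_nonneg_left (hle x y hx hxy hy) K.2)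

theorem prodMk {g : ℝ → Y} (hf : HasDominatedVariation f a b) (hg : HasDominatedVariation g a b) :
    HasDominatedVariation (fun t => (f t, g t)) a b := by
  obtain ⟨c, hc0, hc, hle⟩ := hf
  obtain ⟨c', hc0', hc', hle'⟩ := hg
  refine ⟨fun t => c t + c' t, fun t => add_nonneg (hc0 t) (hc0' t), hc.add hc',
    fun x y hx hxy hy => ?_⟩
  have m1 : x ∈ Icc a b := ⟨hx, hxy.trans hy⟩
  have m2 : y ∈ Icc a b := ⟨hx.trans hxy, hy⟩
  rw [intervalIntegral.integral_add (intervalIntegrable_of_integrableOn_Icc hc m1 m2)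
    (intervalIntegrable_of_integrableOn_Icc hc' m1 m2), Prod.dist_eq]
  have h1 := hle x y hx hxy hy
  have h2 := hle' x y hx hxy hy
  exact max_le (by linarith [dist_nonneg (x := g x) (y := g y)])
    (by linarith [dist_nonneg (x := f x) (y := f y)])

theorem of_integral {E : Type*} [NormedAddCommGroup E] [NormedSpace ℝ E] {f g : ℝ → E}
    (hg : IntegrableOn g (Icc a b))
    (h : ∀ x y, a ≤ x → x ≤ y → y ≤ b → f y - f x = ∫ t in x..y, g t) :
    HasDominatedVariation f a b := by
  refine ⟨fun t => ‖g t‖, fun t => norm_nonneg _, hg.norm, fun x y hx hxy hy => ?_⟩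
  rw [dist_comm, dist_eq_norm, h x y hx hxy hy]
  exact intervalIntegral.norm_integral_le_integral_norm hxy

/-- The primitive of the dominating function is absolutely continuous, and its increments bound
those of `f`. -/
theorem absolutelyContinuousOnInterval (h : HasDominatedVariation f a b) (hab : a ≤ b) :
    AbsolutelyContinuousOnInterval f a b := by
  obtain ⟨c, hc0, hc, hle⟩ := h
  have hi : IntervalIntegrable c volume a b :=
    intervalIntegrable_of_integrableOn_Icc hc ⟨le_rfl, hab⟩ ⟨hab, le_rfl⟩
  have hac := hi.absolutelyContinuousOnInterval_intervalIntegral (c := a) left_mem_uIcc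
  rw [absolutelyContinuousOnInterval_iff] at hac ⊢
  intro ε hε
  obtain ⟨δ, hδ, H⟩ := hac ε hε
  refine ⟨δ, hδ, fun I hI hlt => lt_of_le_of_lt (Finset.sum_le_sum fun i hi' => ?_) (H I hI hlt)⟩
  obtain ⟨m1, m2⟩ := hI.1 i hi'
  rw [uIcc_of_le hab] at m1 m2
  have ha : a ∈ Icc a b := ⟨le_rfl, hab⟩
  rw [dist_comm (∫ v in a..(I.2 i).1, c v), Real.dist_eq,
    intervalIntegral.integral_interval_sub_left
      (intervalIntegrable_of_integrableOn_Icc hc ha m2)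
      (intervalIntegrable_of_integrableOn_Icc hc ha m1)]
  rcases le_total (I.2 i).1 (I.2 i).2 with h1 | h1
  · exact (hle _ _ m1.1 h1 m2.2).trans (le_abs_self _)
  · rw [intervalIntegral.integral_symm, abs_neg, dist_comm]
    exact (hle _ _ m2.1 h1 m1.2).trans (le_abs_self _)

end HasDominatedVariation

namespace AbsolutelyContinuousOnInterval

variable {E : Type*} [NormedAddCommGroup E] {a b : ℝ} {f : ℝ → E}

theorem lipschitz_comp {F : Type*} [NormedAddCommGroup F] {K : NNReal} {g : E → F}
    (hf : AbsolutelyContinuousOnInterval f a b) (hg : LipschitzWith K g) :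
    AbsolutelyContinuousOnInterval (fun t => g (f t)) a b := by
  rw [absolutelyContinuousOnInterval_iff] at hf ⊢
  intro ε hε
  obtain ⟨δ, hδ, H⟩ := hf (ε / (K + 1)) (by positivity)
  refine ⟨δ, hδ, fun I hI hlt => ?_⟩
  calc _ ≤ ∑ i ∈ Finset.range I.1, K * dist (f (I.2 i).1) (f (I.2 i).2) :=
        Finset.sum_le_sum fun i _ => hg.dist_le_mul _ _
    _ = K * ∑ i ∈ Finset.range I.1, dist (f (I.2 i).1) (f (I.2 i).2) := by rw [Finset.mul_sum]
    _ ≤ K * (ε / (K + 1)) := by gcongr; exact (H I hI hlt).le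
    _ < (K + 1) * (ε / (K + 1)) := by gcongr; linarith
    _ = ε := by field_simp

variable [NormedSpace ℝ E] [FiniteDimensional ℝ E]

/-- Fundamental theorem of calculus for absolutely continuous curves in a finite-dimensional
space. -/
theorem exists_integral_eq (hf : AbsolutelyContinuousOnInterval f a b) (hab : a ≤ b) :
    ∃ g : ℝ → E, IntegrableOn g (Icc a b) ∧
      (∀ x ∈ Icc a b, ∀ y ∈ Icc a b, f y - f x = ∫ t in x..y, g t) ∧
      ∀ t v, HasDerivAt f v t → g t = v := by
  set B := Module.finBasis ℝ E
  set l : Fin (Module.finrank ℝ E) → E →L[ℝ] ℝ := fun i => (B.coord i).toContinuousLinearMap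
  have hl : ∀ v : E, ∑ i, l i v • B i = v := fun v => B.sum_repr v
  have hac : ∀ i, AbsolutelyContinuousOnInterval (fun t => l i (f t)) a b := fun i =>
    hf.lipschitz_comp (l i).lipschitz
  have hint : ∀ i, IntegrableOn (deriv fun t => l i (f t)) (Icc a b) := fun i => by
    rw [← uIcc_of_le hab, ← intervalIntegrable_iff']
    exact (hac i).intervalIntegrable_deriv
  have hint' : ∀ i, IntegrableOn (fun t => deriv (fun t => l i (f t)) t • B i) (Icc a b) :=
    fun i => (hint i).smul_const _
  -- Differentiating coordinate by coordinate reduces to the scalar case. Where `f` is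
  -- differentiable the sum is its derivative; elsewhere `deriv` may take its default value 0, which
  -- does no harm.
  refine ⟨fun t => ∑ i, deriv (fun t => l i (f t)) t • B i,
    integrable_finsetSum _ fun i _ => hint' i, fun x hx y hy => ?_, fun t v hv => ?_⟩
  · rw [intervalIntegral.integral_finsetSum
      fun i _ => intervalIntegrable_of_integrableOn_Icc (hint' i) hx hy, ← hl (f y - f x)]
    refine Finset.sum_congr rfl fun i _ => ?_
    rw [intervalIntegral.integral_smul_const, ((hac i).mono ?_).integral_deriv_eq_sub, map_sub]
    rw [uIcc_of_le hab]
    exact uIcc_subset_Icc hx hy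
  · conv_rhs => rw [← hl v]
    refine Finset.sum_congr rfl fun i _ => ?_
    have := ((l i).hasFDerivAt.comp_hasDerivAt t hv).deriv
    exact congrArg (· • B i) this

theorem hasDominatedVariation (hf : AbsolutelyContinuousOnInterval f a b) (hab : a ≤ b) :
    HasDominatedVariation f a b := by
  obtain ⟨g, hg, h, -⟩ := hf.exists_integral_eq hab
  exact .of_integral hg fun x y hx hxy hy => h x ⟨hx, hxy.trans hy⟩ y ⟨hx.trans hxy, hy⟩

end AbsolutelyContinuousOnInterval

theorem HasDominatedVariation.integral_eq_sub {E : Type*} [NormedAddCommGroup E] [NormedSpace ℝ E]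
    [FiniteDimensional ℝ E] {f g : ℝ → E} {a b : ℝ} (h : HasDominatedVariation f a b)
    (hab : a ≤ b) (hg : ∀ᵐ t ∂volume.restrict (Icc a b), HasDerivAt f (g t) t) :
    IntegrableOn g (Icc a b) ∧
      ∀ x ∈ Icc a b, ∀ y ∈ Icc a b, f y - f x = ∫ t in x..y, g t := by
  obtain ⟨g', hg', h1, h2⟩ := (h.absolutelyContinuousOnInterval hab).exists_integral_eq hab
  have hae : g' =ᵐ[volume.restrict (Icc a b)] g := by
    filter_upwards [hg] with t ht using h2 t _ ht
  refine ⟨hg'.congr hae, fun x hx y hy => (h1 x hx y hy).trans ?_⟩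
  refine intervalIntegral.integral_congr_ae_restrict ?_
  exact ae_restrict_of_ae_restrict_of_subset
    (uIoc_subset_uIcc.trans (uIcc_subset_Icc hx hy)) hae

/-! ### Cauchy estimates and holomorphic dependence on parameters -/

section ParametricODE

variable {E : Type*} [NormedAddCommGroup E] [NormedSpace ℂ E]

open Metric

/-- Cauchy's estimate on the ball of radius `r` about `x`, which `f` maps into the closed ball of
radius `2 * C` about `f x`. -/
theorem norm_fderiv_le_of_differentiableOn_ball {F : Type*} [NormedAddCommGroup F]
    [NormedSpace ℂ F] {f : E → F} {e₀ : E} {ρ r C : ℝ} (hr : 0 < r)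
    (hf : DifferentiableOn ℂ f (ball e₀ (ρ + r))) (hC : ∀ e ∈ ball e₀ (ρ + r), ‖f e‖ ≤ C) :
    ∀ x ∈ ball e₀ ρ, ‖fderiv ℂ f x‖ ≤ 2 * C / r := by
  intro x hx
  have hsub : ball x r ⊆ ball e₀ (ρ + r) := ball_subset_ball' (by
    rw [mem_ball] at hx; linarith)
  refine Complex.norm_fderiv_le_div_of_mapsTo_ball (hf.mono hsub) (fun y hy => ?_) hr
  rw [mem_closedBall, dist_eq_norm]
  have h1 := hC y (hsub hy)
  have h2 := hC x (hsub (mem_ball_self hr))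
  linarith [norm_sub_le (f y) (f x)]

/-- This is where holomorphy replaces a Lipschitz hypothesis: a sup bound on a larger ball controls
the Lipschitz constant on the smaller one. -/
theorem norm_sub_le_of_differentiableOn_ball {F : Type*} [NormedAddCommGroup F]
    [NormedSpace ℂ F] {f : E → F} {e₀ : E} {ρ r C : ℝ} (hr : 0 < r)
    (hf : DifferentiableOn ℂ f (ball e₀ (ρ + r))) (hC : ∀ e ∈ ball e₀ (ρ + r), ‖f e‖ ≤ C)
    {x y : E} (hx : x ∈ ball e₀ ρ) (hy : y ∈ ball e₀ ρ) :
    ‖f y - f x‖ ≤ 2 * C / r * ‖y - x‖ := by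
  refine (convex_ball e₀ ρ).norm_image_sub_le_of_norm_fderiv_le (𝕜 := ℂ) (fun z hz => ?_)
    (norm_fderiv_le_of_differentiableOn_ball hr hf hC) hx hy
  exact hf.differentiableAt (isOpen_ball.mem_nhds (ball_subset_ball (by linarith) hz))

/-- A uniform limit of holomorphic functions on a ball of a normed space is holomorphic. -/
theorem differentiableOn_ball_of_tendstoUniformlyOn {F : Type*} [NormedAddCommGroup F]
    [NormedSpace ℂ F] [CompleteSpace F] {f : ℕ → E → F} {g : E → F} {e₀ : E} {ρ : ℝ}
    (hf : ∀ n, DifferentiableOn ℂ (f n) (ball e₀ ρ))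
    (h : TendstoUniformlyOn f g atTop (ball e₀ ρ)) : DifferentiableOn ℂ g (ball e₀ ρ) := by
  intro x hx
  obtain ⟨r, hr, hrρ⟩ : ∃ r > 0, ball x (r + r) ⊆ ball e₀ ρ := by
    obtain ⟨r, hr, h⟩ := Metric.isOpen_iff.1 isOpen_ball x hx
    exact ⟨r / 2, by linarith, by simpa using h⟩
  have hsmall : ball x r ⊆ ball e₀ ρ := (ball_subset_ball (by linarith)).trans hrρ
  have hf' : ∀ n, DifferentiableOn ℂ (f n) (ball x (r + r)) := fun n => (hf n).mono hrρ
  -- Cauchy's estimate applied to the differences `f m - f n` makes the derivatives converge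
  -- uniformly on a smaller ball.
  have hcauchy : UniformCauchySeqOn (fun n => fderiv ℂ (f n)) atTop (ball x r) := by
    have hc := (h.mono hrρ).uniformCauchySeqOn
    rw [Metric.uniformCauchySeqOn_iff] at hc ⊢
    intro ε hε
    obtain ⟨N, hN⟩ := hc (ε * r / 4) (by positivity)
    refine ⟨N, fun m hm n hn y hy => ?_⟩
    have hd : ∀ k, DifferentiableAt ℂ (f k) y := fun k =>
      (hf k).differentiableAt (isOpen_ball.mem_nhds (hsmall hy))
    rw [dist_eq_norm, ← fderiv_sub (hd m) (hd n)]
    refine (norm_fderiv_le_of_differentiableOn_ball (C := ε * r / 4) hr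
      ((hf' m).sub (hf' n)) (fun e he => ?_) y hy).trans_lt ?_
    · rw [Pi.sub_apply, ← dist_eq_norm]
      exact (hN m hm n hn e he).le
    · rw [show 2 * (ε * r / 4) / r = ε / 2 by field_simp; norm_num]
      linarith
  have hpt : ∀ y ∈ ball x r, ∃ l, Tendsto (fun n => fderiv ℂ (f n) y) atTop (𝓝 l) :=
    fun y hy => cauchySeq_tendsto_of_complete (hcauchy.cauchy_map hy)
  choose! g' hg' using hpt
  have hlim : TendstoUniformlyOn (fun n => fderiv ℂ (f n)) g' atTop (ball x r) :=
    hcauchy.tendstoUniformlyOn_of_tendsto hg'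
  refine (hasFDerivAt_of_tendstoUniformlyOn (f := f) isOpen_ball hlim (fun n y hy => ?_)
    (fun y hy => ?_) (mem_ball_self hr)).differentiableAt.differentiableWithinAt
  · exact ((hf n).differentiableAt (isOpen_ball.mem_nhds (hsmall hy))).hasFDerivAt
  · exact h.tendsto_at (hsmall hy)

theorem aestronglyMeasurable_clm_of_apply {α F : Type*} [MeasurableSpace α] {μ : Measure α}
    [FiniteDimensional ℂ E] [NormedAddCommGroup F] [NormedSpace ℂ F] {L : α → E →L[ℂ] F}
    (h : ∀ e, AEStronglyMeasurable (fun a => L a e) μ) : AEStronglyMeasurable L μ := by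
  set B := Module.finBasis ℂ E
  have : L = fun a => ∑ i, (ContinuousLinearMap.smulRightL ℂ E F
      (B.coord i).toContinuousLinearMap) (L a (B i)) := by
    funext a
    ext e
    conv_lhs => rw [← B.sum_repr e]
    simp [-Module.Basis.sum_repr]
  rw [this]
  exact Finset.aestronglyMeasurable_fun_sum _ fun i _ =>
    (ContinuousLinearMap.continuous _).comp_aestronglyMeasurable (h _)

/-- Holomorphy of an integral depending on a parameter. -/
theorem differentiableOn_integral_ball {α F : Type*} [MeasurableSpace α] {μ : Measure α}
    [FiniteDimensional ℂ E] [NormedAddCommGroup F] [NormedSpace ℂ F]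
    {f : E → α → F} {C : α → ℝ} {e₀ : E} {ρ : ℝ} (hC : Integrable C μ)
    (hmeas : ∀ e ∈ ball e₀ ρ, AEStronglyMeasurable (f e) μ)
    (hf : ∀ᵐ a ∂μ, DifferentiableOn ℂ (fun e => f e a) (ball e₀ ρ) ∧
      ∀ e ∈ ball e₀ ρ, ‖f e a‖ ≤ C a) :
    DifferentiableOn ℂ (fun e => ∫ a, f e a ∂μ) (ball e₀ ρ) := by
  intro x hx
  obtain ⟨r, hr, hrρ⟩ : ∃ r > 0, ball x (r + r) ⊆ ball e₀ ρ := by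
    obtain ⟨r, hr, h⟩ := Metric.isOpen_iff.1 isOpen_ball x hx
    exact ⟨r / 2, by linarith, by simpa using h⟩
  have hsmall : ball x r ⊆ ball e₀ ρ := (ball_subset_ball (by linarith)).trans hrρ
  have hdiff : ∀ᵐ a ∂μ, ∀ y ∈ ball x r,
      HasFDerivAt (fun e => f e a) (fderiv ℂ (fun e => f e a) y) y := by
    filter_upwards [hf] with a ha y hy
    exact (ha.1.differentiableAt (isOpen_ball.mem_nhds (hsmall hy))).hasFDerivAt
  refine (hasFDerivAt_integral_of_dominated_of_fderiv_le (s := ball x r)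
    (F' := fun y a => fderiv ℂ (fun e => f e a) y) (bound := fun a => 2 * C a / r)
    (ball_mem_nhds x hr) ?_ ?_ ?_ ?_ ?_ hdiff).differentiableAt.differentiableWithinAt
  · filter_upwards [isOpen_ball.mem_nhds hx] with y hy using hmeas y hy
  · refine hC.mono' (hmeas x hx) ?_
    filter_upwards [hf] with a ha using ha.2 x hx
  · refine aestronglyMeasurable_clm_of_apply fun e => ?_
    have hc : Tendsto (fun n : ℕ => ‖((n : ℂ) + 1)‖) atTop atTop := by
      have : (fun n : ℕ => ‖((n : ℂ) + 1)‖) = fun n : ℕ => ((n + 1 : ℕ) : ℝ) := by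
        funext n
        rw [← Nat.cast_add_one, Complex.norm_natCast]
      rw [this]
      exact (tendsto_natCast_atTop_atTop (R := ℝ)).comp (tendsto_add_atTop_nat 1)
    have hev : ∀ᶠ n : ℕ in atTop, x + ((n : ℂ) + 1)⁻¹ • e ∈ ball e₀ ρ := by
      have : Tendsto (fun n : ℕ => x + ((n : ℂ) + 1)⁻¹ • e) atTop (𝓝 (x + (0 : ℂ) • e)) :=
        tendsto_const_nhds.add (((tendsto_inv₀_cobounded.comp
          (tendsto_norm_atTop_iff_cobounded.1 hc)).smul_const e))
      refine this.eventually_mem ?_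
      simpa using isOpen_ball.mem_nhds hx
    -- Measurability of the derivative: in each direction it is a limit of difference quotients with
    -- steps `1 / (n + 1)`. The shift by `N` keeps all the points inside the ball.
    obtain ⟨N, hN⟩ := eventually_atTop.1 hev
    refine aestronglyMeasurable_of_tendsto_ae atTop
      (f := fun (n : ℕ) a => (((n + N : ℕ) : ℂ) + 1) •
        (f (x + (((n + N : ℕ) : ℂ) + 1)⁻¹ • e) a - f x a)) (fun n => ?_) ?_
    · exact ((hmeas _ (hN _ (by omega))).sub (hmeas x hx)).const_smul _
    · filter_upwards [hdiff] with a ha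
      exact (ha x (mem_ball_self hr)).lim e (hc.comp (tendsto_add_atTop_nat N))
  · filter_upwards [hf] with a ha y hy
    exact norm_fderiv_le_of_differentiableOn_ball hr (ha.1.mono hrρ)
      (fun e he => ha.2 e (hrρ he)) y hy
  · exact (hC.const_mul 2).div_const r

end ParametricODE

/-! ### Measurability along a curve -/

section Caratheodory

variable {X F : Type*} [TopologicalSpace X] [NormedAddCommGroup F]

theorem tendsto_floor_mul_div (t : ℝ) :
    Tendsto (fun n : ℕ => (⌊t * ((n : ℝ) + 1)⌋ : ℝ) / ((n : ℝ) + 1)) atTop (𝓝 t) := by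
  have h1 : Tendsto (fun n : ℕ => (n : ℝ) + 1) atTop atTop :=
    tendsto_atTop_add_const_right _ _ tendsto_natCast_atTop_atTop
  have h2 : Tendsto (fun n : ℕ => t - 1 / ((n : ℝ) + 1)) atTop (𝓝 (t - 0)) :=
    tendsto_const_nhds.sub tendsto_one_div_add_atTop_nhds_zero_nat
  rw [sub_zero] at h2
  refine tendsto_of_tendsto_of_tendsto_of_le_of_le h2 tendsto_const_nhds (fun n => ?_) fun n => ?_
  · have hn : (0 : ℝ) < (n : ℝ) + 1 := by positivity
    have := Int.lt_floor_add_one (t * ((n : ℝ) + 1))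
    show t - 1 / ((n : ℝ) + 1) ≤ _
    rw [sub_le_iff_le_add, ← add_div, le_div_iff₀ hn]
    exact this.le
  · have hn : (0 : ℝ) < (n : ℝ) + 1 := by positivity
    show _ / _ ≤ t
    rw [div_le_iff₀ hn]
    exact Int.floor_le _

/-- Superposition of a Carathéodory function with a continuous curve. -/
theorem aestronglyMeasurable_superposition {μ : Measure ℝ} {v : ℝ → X → F} {Ω : Set X}
    (hmeas : ∀ e ∈ Ω, AEStronglyMeasurable (fun t => v t e) μ)
    (hcont : ∀ᵐ t ∂μ, ContinuousOn (v t) Ω) {x : ℝ → X} (hx : Continuous x)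
    (hxΩ : ∀ t, x t ∈ Ω) : AEStronglyMeasurable (fun t => v t (x t)) μ := by
  refine aestronglyMeasurable_of_tendsto_ae atTop
    (f := fun (n : ℕ) t => v t (x ((⌊t * ((n : ℝ) + 1)⌋ : ℝ) / ((n : ℝ) + 1)))) (fun n => ?_) ?_
  · have hU : (⋃ k : ℤ, (fun t : ℝ => ⌊t * ((n : ℝ) + 1)⌋) ⁻¹' {k}) = univ := by
      ext t; simp
    rw [← Measure.restrict_univ (μ := μ), ← hU, aestronglyMeasurable_iUnion_iff]
    intro k
    refine ((hmeas (x ((k : ℝ) / ((n : ℝ) + 1))) (hxΩ _)).mono_measure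
      Measure.restrict_le_self).congr ?_
    have hm : MeasurableSet ((fun t : ℝ => ⌊t * ((n : ℝ) + 1)⌋) ⁻¹' {k}) :=
      (Int.measurable_floor.comp (measurable_id.mul_const _)) (measurableSet_singleton k)
    filter_upwards [ae_restrict_mem hm] with t ht
    have : ⌊t * ((n : ℝ) + 1)⌋ = k := ht
    simp only [this]
  · filter_upwards [hcont] with t ht
    have h1 : Tendsto (fun n : ℕ => x ((⌊t * ((n : ℝ) + 1)⌋ : ℝ) / ((n : ℝ) + 1))) atTop
        (𝓝[Ω] (x t)) := tendsto_nhdsWithin_iff.2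
      ⟨(hx.tendsto t).comp (tendsto_floor_mul_div t), Eventually.of_forall fun n => hxΩ _⟩
    exact (ht (x t) (hxΩ t)).tendsto.comp h1

theorem aestronglyMeasurable_superposition_Icc {v : ℝ → X → F} {Ω : Set X} {α β : ℝ}
    (hαβ : α ≤ β) (hmeas : ∀ e ∈ Ω, AEStronglyMeasurable (fun t => v t e)
      (volume.restrict (Icc α β)))
    (hcont : ∀ᵐ t ∂volume.restrict (Icc α β), ContinuousOn (v t) Ω) {x : ℝ → X}
    (hx : ContinuousOn x (Icc α β)) (hxΩ : MapsTo x (Icc α β) Ω) :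
    AEStronglyMeasurable (fun t => v t (x t)) (volume.restrict (Icc α β)) := by
  refine (aestronglyMeasurable_superposition hmeas hcont
    (continuousOn_iff_continuous_domRestrict.1 hx |>.comp (continuous_projIcc (h := hαβ)))
    fun t => hxΩ (projIcc α β hαβ t).2).congr ?_
  filter_upwards [ae_restrict_mem measurableSet_Icc] with t ht
  simp [projIcc_of_mem hαβ ht]

end Caratheodory

/-! ### Picard iteration for Carathéodory equations -/

section Picard

open Metric

variable {E : Type*} [NormedAddCommGroup E] [NormedSpace ℂ E]

/-- Picard iteration for the integral equation `x(t) = z + ∫_α^t v(τ, x(τ)) dτ`. -/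
noncomputable def picardIterate (v : ℝ → E → E) (α : ℝ) : ℕ → E → ℝ → E
  | 0, z, _ => z
  | n + 1, z, t => z + ∫ τ in α..t, v τ (picardIterate v α n z τ)

variable {v : ℝ → E → E} {C : ℝ → ℝ} {e₀ : E} {r α β : ℝ}

/-- Local existence and holomorphic dependence on the initial value for a Carathéodory
differential equation with holomorphic right-hand side. -/
theorem exists_holomorphic_local_flow [FiniteDimensional ℂ E] (hαβ : α ≤ β) (hr : 0 < r)
    (hC0 : ∀ t, 0 ≤ C t) (hC : IntegrableOn C (Icc α β)) (hsmall : ∫ t in α..β, C t ≤ r / 4)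
    (hmeas : ∀ e ∈ ball e₀ (2 * r + r), AEStronglyMeasurable (fun t => v t e)
      (volume.restrict (Icc α β)))
    (hv : ∀ᵐ t ∂volume.restrict (Icc α β), DifferentiableOn ℂ (v t) (ball e₀ (2 * r + r)) ∧
      ∀ e ∈ ball e₀ (2 * r + r), ‖v t e‖ ≤ C t) :
    ∃ X : E → ℝ → E, (∀ z ∈ ball e₀ r, X z α = z ∧ ContinuousOn (X z) (Icc α β) ∧
        MapsTo (X z) (Icc α β) (ball e₀ (2 * r)) ∧
        IntegrableOn (fun t => v t (X z t)) (Icc α β) ∧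
        ∀ t ∈ Icc α β, X z t = z + ∫ τ in α..t, v τ (X z τ)) ∧
      ∀ t ∈ Icc α β, DifferentiableOn ℂ (fun z => X z t) (ball e₀ r) := by
  have hsub : ball e₀ (2 * r) ⊆ ball e₀ (2 * r + r) := ball_subset_ball (by linarith)
  have hαm : α ∈ Icc α β := ⟨le_rfl, hαβ⟩
  have hCle : ∀ t ∈ Icc α β, ∫ τ in α..t, C τ ≤ r / 4 := fun t ht =>
    (intervalIntegral.integral_mono_interval le_rfl ht.1 ht.2
      (Eventually.of_forall hC0) (intervalIntegrable_of_integrableOn_Icc hC hαm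
        ⟨hαβ, le_rfl⟩)).trans hsmall
  have hCi : ∀ t ∈ Icc α β, IntervalIntegrable C volume α t := fun t ht =>
    intervalIntegrable_of_integrableOn_Icc hC hαm ht
  -- superposition with an admissible curve
  have hint : ∀ x : ℝ → E, ContinuousOn x (Icc α β) → MapsTo x (Icc α β) (ball e₀ (2 * r)) →
      IntegrableOn (fun t => v t (x t)) (Icc α β) := by
    intro x hx hxm
    refine Integrable.mono' hC (aestronglyMeasurable_superposition_Icc hαβ
      (fun e he => hmeas e (hsub he)) ?_ hx hxm) ?_
    · filter_upwards [hv] with t ht using ht.1.continuousOn.mono hsub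
    · filter_upwards [hv, ae_restrict_mem measurableSet_Icc] with t ht htm
      exact ht.2 _ (hsub (hxm htm))
  have hbound : ∀ x : ℝ → E, MapsTo x (Icc α β) (ball e₀ (2 * r)) → ∀ t ∈ Icc α β,
      ‖∫ τ in α..t, v τ (x τ)‖ ≤ r / 4 := by
    intro x hxm t ht
    refine (intervalIntegral.norm_integral_le_of_norm_le ht.1 ?_ (hCi t ht)).trans (hCle t ht)
    have h2 := (ae_restrict_iff' measurableSet_Icc).1 hv
    filter_upwards [h2] with τ hτ hm
    have hm' : τ ∈ Icc α β := ⟨hm.1.le, hm.2.trans ht.2⟩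
    exact (hτ hm').2 _ (hsub (hxm hm'))
  set P := picardIterate v α with hP
  have hPs : ∀ n z t, P (n + 1) z t = z + ∫ τ in α..t, v τ (P n z τ) := fun _ _ _ => rfl
  -- The radii: values start within `r` and move by at most `r / 4`, hence stay within `2 * r`. The
  -- outer collar of width `r` is reserved for Cauchy's estimate.
  have hzr : ∀ z ∈ ball e₀ r, ∀ y : E, ‖y - z‖ ≤ r / 4 → y ∈ ball e₀ (2 * r) := by
    intro z hz y hy
    rw [mem_ball] at hz ⊢
    rw [← dist_eq_norm] at hy
    linarith [dist_triangle y z e₀]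
  have hPprop : ∀ z ∈ ball e₀ r, ∀ n, ContinuousOn (P n z) (Icc α β) ∧
      MapsTo (P n z) (Icc α β) (ball e₀ (2 * r)) := by
    intro z hz n
    induction n with
    | zero =>
      refine ⟨continuousOn_const, fun t _ => hzr z hz _ ?_⟩
      show ‖z - z‖ ≤ _
      rw [sub_self, norm_zero]; positivity
    | succ n ih =>
      refine ⟨?_, fun t ht => hzr z hz _ ?_⟩
      · refine continuousOn_const.add ?_
        have := intervalIntegral.continuousOn_primitive_interval
          (a := α) (b := β) (f := fun τ => v τ (P n z τ)) (μ := volume)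
          (by rw [uIcc_of_le hαβ]; exact hint _ ih.1 ih.2)
        rwa [uIcc_of_le hαβ] at this
      · rw [hPs, add_sub_cancel_left]
        exact hbound _ ih.2 t ht
  -- The contraction factor is 1/2: the Lipschitz constant `2 * C τ / r` has integral at most `2 / r
  -- * (r / 4)`.
  have hgeo : ∀ z ∈ ball e₀ r, ∀ n, ∀ t ∈ Icc α β,
      dist (P n z t) (P (n + 1) z t) ≤ r * (1 / 2) ^ n := by
    intro z hz n
    induction n with
    | zero =>
      intro t ht
      rw [dist_comm, dist_eq_norm, hPs]
      show ‖z + _ - z‖ ≤ _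
      rw [add_sub_cancel_left]
      refine (hbound _ (hPprop z hz 0).2 t ht).trans ?_
      simp; linarith
    | succ n ih =>
      intro t ht
      rw [dist_comm, dist_eq_norm, hPs (n + 1), hPs n, add_sub_add_left_eq_sub,
        ← intervalIntegral.integral_sub
          (intervalIntegrable_of_integrableOn_Icc (hint _ (hPprop z hz _).1 (hPprop z hz _).2) hαm ht)
          (intervalIntegrable_of_integrableOn_Icc (hint _ (hPprop z hz _).1 (hPprop z hz _).2) hαm ht)]
      have h2 := (ae_restrict_iff' measurableSet_Icc).1 hv
      refine (intervalIntegral.norm_integral_le_of_norm_le ht.1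
        (g := fun τ => C τ * (2 * (1 / 2) ^ n)) ?_ ((hCi t ht).mul_const _)).trans ?_
      · filter_upwards [h2] with τ hτ hm
        have hm' : τ ∈ Icc α β := ⟨hm.1.le, hm.2.trans ht.2⟩
        refine (norm_sub_le_of_differentiableOn_ball hr (hτ hm').1 (hτ hm').2
          ((hPprop z hz n).2 hm') ((hPprop z hz (n + 1)).2 hm')).trans ?_
        have h3 := ih τ hm'
        rw [dist_comm, dist_eq_norm] at h3
        calc 2 * C τ / r * ‖P (n + 1) z τ - P n z τ‖
            ≤ 2 * C τ / r * (r * (1 / 2) ^ n) := by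
              gcongr; exact div_nonneg (mul_nonneg (by norm_num) (hC0 τ)) hr.le
          _ = C τ * (2 * (1 / 2) ^ n) := by field_simp
      · rw [intervalIntegral.integral_mul_const]
        calc (∫ τ in α..t, C τ) * (2 * (1 / 2) ^ n) ≤ r / 4 * (2 * (1 / 2) ^ n) := by
              gcongr; exact hCle t ht
          _ = r * (1 / 2) ^ (n + 1) := by rw [pow_succ]; ring
  have hlim : ∀ z ∈ ball e₀ r, ∀ t ∈ Icc α β, ∃ l, Tendsto (fun n => P n z t) atTop (𝓝 l) :=
    fun z hz t ht => cauchySeq_tendsto_of_complete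
      (cauchySeq_of_le_geometric (1 / 2) r (by norm_num) fun n => hgeo z hz n t ht)
  choose! X hX using hlim
  have herr : ∀ z ∈ ball e₀ r, ∀ t ∈ Icc α β, ∀ n, dist (P n z t) (X z t) ≤
      r * (1 / 2) ^ n / (1 - 1 / 2) := fun z hz t ht n =>
    dist_le_of_le_geometric_of_tendsto (1 / 2) r (by norm_num) (fun n => hgeo z hz n t ht)
      (hX z hz t ht) n
  have herr0 : Tendsto (fun n : ℕ => r * (1 / 2 : ℝ) ^ n / (1 - 1 / 2)) atTop (𝓝 0) := by
    have := ((tendsto_pow_atTop_nhds_zero_of_lt_one (r := (1 / 2 : ℝ)) (by norm_num)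
      (by norm_num)).const_mul r).div_const (1 - 1 / 2)
    simpa using this
  have hXc : ∀ z ∈ ball e₀ r, ContinuousOn (X z) (Icc α β) := by
    intro z hz
    refine TendstoUniformlyOn.continuousOn (F := fun n => P n z) (p := atTop) ?_
      (Eventually.of_forall fun n => (hPprop z hz n).1).frequently
    rw [Metric.tendstoUniformlyOn_iff]
    intro ε hε
    filter_upwards [herr0.eventually (gt_mem_nhds hε)] with n hn t ht
    rw [dist_comm]
    exact (herr z hz t ht n).trans_lt hn
  have hXm : ∀ z ∈ ball e₀ r, MapsTo (X z) (Icc α β) (ball e₀ (2 * r)) := by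
    intro z hz t ht
    refine hzr z hz _ (le_of_tendsto ((hX z hz t ht).sub_const z).norm ?_)
    filter_upwards [eventually_ge_atTop 1] with n hn
    obtain ⟨n, rfl⟩ := Nat.exists_eq_add_of_le' hn
    rw [hPs, add_sub_cancel_left]
    exact hbound _ (hPprop z hz n).2 t ht
  have hXeq : ∀ z ∈ ball e₀ r, ∀ t ∈ Icc α β, X z t = z + ∫ τ in α..t, v τ (X z τ) := by
    intro z hz t ht
    refine tendsto_nhds_unique ((hX z hz t ht).comp (tendsto_add_atTop_nat 1)) ?_
    refine Tendsto.const_add z ?_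
    have h2 := (ae_restrict_iff' measurableSet_Icc).1 hv
    refine intervalIntegral.tendsto_integral_filter_of_dominated_convergence C
      (Eventually.of_forall fun n => ?_) (Eventually.of_forall fun n => ?_) (hCi t ht) ?_
    · exact (intervalIntegrable_of_integrableOn_Icc
        (hint _ (hPprop z hz n).1 (hPprop z hz n).2) hαm ht).aestronglyMeasurable_restrict_uIoc
    · filter_upwards [h2] with τ hτ hm
      rw [uIoc_of_le ht.1] at hm
      have hm' : τ ∈ Icc α β := ⟨hm.1.le, hm.2.trans ht.2⟩
      exact (hτ hm').2 _ (hsub ((hPprop z hz n).2 hm'))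
    · filter_upwards [h2] with τ hτ hm
      rw [uIoc_of_le ht.1] at hm
      have hm' : τ ∈ Icc α β := ⟨hm.1.le, hm.2.trans ht.2⟩
      exact (((hτ hm').1.continuousOn.continuousAt
        (isOpen_ball.mem_nhds (hsub (hXm z hz hm')))).tendsto).comp (hX z hz τ hm')
  have hPhol : ∀ n, ∀ t ∈ Icc α β, DifferentiableOn ℂ (fun z => P n z t) (ball e₀ r) := by
    intro n
    induction n with
    | zero => exact fun t _ => differentiableOn_id
    | succ n ih =>
      intro t ht
      simp only [hPs]
      refine differentiableOn_id.add ?_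
      simp only [intervalIntegral.integral_of_le ht.1]
      have hle : Ioc α t ⊆ Icc α β := fun τ hτ => ⟨hτ.1.le, hτ.2.trans ht.2⟩
      refine differentiableOn_integral_ball (hC.mono_set hle) (fun z hz => ?_) ?_
      · exact ((hint _ (hPprop z hz n).1 (hPprop z hz n).2).mono_set hle).aestronglyMeasurable
      · filter_upwards [ae_restrict_of_ae_restrict_of_subset hle hv,
          ae_restrict_mem measurableSet_Ioc] with τ hτ hm
        refine ⟨(hτ.1.mono hsub).comp (ih τ (hle hm)) fun z hz => (hPprop z hz n).2 (hle hm),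
          fun z hz => hτ.2 _ (hsub ((hPprop z hz n).2 (hle hm)))⟩
  refine ⟨X, fun z hz => ⟨?_, hXc z hz, hXm z hz, hint _ (hXc z hz) (hXm z hz), hXeq z hz⟩,
    fun t ht => differentiableOn_ball_of_tendstoUniformlyOn (fun n => hPhol n t ht) ?_⟩
  · rw [hXeq z hz α hαm, intervalIntegral.integral_same, add_zero]
  · rw [Metric.tendstoUniformlyOn_iff]
    intro ε hε
    filter_upwards [herr0.eventually (gt_mem_nhds hε)] with n hn z hz
    rw [dist_comm]
    exact (herr z hz t ht n).trans_lt hn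

/-- Two solutions of a Carathéodory differential equation with the same initial value coincide on
a short interval. -/
theorem eqOn_of_integral_equation (hr : 0 < r)
    (hC0 : ∀ t, 0 ≤ C t) (hC : IntegrableOn C (Icc α β)) (hsmall : ∫ t in α..β, C t ≤ r / 4)
    (hv : ∀ᵐ t ∂volume.restrict (Icc α β), DifferentiableOn ℂ (v t) (ball e₀ (2 * r + r)) ∧
      ∀ e ∈ ball e₀ (2 * r + r), ‖v t e‖ ≤ C t) {x y : ℝ → E}
    (hx : ContinuousOn x (Icc α β)) (hy : ContinuousOn y (Icc α β))
    (hxm : MapsTo x (Icc α β) (ball e₀ (2 * r))) (hym : MapsTo y (Icc α β) (ball e₀ (2 * r)))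
    (hxi : IntegrableOn (fun t => v t (x t)) (Icc α β))
    (hyi : IntegrableOn (fun t => v t (y t)) (Icc α β))
    (hxe : ∀ t ∈ Icc α β, x t - x α = ∫ τ in α..t, v τ (x τ))
    (hye : ∀ t ∈ Icc α β, y t - y α = ∫ τ in α..t, v τ (y τ)) (h0 : x α = y α) :
    EqOn x y (Icc α β) := by
  intro t₁ ht₁
  have hαβ : α ≤ β := ht₁.1.trans ht₁.2
  have hαm : α ∈ Icc α β := ⟨le_rfl, hαβ⟩
  -- At a time of maximal separation, the same contraction factor 1/2 bounds the maximum by half of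
  -- itself.
  obtain ⟨m, hm, hmax⟩ := isCompact_Icc.exists_isMaxOn ⟨α, hαm⟩ (hx.sub hy).norm
  have hmax' : ∀ t ∈ Icc α β, ‖x t - y t‖ ≤ ‖x m - y m‖ := fun t ht => hmax ht
  have hkey : ‖x m - y m‖ ≤ 1 / 2 * ‖x m - y m‖ := by
    have h1 : x m - y m = ∫ τ in α..m, (v τ (x τ) - v τ (y τ)) := by
      rw [intervalIntegral.integral_sub (intervalIntegrable_of_integrableOn_Icc hxi hαm hm)
        (intervalIntegrable_of_integrableOn_Icc hyi hαm hm), ← hxe m hm, ← hye m hm, h0]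
      abel
    have hCi : IntervalIntegrable C volume α m := intervalIntegrable_of_integrableOn_Icc hC hαm hm
    have h2 := (ae_restrict_iff' measurableSet_Icc).1 hv
    conv_lhs => rw [h1]
    refine (intervalIntegral.norm_integral_le_of_norm_le hm.1
      (g := fun τ => C τ * (2 / r * ‖x m - y m‖)) ?_ (hCi.mul_const _)).trans ?_
    · filter_upwards [h2] with τ hτ hτm
      have hm' : τ ∈ Icc α β := ⟨hτm.1.le, hτm.2.trans hm.2⟩
      refine (norm_sub_le_of_differentiableOn_ball hr (hτ hm').1 (hτ hm').2
          (hym hm') (hxm hm')).trans ?_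
      rw [show C τ * (2 / r * ‖x m - y m‖) = 2 * C τ / r * ‖x m - y m‖ by ring]
      gcongr
      · exact div_nonneg (mul_nonneg (by norm_num) (hC0 τ)) hr.le
      · exact hmax' τ hm'
    · rw [intervalIntegral.integral_mul_const]
      have h3 : ∫ τ in α..m, C τ ≤ r / 4 :=
        (intervalIntegral.integral_mono_interval le_rfl hm.1 hm.2
          (Eventually.of_forall hC0) (intervalIntegrable_of_integrableOn_Icc hC hαm
            ⟨hαβ, le_rfl⟩)).trans hsmall
      calc (∫ τ in α..m, C τ) * (2 / r * ‖x m - y m‖) ≤ r / 4 * (2 / r * ‖x m - y m‖) := by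
            gcongr
        _ = 1 / 2 * ‖x m - y m‖ := by field_simp; norm_num
  have h4 := hmax' t₁ ht₁
  have h5 : ‖x t₁ - y t₁‖ ≤ 0 := by linarith
  exact sub_eq_zero.1 (norm_le_zero_iff.1 h5)

end Picard

/-! ### Local comparison of the Riemannian distance with a chart -/

section Riemannian

open Manifold Metric Bundle
open scoped NNReal

variable {E : Type*} [NormedAddCommGroup E] [NormedSpace ℝ E]
  {M : Type*} [TopologicalSpace M] [ChartedSpace E M]
  [RiemannianBundle (fun x : M => TangentSpace 𝓘(ℝ, E) x)]
  [IsManifold 𝓘(ℝ, E) 1 M]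
  [IsContinuousRiemannianBundle E (fun x : M => TangentSpace 𝓘(ℝ, E) x)]

attribute [local instance] normedAddCommGroupTangentSpaceVectorSpace
attribute [local instance] normedSpaceTangentSpaceVectorSpace

theorem eventually_enorm_mfderivWithin_symm_extChartAt_apply_le (p : M) : ∃ C > (0 : ℝ≥0),
    ∀ᶠ y in 𝓝[range 𝓘(ℝ, E)] (extChartAt 𝓘(ℝ, E) p p), ∀ v : TangentSpace 𝓘(ℝ, E) y,
      ‖mfderiv[range 𝓘(ℝ, E)] (extChartAt 𝓘(ℝ, E) p).symm y v‖ₑ ≤ C * ‖v‖ₑ := by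
  obtain ⟨C, C_pos, hC⟩ := eventually_enorm_mfderivWithin_symm_extChartAt_lt 𝓘(ℝ, E) p
  refine ⟨C, C_pos, hC.mono fun y hy v => ?_⟩
  exact (ContinuousLinearMap.le_opENorm _ _).trans (mul_le_mul_left hy.le _)

theorem eventually_enorm_mfderiv_extChartAt_apply_le (p : M) : ∃ C > (0 : ℝ≥0),
    ∀ᶠ y in 𝓝 p, ∀ v : TangentSpace 𝓘(ℝ, E) y,
      ‖mfderiv% (extChartAt 𝓘(ℝ, E) p) y v‖ₑ ≤ C * ‖v‖ₑ := by
  obtain ⟨C, C_pos, hC⟩ := eventually_enorm_mfderiv_extChartAt_lt 𝓘(ℝ, E) p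
  refine ⟨C, C_pos, hC.mono fun y hy v => ?_⟩
  exact (ContinuousLinearMap.le_opENorm _ _).trans (mul_le_mul_left hy.le _)

/-- The straight segment in the chart is a competing path, and the inverse chart stretches lengths
by at most a bounded factor near the base point. -/
theorem exists_riemannianEDist_le_edist_chartAt (p : M) :
    ∃ C : ℝ≥0, ∃ W ∈ 𝓝 p, ∀ x ∈ W, ∀ y ∈ W,
      riemannianEDist 𝓘(ℝ, E) x y ≤ C * edist (chartAt E p x) (chartAt E p y) := by
  rcases eventually_enorm_mfderivWithin_symm_extChartAt_apply_le (E := E) p with ⟨C, C_pos, hC⟩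
  obtain ⟨r, r_pos, hr⟩ : ∃ r > 0,
      ball (extChartAt 𝓘(ℝ, E) p p) r ∩ range 𝓘(ℝ, E) ⊆ (extChartAt 𝓘(ℝ, E) p).target ∩
        {y | ∀ v : TangentSpace 𝓘(ℝ, E) y,
          ‖mfderiv[range 𝓘(ℝ, E)] (extChartAt 𝓘(ℝ, E) p).symm y v‖ₑ ≤ C * ‖v‖ₑ} :=
    mem_nhdsWithin_iff.1 (inter_mem (extChartAt_target_mem_nhdsWithin p) hC)
  have A : (extChartAt 𝓘(ℝ, E) p) ⁻¹' (ball (extChartAt 𝓘(ℝ, E) p p) r ∩ range 𝓘(ℝ, E)) ∈ 𝓝 p := by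
    apply extChartAt_preimage_mem_nhds_of_mem_nhdsWithin (by simp)
    rw [inter_comm]
    exact inter_mem_nhdsWithin _ (ball_mem_nhds _ r_pos)
  refine ⟨C, _, inter_mem A (chart_source_mem_nhds E p), fun x hx y hy => ?_⟩
  let η := ContinuousAffineMap.lineMap (R := ℝ) (extChartAt 𝓘(ℝ, E) p x) (extChartAt 𝓘(ℝ, E) p y)
  set γ := (extChartAt 𝓘(ℝ, E) p).symm ∘ η
  have hη : Icc 0 1 ⊆ ⇑η ⁻¹' ((extChartAt 𝓘(ℝ, E) p).target ∩
        {y | ∀ v : TangentSpace 𝓘(ℝ, E) y,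
          ‖mfderiv[range 𝓘(ℝ, E)] (extChartAt 𝓘(ℝ, E) p).symm y v‖ₑ ≤ C * ‖v‖ₑ}) := by
    simp only [← image_subset_iff, ContinuousAffineMap.coe_lineMap_eq,
     ← segment_eq_image_lineMap, η]
    apply Subset.trans _ hr
    exact ((convex_ball _ _).inter 𝓘(ℝ, E).convex_range).segment_subset hx.1 hy.1
  simp only [preimage_inter, subset_inter_iff] at hη
  have η_smooth : CMDiff[Icc 0 1] 1 η := by
    apply ContMDiff.contMDiffOn
    rw [contMDiff_iff_contDiff]
    exact ContinuousAffineMap.contDiff _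
  have : riemannianEDist 𝓘(ℝ, E) x y ≤ pathELength 𝓘(ℝ, E) γ 0 1 := by
    apply riemannianEDist_le_pathELength _ _ _ zero_le_one
    · exact (contMDiffOn_extChartAt_symm p).comp η_smooth hη.1
    · have := hx.2
      simp [γ, η, ContinuousAffineMap.coe_lineMap_eq, this]
    · have := hy.2
      simp [γ, η, ContinuousAffineMap.coe_lineMap_eq, this]
  apply this.trans
  rw [show edist (chartAt E p x) (chartAt E p y) =
      edist (extChartAt 𝓘(ℝ, E) p x) (extChartAt 𝓘(ℝ, E) p y) from rfl,
    ← lintegral_fderiv_lineMap_eq_edist, pathELength_eq_lintegral_mfderivWithin_Icc,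
    ← lintegral_const_mul' _ _ ENNReal.coe_ne_top]
  apply setLIntegral_mono' measurableSet_Icc (fun t ht ↦ ?_)
  have : mfderiv[Icc 0 1] γ t =
      (mfderiv[range 𝓘(ℝ, E)] (extChartAt 𝓘(ℝ, E) p).symm (η t)) ∘L (mfderiv[Icc 0 1] η t) := by
    apply mfderivWithin_comp
    · exact mdifferentiableWithinAt_extChartAt_symm (hη.1 ht)
    · exact η_smooth.mdifferentiableOn one_ne_zero t ht
    · exact hη.1.trans (preimage_mono (extChartAt_target_subset_range p))
    · rw [uniqueMDiffWithinAt_iff_uniqueDiffWithinAt]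
      exact uniqueDiffOn_Icc zero_lt_one t ht
  have : mfderiv[Icc 0 1] γ t 1 =
      (mfderiv[range 𝓘(ℝ, E)] (extChartAt 𝓘(ℝ, E) p).symm (η t)) (mfderiv[Icc 0 1] η t 1) :=
    congr($this 1)
  rw [this]
  refine (hη.2 ht _).trans (le_of_eq ?_)
  simp only [mfderivWithin_eq_fderivWithin]
  rfl

/-- A nearly shortest path between two points close to `p` cannot leave the neighbourhood where the
derivative of the chart is bounded, so its image in the chart has comparable length. -/
theorem exists_edist_chartAt_le_riemannianEDist [RegularSpace M] (p : M) :
    ∃ C : ℝ≥0, ∃ W ∈ 𝓝 p, ∀ x ∈ W, ∀ y ∈ W,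
      edist (chartAt E p x) (chartAt E p y) ≤ C * riemannianEDist 𝓘(ℝ, E) x y := by
  rcases eventually_enorm_mfderiv_extChartAt_apply_le (E := E) p with ⟨C, C_pos, hC⟩
  obtain ⟨c, hc, hcs⟩ := setOfPred_riemannianEDist_lt_subset_nhds 𝓘(ℝ, E)
    (inter_mem hC (chart_source_mem_nhds E p))
  -- With both ends within `c / 4` of `p`, a path of length less than `c / 2` stays within `c / 4 +
  -- c / 2 < c` of `p`.
  have hc4 : (0 : ℝ≥0∞) < ((c / 4 : ℝ≥0) : ℝ≥0∞) := ENNReal.coe_pos.2 (by positivity)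
  refine ⟨C, _, eventually_riemannianEDist_lt 𝓘(ℝ, E) p hc4, fun x hx y hy => ?_⟩
  by_contra! hlt
  have hC0 : (C : ℝ≥0∞) ≠ 0 := by simpa using C_pos.ne'
  have h1 : riemannianEDist 𝓘(ℝ, E) x y <
      edist (chartAt E p x) (chartAt E p y) / C := by
    rwa [ENNReal.lt_div_iff_mul_lt (Or.inl hC0) (Or.inl ENNReal.coe_ne_top), mul_comm]
  have h2 : riemannianEDist 𝓘(ℝ, E) x y < ((c / 2 : ℝ≥0) : ℝ≥0∞) := by
    refine riemannianEDist_triangle (I := 𝓘(ℝ, E)) (y := p) |>.trans_lt ?_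
    rw [riemannianEDist_comm (y := p)]
    refine (ENNReal.add_lt_add hx hy).trans_eq ?_
    rw [← ENNReal.coe_add]
    congr 1
    ext; push_cast; ring
  obtain ⟨r, hr, hr'⟩ := exists_between (lt_min h1 h2)
  obtain ⟨γ, hγ0, hγ1, γ_smooth, hγ⟩ := exists_lt_of_riemannianEDist_lt hr
  have hmem : ∀ t ∈ Icc (0 : ℝ) 1, γ t ∈ {y | ∀ v : TangentSpace 𝓘(ℝ, E) y,
      ‖mfderiv% (extChartAt 𝓘(ℝ, E) p) y v‖ₑ ≤ C * ‖v‖ₑ} ∩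
      (chartAt E p).source := by
    intro t ht
    refine hcs ?_
    have h3 : riemannianEDist 𝓘(ℝ, E) x (γ t) < ((c / 2 : ℝ≥0) : ℝ≥0∞) :=
      calc _ ≤ pathELength 𝓘(ℝ, E) γ 0 t := riemannianEDist_le_pathELength
              (γ_smooth.mono (Icc_subset_Icc le_rfl ht.2)) hγ0 rfl ht.1
        _ ≤ pathELength 𝓘(ℝ, E) γ 0 1 := pathELength_mono le_rfl ht.2
        _ < _ := hγ.trans (hr'.trans_le (min_le_right _ _))
    refine (riemannianEDist_triangle (I := 𝓘(ℝ, E)) (y := x)).trans_lt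
      ((ENNReal.add_lt_add hx h3).trans_le ?_)
    rw [← ENNReal.coe_add]
    refine ENNReal.coe_le_coe.2 ?_
    rw [← NNReal.coe_le_coe]
    push_cast
    have : (0 : ℝ) < c := hc
    linarith
  let γ' := extChartAt 𝓘(ℝ, E) p ∘ γ
  have hC' : CMDiff[Icc 0 1] 1 γ' :=
    contMDiffOn_extChartAt.comp (I' := 𝓘(ℝ, E)) (t := (chartAt E p).source)
      γ_smooth (fun t' ht' ↦ (hmem t' ht').2)
  have hle : ‖γ' 1 - γ' 0‖ₑ ≤ C * pathELength 𝓘(ℝ, E) γ 0 1 := by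
    calc
      ‖γ' 1 - γ' 0‖ₑ
    _ ≤ ∫⁻ t' in Icc 0 1, ‖derivWithin γ' (Icc 0 1) t'‖ₑ := by
      apply enorm_sub_le_lintegral_derivWithin_Icc_of_contDiffOn_Icc _ zero_le_one
      rwa [← contMDiffOn_iff_contDiffOn]
    _ = ∫⁻ t' in Icc 0 1, ‖mfderiv[Icc 0 1] γ' t' 1‖ₑ := by
      simp_rw [← fderivWithin_derivWithin, mfderivWithin_eq_fderivWithin]
      rfl
    _ ≤ ∫⁻ t' in Icc 0 1, C * ‖mfderiv[Icc 0 1] γ t' 1‖ₑ := by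
      apply setLIntegral_mono' measurableSet_Icc (fun t' ht' ↦ ?_)
      have : mfderiv[Icc 0 1] γ' t' =
          (mfderiv% (extChartAt 𝓘(ℝ, E) p) (γ t')) ∘L (mfderiv[Icc 0 1] γ t') := by
        apply mfderiv_comp_mfderivWithin
        · exact mdifferentiableAt_extChartAt (hmem t' ht').2
        · exact γ_smooth.mdifferentiableOn one_ne_zero _ ht'
        · rw [uniqueMDiffWithinAt_iff_uniqueDiffWithinAt]
          exact uniqueDiffOn_Icc zero_lt_one _ ht'
      have : mfderiv[Icc 0 1] γ' t' 1 =
          (mfderiv% (extChartAt 𝓘(ℝ, E) p) (γ t')) (mfderiv[Icc 0 1] γ t' 1) :=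
        congr($this 1)
      rw [this]
      exact (hmem t' ht').1 _
    _ = C * pathELength 𝓘(ℝ, E) γ 0 1 := by
      rw [lintegral_const_mul' _ _ ENNReal.coe_ne_top,
          pathELength_eq_lintegral_mfderivWithin_Icc]
  have hfin : edist (chartAt E p x) (chartAt E p y) ≤ C * r := by
    have h4 : edist (chartAt E p x) (chartAt E p y) = ‖γ' 1 - γ' 0‖ₑ := by
      rw [edist_comm, edist_eq_enorm_sub]
      simp only [γ', Function.comp_apply, hγ0, hγ1]
      rfl
    rw [h4]
    exact hle.trans (by gcongr)
  have h5 := hr'.trans_le (min_le_left _ _)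
  rw [ENNReal.lt_div_iff_mul_lt (Or.inl hC0) (Or.inl ENNReal.coe_ne_top), mul_comm] at h5
  exact absurd hfin (not_le.2 h5)

end Riemannian

namespace HermitianMetric

open Bundle
open scoped NNReal

variable {E : Type*} [NormedAddCommGroup E] [NormedSpace ℂ E]
  {M : Type*} [TopologicalSpace M] [ChartedSpace E M] [IsManifold 𝓘(ℂ, E) ω M]
  (h : HermitianMetric E M)

theorem edist_triangle (x y z : M) : h.edist x z ≤ h.edist x y + h.edist y z := by
  let : RiemannianBundle (fun z : M => TangentSpace 𝓘(ℝ, E) z) :=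
    ⟨h.toContMDiffRiemannianMetric.toRiemannianMetric⟩
  exact Manifold.riemannianEDist_triangle

theorem exists_edist_le_edist_chartAt (p : M) :
    ∃ C : ℝ≥0, ∃ W ∈ 𝓝 p, ∀ x ∈ W, ∀ y ∈ W,
      h.edist x y ≤ C * EDist.edist (chartAt E p x) (chartAt E p y) := by
  let : RiemannianBundle (fun z : M => TangentSpace 𝓘(ℝ, E) z) :=
    ⟨h.toContMDiffRiemannianMetric.toRiemannianMetric⟩
  have : IsManifold 𝓘(ℝ, E) 1 M := .of_le (n := ω) le_top
  have : IsContinuousRiemannianBundle E (fun z : M => TangentSpace 𝓘(ℝ, E) z) :=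
    ⟨⟨h.inner, h.contMDiff.continuous, fun _ _ _ => rfl⟩⟩
  exact exists_riemannianEDist_le_edist_chartAt p

theorem exists_edist_chartAt_le_edist [RegularSpace M] (p : M) :
    ∃ C : ℝ≥0, ∃ W ∈ 𝓝 p, ∀ x ∈ W, ∀ y ∈ W,
      EDist.edist (chartAt E p x) (chartAt E p y) ≤ C * h.edist x y := by
  let : RiemannianBundle (fun z : M => TangentSpace 𝓘(ℝ, E) z) :=
    ⟨h.toContMDiffRiemannianMetric.toRiemannianMetric⟩
  have : IsManifold 𝓘(ℝ, E) 1 M := .of_le (n := ω) le_top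
  have : IsContinuousRiemannianBundle E (fun z : M => TangentSpace 𝓘(ℝ, E) z) :=
    ⟨⟨h.inner, h.contMDiff.continuous, fun _ _ _ => rfl⟩⟩
  exact exists_edist_chartAt_le_riemannianEDist p

theorem exists_edist_lt_subset [RegularSpace M] {p : M} {s : Set M} (hs : s ∈ 𝓝 p) :
    ∃ c > 0, {y | h.edist p y < c} ⊆ s := by
  let : RiemannianBundle (fun z : M => TangentSpace 𝓘(ℝ, E) z) :=
    ⟨h.toContMDiffRiemannianMetric.toRiemannianMetric⟩
  have : IsManifold 𝓘(ℝ, E) 1 M := .of_le (n := ω) le_top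
  have : IsContinuousRiemannianBundle E (fun z : M => TangentSpace 𝓘(ℝ, E) z) :=
    ⟨⟨h.inner, h.contMDiff.continuous, fun _ _ _ => rfl⟩⟩
  exact setOfPred_riemannianEDist_lt_subset_nhds' 𝓘(ℝ, E) hs

/-- The velocity of a curve, read in the chart at `p`, is locally bounded by its length. -/
theorem exists_norm_mfderiv_chartAt_le (p : M) :
    ∃ C > (0 : ℝ), ∃ W ∈ 𝓝 p, ∀ q ∈ W, ∀ v : TangentSpace 𝓘(ℂ, E) q,
      @Norm.norm E _ (mfderiv 𝓘(ℝ, E) 𝓘(ℝ, E) (chartAt E p) q (toRealTangent v)) ≤ C * h.norm v := by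
  let : RiemannianBundle (fun z : M => TangentSpace 𝓘(ℝ, E) z) :=
    ⟨h.toContMDiffRiemannianMetric.toRiemannianMetric⟩
  have : IsManifold 𝓘(ℝ, E) 1 M := .of_le (n := ω) le_top
  have : IsContinuousRiemannianBundle E (fun z : M => TangentSpace 𝓘(ℝ, E) z) :=
    ⟨⟨h.inner, h.contMDiff.continuous, fun _ _ _ => rfl⟩⟩
  obtain ⟨C, hC, hW⟩ := eventually_norm_trivializationAt_lt E
    (fun z : M => TangentSpace 𝓘(ℝ, E) z) p
  refine ⟨C, hC, _, inter_mem hW (chart_source_mem_nhds E p), fun q hq v => ?_⟩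
  have h1 := TangentBundle.continuousLinearMapAt_trivializationAt (I := 𝓘(ℝ, E)) hq.2
  have h2 := ((trivializationAt E (TangentSpace 𝓘(ℝ, E)) p).continuousLinearMapAt ℝ q).le_opNorm
    (toRealTangent v)
  have h3 : ‖toRealTangent v‖ = h.norm v := by
    rw [norm_eq_sqrt_real_inner]
    rfl
  rw [h3] at h2
  have h4 : mfderiv 𝓘(ℝ, E) 𝓘(ℝ, E) (chartAt E p) q (toRealTangent v) =
    (trivializationAt E (TangentSpace 𝓘(ℝ, E)) p).continuousLinearMapAt ℝ q (toRealTangent v) := by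
    rw [h1]; rfl
  rw [h4]
  exact h2.trans (mul_le_mul_of_nonneg_right hq.1.le (Real.sqrt_nonneg _))

end HermitianMetric

/-! ### The Poincaré distance of the disc -/

theorem poincareDist_comm (a b : ℂ) : poincareDist a b = poincareDist b a := by
  unfold poincareDist
  rw [norm_sub_rev a b, ← Complex.norm_conj (1 - (starRingEnd ℂ) b * a)]
  simp [mul_comm]

/-- The difference of the squares is `(1 - ‖a‖ ^ 2) * (1 - ‖b‖ ^ 2)`. -/
theorem norm_sub_lt_norm_one_sub_conj_mul {a b : ℂ} (ha : ‖a‖ < 1) (hb : ‖b‖ < 1) :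
    ‖a - b‖ < ‖1 - starRingEnd ℂ b * a‖ := by
  have h1 : ‖a‖ ^ 2 < 1 := by nlinarith [norm_nonneg a]
  have h2 : ‖b‖ ^ 2 < 1 := by nlinarith [norm_nonneg b]
  refine lt_of_pow_lt_pow_left₀ 2 (norm_nonneg _) ?_
  rw [← Complex.normSq_eq_norm_sq] at h1 h2 ⊢
  rw [← Complex.normSq_eq_norm_sq]
  simp only [Complex.normSq_apply, Complex.sub_re, Complex.sub_im, Complex.mul_re, Complex.mul_im,
    Complex.conj_re, Complex.conj_im, Complex.one_re, Complex.one_im] at h1 h2 ⊢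
  nlinarith [mul_pos (sub_pos.2 h1) (sub_pos.2 h2)]

/-- Poincaré discs are convex. -/
theorem poincareDist_lineMap_le {a b : ℂ} (ha : ‖a‖ < 1) (hb : ‖b‖ < 1) {t : ℝ}
    (ht : t ∈ Icc (0 : ℝ) 1) : poincareDist a (a + t * (b - a)) ≤ poincareDist a b := by
  rw [poincareDist_comm, poincareDist_comm a b]
  have hab := norm_sub_lt_norm_one_sub_conj_mul hb ha
  have hpos : 0 < ‖1 - starRingEnd ℂ a * b‖ := (norm_nonneg _).trans_lt hab
  -- Writing `ā` for the conjugate of `a`, `1 - ā (a + t (b - a)) = (1 - t) (1 - ‖a‖²) + t (1 - ā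
  -- b)`. The first term is a nonnegative real and the second has nonnegative real part, so the norm
  -- of the sum is at least that of the second.
  have hkey : t * ‖1 - starRingEnd ℂ a * b‖ ≤ ‖1 - starRingEnd ℂ a * (a + t * (b - a))‖ := by
    have h1 : 0 < 1 - ‖a‖ ^ 2 := by nlinarith [norm_nonneg a]
    have h3 : (starRingEnd ℂ a * b).re ≤ 1 := by
      refine (Complex.re_le_norm _).trans ?_
      rw [norm_mul, Complex.norm_conj]
      nlinarith [norm_nonneg a, norm_nonneg b]
    refine le_of_sq_le_sq ?_ (norm_nonneg _)
    rw [mul_pow]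
    rw [← Complex.normSq_eq_norm_sq] at h1 ⊢
    rw [← Complex.normSq_eq_norm_sq]
    simp only [Complex.normSq_apply, Complex.sub_re, Complex.sub_im, Complex.mul_re,
      Complex.mul_im, Complex.conj_re, Complex.conj_im, Complex.one_re, Complex.one_im,
      Complex.add_re, Complex.add_im, Complex.ofReal_re, Complex.ofReal_im] at h1 h3 ⊢
    have h4 : 0 ≤ (1 - t) * (1 - (a.re * a.re + a.im * a.im)) :=
      mul_nonneg (by linarith [ht.2]) h1.le
    have h5 : 0 ≤ t * (1 - (a.re * b.re + a.im * b.im)) := mul_nonneg ht.1 (by linarith)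
    nlinarith [mul_nonneg h4 h5, mul_nonneg h4 h4]
  have hle : ‖a + t * (b - a) - a‖ / ‖1 - starRingEnd ℂ a * (a + t * (b - a))‖ ≤
      ‖b - a‖ / ‖1 - starRingEnd ℂ a * b‖ := by
    rw [add_sub_cancel_left, norm_mul, Complex.norm_real, Real.norm_eq_abs, abs_of_nonneg ht.1]
    rcases ht.1.eq_or_lt with h0 | h0
    · rw [← h0, zero_mul, zero_div]; positivity
    · rw [div_le_div_iff₀ ((mul_pos h0 hpos).trans_le hkey) hpos]
      nlinarith [norm_nonneg (b - a)]
  have hnn : 0 ≤ ‖a + t * (b - a) - a‖ / ‖1 - (starRingEnd ℂ) a * (a + t * (b - a))‖ := by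
    positivity
  exact Real.artanh_le_artanh (by linarith) ((div_lt_one hpos).2 hab) hle

theorem IsPreconnected.inter_frontier_nonempty {X : Type*} [TopologicalSpace X] {s W : Set X}
    (hs : IsPreconnected s) (h1 : (s ∩ W).Nonempty) (h2 : (s ∩ Wᶜ).Nonempty) :
    (s ∩ frontier W).Nonempty := by
  by_contra hne
  rw [not_nonempty_iff_eq_empty] at hne
  have hnf : ∀ x ∈ s, x ∉ frontier W := fun x hx hf =>
    (hne ▸ (⟨hx, hf⟩ : x ∈ s ∩ frontier W) : x ∈ (∅ : Set X)).elim
  have hin : ∀ x ∈ s, x ∈ W → x ∈ interior W := fun x hx hW => by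
    by_contra hi
    exact hnf x hx ⟨subset_closure hW, hi⟩
  have hout : ∀ x ∈ s, x ∉ W → x ∈ (closure W)ᶜ := fun x hx hW hc =>
    hnf x hx ⟨hc, fun hi => hW (interior_subset hi)⟩
  obtain ⟨x, hx, hxW⟩ := h1
  obtain ⟨y, hy, hyW⟩ := h2
  obtain ⟨z, -, hz1, hz2⟩ := hs _ _ isOpen_interior isClosed_closure.isOpen_compl
    (fun z hz => (em (z ∈ W)).imp (hin z hz) (hout z hz)) ⟨x, hx, hin x hx hxW⟩
    ⟨y, hy, hout y hy hyW⟩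
  exact hz2 (subset_closure (interior_subset hz1))

/-! ### The Kobayashi distance and its topology -/

section Kobayashi

variable {E : Type*} [NormedAddCommGroup E] [NormedSpace ℂ E]
  {M : Type*} [TopologicalSpace M] [ChartedSpace E M]

theorem discEDist_comm (p q : M) : discEDist E p q = discEDist E q p := by
  have : ∀ p q : M, discEDist E p q ≤ discEDist E q p := by
    intro p q
    refine le_iInf fun f => le_iInf fun hf => le_iInf₂ fun a ha => le_iInf₂ fun b hb =>
      le_iInf fun h1 => le_iInf fun h2 => ?_
    rw [poincareDist_comm]
    exact iInf_le_of_le f <| iInf_le_of_le hf <| iInf₂_le_of_le b hb <| iInf₂_le_of_le a ha <|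
      iInf_le_of_le h2 <| iInf_le_of_le h1 le_rfl
  exact le_antisymm (this p q) (this q p)

theorem discEDist_le {f : ℂ → M} (hf : MDifferentiableOn 𝓘(ℂ) 𝓘(ℂ, E) f (Metric.ball 0 1))
    {a b : ℂ} (ha : a ∈ Metric.ball (0 : ℂ) 1) (hb : b ∈ Metric.ball (0 : ℂ) 1) :
    discEDist E (f a) (f b) ≤ ENNReal.ofReal (poincareDist a b) :=
  iInf_le_of_le f <| iInf_le_of_le hf <| iInf₂_le_of_le a ha <| iInf₂_le_of_le b hb <|
    iInf_le_of_le rfl <| iInf_le_of_le rfl le_rfl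

theorem kobayashiEDist_self (p : M) : kobayashiEDist E p p = 0 :=
  le_antisymm (iInf_le_of_le 0 <| iInf_le_of_le (fun _ => p) <| iInf_le_of_le rfl <|
    iInf_le_of_le rfl (by simp)) zero_le

theorem kobayashiEDist_le_discEDist (p q : M) : kobayashiEDist E p q ≤ discEDist E p q :=
  iInf_le_of_le 1 <| iInf_le_of_le (fun i => if i = 0 then p else q) <|
    iInf_le_of_le (by simp) <| iInf_le_of_le (by simp) (by simp)

theorem kobayashiEDist_le_discEDist_add (p q r : M) :
    kobayashiEDist E p r ≤ discEDist E p q + kobayashiEDist E q r := by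
  conv_rhs => unfold kobayashiEDist
  simp only [ENNReal.add_iInf]
  refine le_iInf fun m => le_iInf fun x => le_iInf fun h0 => le_iInf fun hm => ?_
  refine iInf_le_of_le (m + 1) <| iInf_le_of_le (fun i => Nat.casesOn i p x) <|
    iInf_le_of_le rfl <| iInf_le_of_le hm ?_
  rw [Finset.sum_range_succ', add_comm]
  simp [h0]

theorem kobayashiEDist_le_sum_add (x : ℕ → M) (r : M) (m : ℕ) :
    kobayashiEDist E (x 0) r ≤
      ∑ i ∈ Finset.range m, discEDist E (x i) (x (i + 1)) + kobayashiEDist E (x m) r := by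
  induction m with
  | zero => simp
  | succ m ih =>
    refine ih.trans ?_
    rw [Finset.sum_range_succ, add_assoc]
    gcongr
    exact kobayashiEDist_le_discEDist_add _ _ _

theorem kobayashiEDist_triangle (p q r : M) :
    kobayashiEDist E p r ≤ kobayashiEDist E p q + kobayashiEDist E q r := by
  conv_rhs => rw [add_comm]; arg 2; unfold kobayashiEDist
  simp only [ENNReal.add_iInf]
  refine le_iInf fun m => le_iInf fun x => le_iInf fun h0 => le_iInf fun hm => ?_
  rw [add_comm, ← h0, ← hm]
  exact kobayashiEDist_le_sum_add x r m

theorem kobayashiEDist_comm (p q : M) : kobayashiEDist E p q = kobayashiEDist E q p := by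
  have : ∀ p q : M, kobayashiEDist E p q ≤ kobayashiEDist E q p := by
    intro p q
    refine le_iInf fun m => le_iInf fun x => le_iInf fun h0 => le_iInf fun hm => ?_
    refine iInf_le_of_le m <| iInf_le_of_le (fun i => x (m - i)) <|
      iInf_le_of_le (by simpa using hm) <| iInf_le_of_le (by simpa using h0) ?_
    rw [← Finset.sum_range_reflect]
    refine Finset.sum_le_sum fun i hi => ?_
    rw [Finset.mem_range] at hi
    rw [discEDist_comm]
    have e1 : m - (m - 1 - i + 1) = i := by omega
    have e2 : m - (m - 1 - i) = i + 1 := by omega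
    simp only [e1, e2, le_refl]
  exact le_antisymm (this p q) (this q p)

/-- A holomorphic disc leaving an open set passes through its frontier. -/
theorem exists_mem_frontier_of_disc {W : Set M} {f : ℂ → M}
    (hf : MDifferentiableOn 𝓘(ℂ) 𝓘(ℂ, E) f (Metric.ball 0 1)) {a b : ℂ}
    (ha : a ∈ Metric.ball (0 : ℂ) 1) (hb : b ∈ Metric.ball (0 : ℂ) 1) (haW : f a ∈ W)
    (hbW : f b ∉ W) :
    ∃ r ∈ frontier W, kobayashiEDist E (f a) r ≤ ENNReal.ofReal (poincareDist a b) := by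
  have hseg : ∀ t ∈ Icc (0 : ℝ) 1, a + t * (b - a) ∈ Metric.ball (0 : ℂ) 1 := by
    intro t ht
    have := (convex_ball (0 : ℂ) 1).add_smul_sub_mem ha hb ht
    simpa using this
  have hconn : IsPreconnected ((fun t : ℝ => f (a + t * (b - a))) '' Icc 0 1) := by
    refine isPreconnected_Icc.image _ (hf.continuousOn.comp ?_ hseg)
    fun_prop
  obtain ⟨r, ⟨t, ht, rfl⟩, hr⟩ := hconn.inter_frontier_nonempty
    (W := W) ⟨f a, ⟨0, by simp, by simp⟩, haW⟩ ⟨f b, ⟨1, by simp, by simp⟩, hbW⟩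
  refine ⟨_, hr, (kobayashiEDist_le_discEDist _ _).trans ((discEDist_le hf ha (hseg t ht)).trans ?_)⟩
  exact ENNReal.ofReal_le_ofReal
    (poincareDist_lineMap_le (mem_ball_zero_iff.1 ha) (mem_ball_zero_iff.1 hb) ht)

variable [IsManifold 𝓘(ℂ, E) ω M]

/-- If the chart at `p` contains a ball of radius `R`, an affine disc of that radius joins `p` to
any nearby `q`, at Poincaré distance `artanh (‖w‖ / R)` for `w` their difference in the chart. -/
theorem tendsto_kobayashiEDist_nhds (p : M) :
    Tendsto (fun q => kobayashiEDist E p q) (𝓝 p) (𝓝 0) := by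
  have : IsManifold 𝓘(ℂ, E) 1 M := .of_le (n := ω) le_top
  obtain ⟨R, hR, hRs⟩ := Metric.isOpen_iff.1 (chartAt E p).open_target _ (mem_chart_target E p)
  have hcont : Tendsto (fun q => ‖chartAt E p q - chartAt E p p‖ / R) (𝓝 p) (𝓝 0) := by
    have : ContinuousAt (fun q => ‖chartAt E p q - chartAt E p p‖ / R) p := by
      refine ContinuousAt.div_const (ContinuousAt.norm (ContinuousAt.sub ?_ continuousAt_const)) _
      exact (chartAt E p).continuousAt (mem_chart_source E p)
    simpa [ContinuousAt] using this
  have hartanh : Tendsto Real.artanh (𝓝 0) (𝓝 0) := by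
    have : ContinuousAt Real.artanh 0 := by
      unfold Real.artanh
      refine ContinuousAt.log (ContinuousAt.sqrt (ContinuousAt.div ?_ ?_ (by norm_num)))
        (by norm_num) <;> fun_prop
    simpa [ContinuousAt] using this
  have hlim : Tendsto (fun q => ENNReal.ofReal
      (Real.artanh (‖chartAt E p q - chartAt E p p‖ / R))) (𝓝 p) (𝓝 0) := by
    have := ENNReal.tendsto_ofReal (hartanh.comp hcont)
    simpa using this
  refine tendsto_of_tendsto_of_tendsto_of_le_of_le' tendsto_const_nhds hlim
    (Eventually.of_forall fun _ => zero_le) ?_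
  filter_upwards [chart_source_mem_nhds E p, hcont.eventually (gt_mem_nhds one_pos)] with q hq hlt
  set w := chartAt E p q - chartAt E p p with hw
  -- For `w = 0` the quotient `R / ‖w‖` is 0 by convention, and the disc is constant.
  set f : ℂ → M := fun ζ => (chartAt E p).symm (chartAt E p p + ζ • ((R / ‖w‖ : ℝ) : ℂ) • w) with hf
  have hmaps : MapsTo (fun ζ : ℂ => chartAt E p p + ζ • ((R / ‖w‖ : ℝ) : ℂ) • w)
      (Metric.ball 0 1) (chartAt E p).target := by
    intro ζ hζ
    refine hRs ?_
    rw [mem_ball_zero_iff] at hζ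
    rw [Metric.mem_ball, dist_eq_norm, add_sub_cancel_left, norm_smul, norm_smul,
      Complex.norm_real, norm_div, norm_norm, Real.norm_of_nonneg hR.le]
    rcases eq_or_ne w 0 with h0 | h0
    · simpa [h0] using hR
    · rw [div_mul_cancel₀ _ (norm_ne_zero_iff.2 h0)]
      nlinarith
  have hfd : MDifferentiableOn 𝓘(ℂ) 𝓘(ℂ, E) f (Metric.ball 0 1) := by
    refine (mdifferentiableOn_atlas_symm (I := 𝓘(ℂ, E)) (chart_mem_atlas E p)).comp ?_ hmaps
    refine DifferentiableOn.mdifferentiableOn ?_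
    fun_prop
  have hf0 : f 0 = p := by simp [hf]
  have hfq : f ((‖w‖ / R : ℝ) : ℂ) = q := by
    simp only [hf]
    rcases eq_or_ne w 0 with h0 | h0
    · have : chartAt E p q = chartAt E p p := sub_eq_zero.1 h0
      simp only [h0, smul_zero, add_zero]
      rw [← this, (chartAt E p).left_inv hq]
    · have : ‖w‖ ≠ 0 := norm_ne_zero_iff.2 h0
      rw [smul_smul, ← Complex.ofReal_mul, div_mul_div_comm, mul_comm R, div_self
        (mul_ne_zero this hR.ne'), Complex.ofReal_one, one_smul, hw, add_sub_cancel,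
        (chartAt E p).left_inv hq]
  have hb : ((‖w‖ / R : ℝ) : ℂ) ∈ Metric.ball (0 : ℂ) 1 := by
    rw [mem_ball_zero_iff, Complex.norm_real, Real.norm_of_nonneg (by positivity)]
    exact hlt
  have := (kobayashiEDist_le_discEDist _ _).trans
    (discEDist_le hfd (Metric.mem_ball_self one_pos) hb)
  rw [hf0, hfq] at this
  refine this.trans_eq ?_
  congr 1
  simp [poincareDist, abs_of_pos hR]

/-- The points at finite distance from `p` form a clopen set, since every point has a neighbourhood
at distance less than 1 from it. -/
theorem kobayashiEDist_ne_top [ConnectedSpace M] (p q : M) : kobayashiEDist E p q ≠ ⊤ := by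
  have hnear : ∀ q : M, ∀ᶠ q' in 𝓝 q, kobayashiEDist E q q' < 1 := fun q =>
    (tendsto_kobayashiEDist_nhds q).eventually (gt_mem_nhds zero_lt_one)
  have hclopen : IsClopen {q : M | kobayashiEDist E p q ≠ ⊤} := by
    constructor
    · rw [← isOpen_compl_iff, isOpen_iff_mem_nhds]
      intro q hq
      filter_upwards [hnear q] with q' hq' hne
      refine hq ((kobayashiEDist_triangle p q' q).trans_lt
        (ENNReal.add_lt_top.2 ⟨lt_top_iff_ne_top.2 hne, ?_⟩)).ne
      rw [kobayashiEDist_comm]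
      exact hq'.trans ENNReal.one_lt_top
    · rw [isOpen_iff_mem_nhds]
      intro q hq
      filter_upwards [hnear q] with q' hq'
      exact ((kobayashiEDist_triangle p q q').trans_lt (ENNReal.add_lt_top.2
        ⟨lt_top_iff_ne_top.2 hq, hq'.trans ENNReal.one_lt_top⟩)).ne
  have := hclopen.eq_univ ⟨p, by simp [kobayashiEDist_self]⟩
  exact (this ▸ mem_univ q : q ∈ {q : M | kobayashiEDist E p q ≠ ⊤})

/-- If the Kobayashi pseudo-distance is a distance, it induces the topology of the manifold
(Barth). -/
theorem exists_kobayashiEDist_lt_subset [LocallyCompactSpace M] [T2Space M]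
    (hM : ∀ p q : M, kobayashiEDist E p q = 0 → p = q) {p : M} {U : Set M} (hU : U ∈ 𝓝 p) :
    ∃ ε > 0, ∀ q, kobayashiEDist E p q < ε → q ∈ U := by
  obtain ⟨K, hK, hKU, hKc⟩ := local_compact_nhds hU
  have hpW : p ∈ interior K := mem_interior_iff_mem_nhds.2 hK
  have hfr : IsCompact (frontier (interior K)) :=
    hKc.of_isClosed_subset isClosed_frontier (frontier_subset_closure.trans
      (closure_minimal interior_subset hKc.isClosed))
  -- Near a frontier point `r` the distance to `p` is at least half the distance from `p` to `r`,
  -- which is nonzero. Compactness of the frontier makes the bound uniform.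
  obtain ⟨ε, hε, hle⟩ : ∃ ε > 0, ∀ r ∈ frontier (interior K), ε ≤ kobayashiEDist E p r := by
    refine hfr.induction_on (p := fun S => ∃ ε > 0, ∀ r ∈ S, ε ≤ kobayashiEDist E p r)
      ⟨1, one_pos, by simp⟩ (fun s t hst ⟨ε, hε, h⟩ => ⟨ε, hε, fun r hr => h r (hst hr)⟩)
      (fun s t ⟨ε, hε, h⟩ ⟨ε', hε', h'⟩ => ⟨min ε ε', lt_min hε hε', fun r hr => hr.elim
        (fun hr => (min_le_left _ _).trans (h r hr))
        fun hr => (min_le_right _ _).trans (h' r hr)⟩) fun r hr => ?_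
    have hrp : kobayashiEDist E p r ≠ 0 := fun h0 => by
      rw [← hM p r h0] at hr
      rw [isOpen_interior.frontier_eq] at hr
      exact hr.2 hpW
    have h2 : 0 < kobayashiEDist E p r / 2 := ENNReal.half_pos hrp
    refine ⟨{q | kobayashiEDist E r q < kobayashiEDist E p r / 2}, mem_nhdsWithin_of_mem_nhds
      ((tendsto_kobayashiEDist_nhds r).eventually (gt_mem_nhds h2)),
      min (kobayashiEDist E p r / 2) 1, lt_min h2 one_pos, fun q hq => ?_⟩
    by_contra! hlt
    have hlt' := hlt.trans_le (min_le_left _ _)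
    have : kobayashiEDist E p r < kobayashiEDist E p r / 2 + kobayashiEDist E p r / 2 :=
      (kobayashiEDist_triangle p q r).trans_lt (ENNReal.add_lt_add hlt'
        (by rw [kobayashiEDist_comm]; exact hq))
    rw [ENNReal.add_halves] at this
    exact lt_irrefl _ this
  refine ⟨ε, hε, fun q hq => hKU (interior_subset ?_)⟩
  by_contra hqW
  refine absurd hq (not_lt.2 ?_)
  refine le_iInf fun m => le_iInf fun x => le_iInf fun h0 => le_iInf fun hm => ?_
  rw [← hm] at hqW
  clear hm hq
  -- A chain cannot jump over the frontier: the link that leaves the open set is a disc meeting it.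
  -- The chain cut at such a point already has length at least `ε`.
  induction m with
  | zero => exact absurd (h0 ▸ hpW) hqW
  | succ m ih =>
    rw [Finset.sum_range_succ]
    by_cases hmW : x m ∈ interior K
    · unfold discEDist
      simp only [ENNReal.add_iInf]
      refine le_iInf fun f => le_iInf fun hf => le_iInf₂ fun a ha => le_iInf₂ fun b hb =>
        le_iInf fun h1 => le_iInf fun h2 => ?_
      obtain ⟨r, hr, hrle⟩ := exists_mem_frontier_of_disc (W := interior K) hf ha hb
        (h1 ▸ hmW) (h2 ▸ hqW)
      refine (hle r hr).trans ?_
      rw [← h0]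
      refine (kobayashiEDist_le_sum_add x r m).trans ?_
      rw [← h1]
      exact add_le_add le_rfl hrle
    · exact (ih hmW).trans le_self_add

end Kobayashi

/-! ### Solutions on the manifold and in charts -/

section Solutions

variable {E : Type*} [NormedAddCommGroup E] [NormedSpace ℂ E]
  {M : Type*} [TopologicalSpace M] [ChartedSpace E M]

/-- The velocity `G(q, t)`, read in the chart at `p`. -/
noncomputable def chartVelocity (G : (z : M) → ℝ → TangentSpace 𝓘(ℂ, E) z) (p : M) (t : ℝ) (q : M) :
    E :=
  mfderiv 𝓘(ℝ, E) 𝓘(ℝ, E) (chartAt E p) q (toRealTangent (G q t))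

/-- Solutions of the differential equation on a compact interval. -/
structure IsSolutionOn (G : (z : M) → ℝ → TangentSpace 𝓘(ℂ, E) z) (a b : ℝ) (x : ℝ → M) :
    Prop where
  continuousOn : ContinuousOn x (Icc a b)
  dominated : ∀ p : M, ∀ t t' : ℝ, a ≤ t → t ≤ t' → t' ≤ b →
    MapsTo x (Icc t t') (chartAt E p).source →
      HasDominatedVariation (fun τ => chartAt E p (x τ)) t t'
  equation : ∀ᵐ t ∂volume.restrict (Icc a b), HasVelocityAt G x t

theorem HasMFDerivAt.restrictScalars_real {F : Type*} [NormedAddCommGroup F] [NormedSpace ℂ F]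
    {N : Type*} [TopologicalSpace N] [ChartedSpace F N] {f : M → N} {q : M} {f' : E →L[ℂ] F}
    (h : HasMFDerivAt 𝓘(ℂ, E) 𝓘(ℂ, F) f q f') :
    HasMFDerivAt 𝓘(ℝ, E) 𝓘(ℝ, F) f q (f'.restrictScalars ℝ) :=
  ⟨h.1, HasFDerivWithinAt.restrictScalars ℝ h.2⟩

variable {G : (z : M) → ℝ → TangentSpace 𝓘(ℂ, E) z}

theorem HasVelocityAt.congr {x y : ℝ → M} {t : ℝ} (h : HasVelocityAt G x t) (hxy : x =ᶠ[𝓝 t] y) :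
    HasVelocityAt G y t := by
  have h1 : x t = y t := hxy.self_of_nhds
  unfold HasVelocityAt at h ⊢
  rw [← h1]
  exact h.congr_of_eventuallyEq hxy.symm

namespace IsSolutionOn

variable {x y : ℝ → M} {a b : ℝ}

theorem mono (h : IsSolutionOn G a b x) {a' b' : ℝ} (ha : a ≤ a') (hb : b' ≤ b) :
    IsSolutionOn G a' b' x :=
  ⟨h.continuousOn.mono (Icc_subset_Icc ha hb), fun p t t' h1 h2 h3 h4 =>
    h.dominated p t t' (ha.trans h1) h2 (h3.trans hb) h4,
    ae_restrict_of_ae_restrict_of_subset (Icc_subset_Icc ha hb) h.equation⟩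

theorem congr (h : IsSolutionOn G a b x) (hxy : EqOn x y (Icc a b)) : IsSolutionOn G a b y := by
  refine ⟨h.continuousOn.congr hxy.symm, fun p t t' h1 h2 h3 h4 => ?_, ?_⟩
  · have hsub : Icc t t' ⊆ Icc a b := Icc_subset_Icc h1 h3
    refine (h.dominated p t t' h1 h2 h3 fun τ hτ => ?_).congr fun τ hτ => ?_
    · rw [hxy (hsub hτ)]; exact h4 hτ
    · simp only [hxy (hsub hτ)]
  · have h1 := h.equation
    -- The velocity at an endpoint depends on the curve outside `[a, b]`, where `x` and `y` may
    -- differ; the endpoints are negligible.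
    rw [← restrict_Ioo_eq_restrict_Icc] at h1 ⊢
    filter_upwards [h1, ae_restrict_mem measurableSet_Ioo] with t ht hm
    refine ht.congr ?_
    filter_upwards [Ioo_mem_nhds hm.1 hm.2] with τ hτ using hxy ⟨hτ.1.le, hτ.2.le⟩

theorem union {m : ℝ} (h : IsSolutionOn G a m x) (h' : IsSolutionOn G m b x) (ham : a ≤ m)
    (hmb : m ≤ b) : IsSolutionOn G a b x := by
  have hU : Icc a m ∪ Icc m b = Icc a b := Icc_union_Icc_eq_Icc ham hmb
  refine ⟨?_, fun p t t' h1 h2 h3 h4 => ?_, ?_⟩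
  · rw [← hU]
    exact h.continuousOn.union_of_isClosed h'.continuousOn isClosed_Icc isClosed_Icc
  · rcases le_total t' m with h5 | h5
    · exact h.dominated p t t' h1 h2 h5 h4
    rcases le_total m t with h6 | h6
    · exact h'.dominated p t t' h6 h2 h3 h4
    exact (h.dominated p t m h1 h6 le_rfl (h4.mono_left (Icc_subset_Icc le_rfl h5))).trans
      (h'.dominated p m t' le_rfl h5 h3 (h4.mono_left (Icc_subset_Icc h6 le_rfl)))
  · rw [← hU, ae_restrict_union_iff]
    exact ⟨h.equation, h'.equation⟩

theorem concat {m : ℝ} (h : IsSolutionOn G a m x) (h' : IsSolutionOn G m b y) (ham : a ≤ m)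
    (hmb : m ≤ b) (hm : x m = y m) :
    IsSolutionOn G a b (fun t => if t ≤ m then x t else y t) := by
  refine union (m := m) (h.congr fun t ht => ?_) (h'.congr fun t ht => ?_) ham hmb
  · simp only [if_pos ht.2]
  · split_ifs with h1
    · rw [le_antisymm h1 ht.1, hm]
    · rfl

theorem exists_concat {m : ℝ} (h : IsSolutionOn G a m x) (h' : IsSolutionOn G m b y) (ham : a ≤ m)
    (hmb : m ≤ b) (hm : x m = y m) :
    ∃ w, IsSolutionOn G a b w ∧ EqOn w x (Icc a m) ∧ EqOn w y (Icc m b) := by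
  refine ⟨_, h.concat h' ham hmb hm, fun t ht => if_pos ht.2, fun t ht => ?_⟩
  by_cases h1 : t ≤ m
  · simp only [if_pos h1]
    rw [le_antisymm h1 ht.1, hm]
  · simp only [if_neg h1]

theorem const (x : ℝ → M) (a : ℝ) : IsSolutionOn G a a x := by
  refine ⟨by simp, fun p t t' h1 h2 h3 _ => ?_, by simp⟩
  have : t = t' := le_antisymm h2 (h3.trans h1)
  subst this
  refine ⟨fun _ => 0, fun _ => le_rfl, integrableOn_zero, fun x y hx hxy hy => ?_⟩
  have : x = y := le_antisymm hxy (hy.trans hx)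
  simp [this]

end IsSolutionOn

variable [IsManifold 𝓘(ℂ, E) ω M]

/-- The bridge between the real velocity, used in the equation, and the complex trivialization, in
which holomorphy of the field is expressed. -/
theorem chartVelocity_eq_trivializationAt {p q : M} (hq : q ∈ (chartAt E p).source) (t : ℝ) :
    chartVelocity G p t q =
      (trivializationAt E (TangentSpace 𝓘(ℂ, E)) p (⟨q, G q t⟩ : TangentBundle 𝓘(ℂ, E) M)).2 := by
  have : IsManifold 𝓘(ℂ, E) 1 M := .of_le (n := ω) le_top
  have h1 := TangentBundle.continuousLinearMapAt_trivializationAt (I := 𝓘(ℂ, E)) hq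
  have h2 : (trivializationAt E (TangentSpace 𝓘(ℂ, E)) p
      (⟨q, G q t⟩ : TangentBundle 𝓘(ℂ, E) M)).2 =
      (trivializationAt E (TangentSpace 𝓘(ℂ, E)) p).continuousLinearMapAt ℂ q (G q t) := by
    rw [Bundle.Trivialization.continuousLinearMapAt_apply,
      Bundle.Trivialization.linearMapAt_apply, if_pos]
    simpa using hq
  rw [h2, h1]
  have h3 : MDifferentiableAt 𝓘(ℂ, E) 𝓘(ℂ, E) (chartAt E p) q :=
    mdifferentiableAt_extChartAt (I := 𝓘(ℂ, E)) hq
  have h4 := h3.hasMFDerivAt.restrictScalars_real.mfderiv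
  unfold chartVelocity
  rw [h4]
  rfl

theorem differentiableOn_chartVelocity (p : M) {t : ℝ}
    (hG : MDifferentiable 𝓘(ℂ, E) 𝓘(ℂ, E).tangent
      (fun z : M => (⟨z, G z t⟩ : TangentBundle 𝓘(ℂ, E) M))) :
    DifferentiableOn ℂ (fun e => chartVelocity G p t ((chartAt E p).symm e))
      (chartAt E p).target := by
  have : IsManifold 𝓘(ℂ, E) 1 M := .of_le (n := ω) le_top
  have h1 := ((trivializationAt E (TangentSpace 𝓘(ℂ, E)) p).mdifferentiableOn_section_baseSet_iff
    (IB := 𝓘(ℂ, E)) (s := fun z => G z t)).1 hG.mdifferentiableOn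
  have h2 : MDifferentiableOn 𝓘(ℂ, E) 𝓘(ℂ, E) (fun e => chartVelocity G p t ((chartAt E p).symm e))
      (chartAt E p).target := by
    refine MDifferentiableOn.congr (h1.comp
      (mdifferentiableOn_atlas_symm (I := 𝓘(ℂ, E)) (chart_mem_atlas E p)) ?_) ?_
    · intro e he
      simpa using (chartAt E p).map_target he
    · intro e he
      exact chartVelocity_eq_trivializationAt ((chartAt E p).map_target he) t
  exact mdifferentiableOn_iff_differentiableOn.1 h2

theorem HasVelocityAt.hasDerivAt {x : ℝ → M} {t : ℝ} (h : HasVelocityAt G x t) {p : M}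
    (hp : x t ∈ (chartAt E p).source) :
    HasDerivAt (fun τ => chartAt E p (x τ)) (chartVelocity G p t (x t)) t := by
  have : IsManifold 𝓘(ℝ, E) 1 M := .of_le (n := ω) le_top
  have h1 : MDifferentiableAt 𝓘(ℝ, E) 𝓘(ℝ, E) (chartAt E p) (x t) :=
    mdifferentiableAt_extChartAt (I := 𝓘(ℝ, E)) hp
  have h2 : HasFDerivAt (fun τ => chartAt E p (x τ))
      ((mfderiv 𝓘(ℝ, E) 𝓘(ℝ, E) (chartAt E p) (x t)).comp
        ((1 : ℝ →L[ℝ] ℝ).smulRight (toRealTangent (G (x t) t)))) t :=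
    (h1.hasMFDerivAt.comp t h).hasFDerivAt
  refine hasDerivAt_iff_hasFDerivAt.2 (h2.congr_fderiv (ContinuousLinearMap.ext fun c => ?_))
  show mfderiv 𝓘(ℝ, E) 𝓘(ℝ, E) (chartAt E p) (x t) (c • toRealTangent (G (x t) t)) =
    c • chartVelocity G p t (x t)
  rw [map_smul]
  rfl

/-- Continuity keeps the curve in the chart domain near `t`; outside it the chart reading says
nothing about the curve. -/
theorem hasVelocityAt_of_hasDerivAt {x : ℝ → M} {t : ℝ} (hc : ContinuousAt x t) {p : M}
    (hp : x t ∈ (chartAt E p).source)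
    (h : HasDerivAt (fun τ => chartAt E p (x τ)) (chartVelocity G p t (x t)) t) :
    HasVelocityAt G x t := by
  have : IsManifold 𝓘(ℝ, E) 1 M := .of_le (n := ω) le_top
  have hmd := mdifferentiable_of_mem_atlas (I := 𝓘(ℝ, E)) (chart_mem_atlas E p)
  have h1 := (hmd.symm.mdifferentiableAt ((chartAt E p).map_source hp)).hasMFDerivAt
  have h2 := h1.comp t h.hasFDerivAt.hasMFDerivAt
  have h3 := h2.congr_of_eventuallyEq (f₁ := x) (by
    filter_upwards [hc.preimage_mem_nhds ((chartAt E p).open_source.mem_nhds hp)] with τ hτ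
    exact ((chartAt E p).left_inv hτ).symm)
  have h4 := congrArg (fun L => L (toRealTangent (G (x t) t))) (hmd.symm_comp_deriv hp)
  have h5 : ∀ c : ℝ, mfderiv 𝓘(ℝ, E) 𝓘(ℝ, E) (chartAt E p).symm (chartAt E p (x t))
      (c • chartVelocity G p t (x t)) = c • toRealTangent (G (x t) t) := fun c =>
    (map_smul _ _ _).trans (congrArg (c • ·) h4)
  exact ⟨h3.1, h3.2.congr_fderiv (ContinuousLinearMap.ext fun c => h5 c)⟩

variable [FiniteDimensional ℂ E]

namespace IsSolutionOn

variable {x y : ℝ → M} {a b : ℝ}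

theorem integral_eq (h : IsSolutionOn G a b x) (hab : a ≤ b) {p : M}
    (hp : MapsTo x (Icc a b) (chartAt E p).source) :
    IntegrableOn (fun t => chartVelocity G p t (x t)) (Icc a b) ∧
      ∀ s ∈ Icc a b, ∀ t ∈ Icc a b,
        chartAt E p (x t) - chartAt E p (x s) = ∫ τ in s..t, chartVelocity G p τ (x τ) := by
  refine (h.dominated p a b le_rfl hab le_rfl hp).integral_eq_sub hab ?_
  filter_upwards [h.equation, ae_restrict_mem measurableSet_Icc] with t ht hm
  exact ht.hasDerivAt (hp hm)

end IsSolutionOn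

omit [FiniteDimensional ℂ E] in
theorem exists_lipschitzOnWith_chart_transition {p p₀ q : M} (hp : q ∈ (chartAt E p).source)
    (hp₀ : q ∈ (chartAt E p₀).source) : ∃ K, ∃ s ∈ 𝓝 (chartAt E p₀ q),
      LipschitzOnWith K (fun e => chartAt E p ((chartAt E p₀).symm e)) s := by
  have h1 := (contDiffGroupoid ω 𝓘(ℝ, E)).compatible (chart_mem_atlas E p₀) (chart_mem_atlas E p)
  have h2 : ContDiffOn ℝ ω (fun e => chartAt E p ((chartAt E p₀).symm e))
      ((chartAt E p₀).symm ≫ₕ chartAt E p).source := by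
    have h2 := h1.1
    change ContDiffOn ℝ ω (𝓘(ℝ, E) ∘ ((chartAt E p₀).symm ≫ₕ chartAt E p) ∘ 𝓘(ℝ, E).symm)
      (𝓘(ℝ, E).symm ⁻¹' ((chartAt E p₀).symm ≫ₕ chartAt E p).source ∩ range 𝓘(ℝ, E)) at h2
    simpa [Function.comp_def] using h2
  have h3 : chartAt E p₀ q ∈ ((chartAt E p₀).symm ≫ₕ chartAt E p).source := by
    simp [hp, hp₀]
  exact ((h2.contDiffAt (((chartAt E p₀).symm ≫ₕ chartAt E p).open_source.mem_nhds h3)).of_le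
    (m := 1) le_top).exists_lipschitzOnWith

-- Transition maps are Lipschitz only locally, hence the localization in time.
omit [FiniteDimensional ℂ E] in
theorem HasDominatedVariation.chart_change {x : ℝ → M} {a b : ℝ} (hab : a ≤ b) {p p₀ : M}
    (hx : ContinuousOn x (Icc a b)) (hp : MapsTo x (Icc a b) (chartAt E p).source)
    (hp₀ : MapsTo x (Icc a b) (chartAt E p₀).source)
    (h : HasDominatedVariation (fun t => chartAt E p₀ (x t)) a b) :
    HasDominatedVariation (fun t => chartAt E p (x t)) a b := by
  refine .of_locally hab fun t ht => ?_
  obtain ⟨K, s, hs, hK⟩ := exists_lipschitzOnWith_chart_transition (hp ht) (hp₀ ht)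
  have hc : ContinuousWithinAt (fun t => chartAt E p₀ (x t)) (Icc a b) t :=
    ((chartAt E p₀).continuousAt (hp₀ ht)).comp_continuousWithinAt (hx t ht)
  obtain ⟨δ, hδ, hsub⟩ := Metric.mem_nhdsWithin_iff.1 (hc.preimage_mem_nhdsWithin hs)
  refine ⟨δ, hδ, fun u w hu huw hw h1 h2 => ?_⟩
  have hI : Icc u w ⊆ Icc a b := Icc_subset_Icc hu hw
  refine ((h.mono hu hw).lipschitz_comp hK fun τ hτ => hsub ⟨?_, hI hτ⟩).congr fun τ hτ => ?_
  · rw [Metric.mem_ball, Real.dist_eq, abs_lt]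
    constructor <;> linarith [hτ.1, hτ.2]
  · simp only [(chartAt E p₀).left_inv (hp₀ (hI hτ))]

/-- Checking the integral equation in one chart is enough: Lebesgue differentiation gives the
velocity almost everywhere, and domination passes to the other charts. -/
theorem IsSolutionOn.of_integral_eq {x : ℝ → M} {a b : ℝ} (hab : a ≤ b) {p : M}
    (hx : ContinuousOn x (Icc a b)) (hp : MapsTo x (Icc a b) (chartAt E p).source)
    (hi : IntegrableOn (fun t => chartVelocity G p t (x t)) (Icc a b))
    (he : ∀ t ∈ Icc a b,
      chartAt E p (x t) = chartAt E p (x a) + ∫ τ in a..t, chartVelocity G p τ (x τ)) :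
    IsSolutionOn G a b x := by
  have ha : a ∈ Icc a b := ⟨le_rfl, hab⟩
  have hb : b ∈ Icc a b := ⟨hab, le_rfl⟩
  have hdom : HasDominatedVariation (fun t => chartAt E p (x t)) a b := by
    refine .of_integral hi fun u w hu huw hw => ?_
    have m1 : u ∈ Icc a b := ⟨hu, huw.trans hw⟩
    have m2 : w ∈ Icc a b := ⟨hu.trans huw, hw⟩
    rw [he u m1, he w m2, add_sub_add_left_eq_sub, intervalIntegral.integral_interval_sub_left
      (intervalIntegrable_of_integrableOn_Icc hi ha m2)
      (intervalIntegrable_of_integrableOn_Icc hi ha m1)]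
  refine ⟨hx, fun p' t t' h1 h2 h3 h4 => ?_, ?_⟩
  · have hI : Icc t t' ⊆ Icc a b := Icc_subset_Icc h1 h3
    exact (hdom.mono h1 h3).chart_change h2 (hx.mono hI) h4 (hp.mono_left hI)
  · have h1 := (intervalIntegrable_of_integrableOn_Icc hi ha hb).ae_hasDerivAt_integral
    rw [← restrict_Ioo_eq_restrict_Icc]
    filter_upwards [ae_restrict_of_ae h1, ae_restrict_mem measurableSet_Ioo] with t ht hm
    have hmI : t ∈ Icc a b := ⟨hm.1.le, hm.2.le⟩
    rw [uIcc_of_le hab] at ht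
    refine hasVelocityAt_of_hasDerivAt (hx.continuousAt (Icc_mem_nhds hm.1 hm.2)) (hp hmI) ?_
    refine ((ht hmI a ha).const_add (chartAt E p (x a))).congr_of_eventuallyEq ?_
    filter_upwards [Icc_mem_nhds hm.1 hm.2] with τ hτ using he τ hτ

end Solutions

/-- By continuity of the primitive of `C` extended by zero. One window around `t₀` serves every
subinterval, which is the source of all later uniformity in the initial time. -/
theorem exists_integral_le_of_integrableOn {C : ℝ → ℝ} {t₀ T ε : ℝ} (hε : 0 < ε)
    (hC0 : ∀ t, 0 ≤ C t) (hC : IntegrableOn C (Icc 0 T)) (hT : t₀ < T) :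
    ∃ δ > 0, t₀ + δ ≤ T ∧ ∀ a b, 0 ≤ a → t₀ - δ ≤ a → a ≤ b → b ≤ t₀ + δ →
      ∫ t in a..b, C t ≤ ε := by
  set f := (Icc 0 T).indicator C with hf
  have hfi : Integrable f := (integrable_indicator_iff measurableSet_Icc).2 hC
  have hf0 : ∀ t, 0 ≤ f t := fun t => indicator_nonneg (fun t _ => hC0 t) t
  have hcont : Continuous fun x => ∫ t in (0 : ℝ)..x, f t :=
    intervalIntegral.continuous_primitive (fun _ _ => hfi.intervalIntegrable) 0
  have hlim : Tendsto (fun δ : ℝ => (∫ t in (0 : ℝ)..(t₀ + δ), f t) -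
      ∫ t in (0 : ℝ)..(t₀ - δ), f t) (𝓝 0) (𝓝 0) := by
    have : Continuous fun δ : ℝ => (∫ t in (0 : ℝ)..(t₀ + δ), f t) -
      ∫ t in (0 : ℝ)..(t₀ - δ), f t :=
      (hcont.comp (continuous_const.add continuous_id)).sub
        (hcont.comp (continuous_const.sub continuous_id))
    simpa using this.tendsto 0
  obtain ⟨δ, hδ⟩ := (((hlim.eventually (gt_mem_nhds hε)).filter_mono nhdsWithin_le_nhds).and
    ((self_mem_nhdsWithin : Ioi (0 : ℝ) ∈ 𝓝[>] 0) |> fun h => (eventually_mem_set.2 h).and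
      (eventually_mem_set.2 (mem_nhdsWithin_of_mem_nhds
        (Iio_mem_nhds (show (0 : ℝ) < T - t₀ by linarith)))))).exists
  obtain ⟨h1, h2, h3⟩ := hδ
  rw [mem_Ioi] at h2
  rw [mem_Iio] at h3
  refine ⟨δ, h2, by linarith, fun a b ha hδa hab hb => ?_⟩
  rw [intervalIntegral.integral_interval_sub_left hfi.intervalIntegrable
    hfi.intervalIntegrable] at h1
  have h4 : ∫ t in a..b, C t = ∫ t in a..b, f t := by
    refine intervalIntegral.integral_congr fun t ht => ?_
    rw [uIcc_of_le hab] at ht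
    exact (indicator_of_mem (mem_Icc.2 ⟨ha.trans ht.1, by linarith [ht.2]⟩) _).symm
  rw [h4]
  exact (intervalIntegral.integral_mono_interval hδa hab hb
    (Eventually.of_forall hf0) hfi.intervalIntegrable).trans h1.le

/-! ### Local flow and uniqueness on the manifold -/

section LocalFlow

variable {E : Type*} [NormedAddCommGroup E] [NormedSpace ℂ E] [FiniteDimensional ℂ E]
  {M : Type*} [TopologicalSpace M] [ChartedSpace E M] [IsManifold 𝓘(ℂ, E) ω M]
  {h : HermitianMetric E M} {d : ℝ≥0∞} {G : (z : M) → ℝ → TangentSpace 𝓘(ℂ, E) z}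

open Metric

/-- Supplies the hypotheses of the Picard theorem and of its uniqueness counterpart, with one `r`
and one `δ` for all intervals in the time window. -/
theorem IsWeakHolomorphicVectorField.exists_chart_bound (hG : IsWeakHolomorphicVectorField h d G)
    (hd : 1 ≤ d) (p₀ : M) {t₀ : ℝ} (ht₀ : 0 ≤ t₀) {V : Set M} (hV : V ∈ 𝓝 p₀) :
    ∃ r > 0, ∃ δ > 0, ∃ C : ℝ → ℝ, (∀ t, 0 ≤ C t) ∧
      (∀ e ∈ ball (chartAt E p₀ p₀) (2 * r + r),
        e ∈ (chartAt E p₀).target ∧ (chartAt E p₀).symm e ∈ V) ∧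
      ∀ a b, 0 ≤ a → t₀ - δ ≤ a → a ≤ b → b ≤ t₀ + δ →
        IntegrableOn C (Icc a b) ∧ ∫ t in a..b, C t ≤ r / 4 ∧
        (∀ e ∈ ball (chartAt E p₀ p₀) (2 * r + r),
          AEStronglyMeasurable (fun t => chartVelocity G p₀ t ((chartAt E p₀).symm e))
            (volume.restrict (Icc a b))) ∧
        ∀ᵐ t ∂volume.restrict (Icc a b),
          DifferentiableOn ℂ (fun e => chartVelocity G p₀ t ((chartAt E p₀).symm e))
            (ball (chartAt E p₀ p₀) (2 * r + r)) ∧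
          ∀ e ∈ ball (chartAt E p₀ p₀) (2 * r + r),
            ‖chartVelocity G p₀ t ((chartAt E p₀).symm e)‖ ≤ C t := by
  have : ProperSpace E := FiniteDimensional.proper ℂ E
  obtain ⟨L, hL, W, hW, hWL⟩ := h.exists_norm_mfderiv_chartAt_le p₀
  set φ := chartAt E p₀ with hφ
  have hnhds : φ.target ∩ φ.symm ⁻¹' (W ∩ V) ∈ 𝓝 (φ p₀) := by
    refine inter_mem (φ.open_target.mem_nhds (mem_chart_target E p₀)) ?_
    refine (φ.continuousAt_symm (mem_chart_target E p₀)).preimage_mem_nhds ?_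
    rw [φ.left_inv (mem_chart_source E p₀)]
    exact inter_mem hW hV
  obtain ⟨ρ, hρ, hρs⟩ := Metric.nhds_basis_closedBall.mem_iff.1 hnhds
  set r := ρ / 3 with hr
  have hrρ : 2 * r + r = ρ := by rw [hr]; ring
  -- The bound on `G` is available on compact sets, hence the closed ball. The factor `L` then
  -- converts Hermitian lengths into norms in the chart.
  have hK : IsCompact (φ.symm '' closedBall (φ p₀) ρ) :=
    (isCompact_closedBall _ _).image_of_continuousOn
      (φ.continuousOn_symm.mono fun e he => (hρs he).1)
  obtain ⟨C, hC0, hCd, hCb⟩ := hG.bound _ hK (t₀ + 1) (by linarith)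
  have hCi : IntegrableOn C (Icc 0 (t₀ + 1)) := hCd.integrable hd
  obtain ⟨δ, hδ, hδT, hδC⟩ := exists_integral_le_of_integrableOn (C := fun t => L * C t)
    (t₀ := t₀) (T := t₀ + 1) (ε := r / 4) (by positivity)
    (fun t => mul_nonneg hL.le (hC0 t)) (hCi.const_mul L) (by linarith)
  refine ⟨r, by positivity, δ, hδ, fun t => L * C t, fun t => mul_nonneg hL.le (hC0 t), ?_, ?_⟩
  · rw [hrρ]
    intro e he
    exact ⟨(hρs (ball_subset_closedBall he)).1, (hρs (ball_subset_closedBall he)).2.2⟩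
  rw [hrρ]
  intro a b ha haδ hab hb
  have hI : Icc a b ⊆ Icc 0 (t₀ + 1) := Icc_subset_Icc ha (hb.trans hδT)
  refine ⟨IntegrableOn.mono_set (f := fun t => L * C t) (hCi.const_mul L) hI,
    hδC a b ha haδ hab hb, fun e _ => ?_, ?_⟩
  · have h1 : AEStronglyMeasurable (G (φ.symm e)) (volume.restrict (Icc a b)) :=
      (hG.measurable (φ.symm e)).mono_set fun t ht => ha.trans ht.1
    exact (mfderiv 𝓘(ℝ, E) 𝓘(ℝ, E) (chartAt E p₀)
      (φ.symm e)).continuous.comp_aestronglyMeasurable h1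
  · filter_upwards [ae_restrict_of_ae_restrict_of_subset hI hCb,
      ae_restrict_mem measurableSet_Icc] with t ht hm
    refine ⟨(differentiableOn_chartVelocity p₀ (hG.holomorphic t (ha.trans hm.1))).mono
      fun e he => (hρs (ball_subset_closedBall he)).1, fun e he => ?_⟩
    have he' := ball_subset_closedBall he
    refine (hWL _ (hρs he').2.1 (G (φ.symm e) t)).trans ?_
    exact mul_le_mul_of_nonneg_left (ht _ ⟨e, he', rfl⟩) hL.le

/-- Local existence of solutions, with holomorphic dependence on the initial value, on a time
interval which is uniform in the initial time and in the initial value. -/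
theorem IsWeakHolomorphicVectorField.exists_local_flow (hG : IsWeakHolomorphicVectorField h d G)
    (hd : 1 ≤ d) (p₀ : M) {t₀ : ℝ} (ht₀ : 0 ≤ t₀) {V : Set M} (hV : V ∈ 𝓝 p₀) :
    ∃ δ > 0, ∃ U ∈ 𝓝 p₀, ∀ s, 0 ≤ s → t₀ - δ ≤ s → s ≤ t₀ + δ → ∃ Φ : M → ℝ → M,
      (∀ z ∈ U, IsSolutionOn G s (t₀ + δ) (Φ z) ∧ Φ z s = z ∧
        MapsTo (Φ z) (Icc s (t₀ + δ)) V) ∧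
      ∀ t ∈ Icc s (t₀ + δ), MDifferentiableOn 𝓘(ℂ, E) 𝓘(ℂ, E) (fun z => Φ z t) U := by
  have : IsManifold 𝓘(ℂ, E) 1 M := .of_le (n := ω) le_top
  obtain ⟨r, hr, δ, hδ, C, hC0, hball, hw⟩ := hG.exists_chart_bound hd p₀ ht₀ hV
  set φ := chartAt E p₀ with hφ
  have h2 : ball (φ p₀) (2 * r) ⊆ ball (φ p₀) (2 * r + r) := ball_subset_ball (by linarith)
  refine ⟨δ, hδ, φ.source ∩ φ ⁻¹' ball (φ p₀) r, ?_, fun s hs0 hs hsδ => ?_⟩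
  · exact inter_mem (chart_source_mem_nhds E p₀)
      ((φ.continuousAt (mem_chart_source E p₀)).preimage_mem_nhds (ball_mem_nhds _ hr))
  obtain ⟨hCi, hCs, hmeas, hv⟩ := hw s (t₀ + δ) hs0 hs hsδ le_rfl
  obtain ⟨X, hX, hXd⟩ := exists_holomorphic_local_flow hsδ hr hC0 hCi hCs hmeas hv
  refine ⟨fun z t => φ.symm (X (φ z) t), fun z hz => ?_, fun t ht => ?_⟩
  · obtain ⟨hX0, hXc, hXm, hXi, hXe⟩ := hX (φ z) hz.2
    have hφX : ∀ t ∈ Icc s (t₀ + δ), φ (φ.symm (X (φ z) t)) = X (φ z) t := fun t ht =>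
      φ.right_inv (hball _ (h2 (hXm ht))).1
    refine ⟨?_, ?_, fun t ht => (hball _ (h2 (hXm ht))).2⟩
    · refine IsSolutionOn.of_integral_eq hsδ (p := p₀)
        (φ.continuousOn_symm.comp hXc fun t ht => (hball _ (h2 (hXm ht))).1)
        (fun t ht => φ.map_target (hball _ (h2 (hXm ht))).1) hXi fun t ht => ?_
      have h3 := hφX s ⟨le_rfl, hsδ⟩
      rw [← hφ, hφX t ht, h3, hX0]
      exact hXe t ht
    · simp only [hX0]
      exact φ.left_inv hz.1
  · refine (mdifferentiableOn_atlas_symm (I := 𝓘(ℂ, E)) (chart_mem_atlas E p₀)).comp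
      (((hXd t ht).mdifferentiableOn).comp
        ((mdifferentiableOn_atlas (I := 𝓘(ℂ, E)) (chart_mem_atlas E p₀)).mono inter_subset_left)
        fun z hz => hz.2) fun z hz => ?_
    exact (hball _ (h2 ((hX (φ z) hz.2).2.2.1 ht))).1

theorem IsWeakHolomorphicVectorField.exists_local_uniqueness
    (hG : IsWeakHolomorphicVectorField h d G)
    (hd : 1 ≤ d) (p₀ : M) {t₀ : ℝ} (ht₀ : 0 ≤ t₀) :
    ∃ δ > 0, ∃ U ∈ 𝓝 p₀, ∀ a b, 0 ≤ a → t₀ - δ ≤ a → a ≤ b → b ≤ t₀ + δ → ∀ x y : ℝ → M,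
      IsSolutionOn G a b x → IsSolutionOn G a b y → MapsTo x (Icc a b) U → MapsTo y (Icc a b) U →
      x a = y a → x b = y b := by
  obtain ⟨r, hr, δ, hδ, C, hC0, hball, hw⟩ := hG.exists_chart_bound hd p₀ ht₀ univ_mem
  set φ := chartAt E p₀ with hφ
  have h2 : ball (φ p₀) (2 * r) ⊆ ball (φ p₀) (2 * r + r) := ball_subset_ball (by linarith)
  refine ⟨δ, hδ, φ.source ∩ φ ⁻¹' ball (φ p₀) (2 * r), ?_, fun a b ha haδ hab hb x y hx hy hxU
    hyU h0 => ?_⟩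
  · exact inter_mem (chart_source_mem_nhds E p₀)
      ((φ.continuousAt (mem_chart_source E p₀)).preimage_mem_nhds (ball_mem_nhds _ (by positivity)))
  obtain ⟨hCi, hCs, hmeas, hv⟩ := hw a b ha haδ hab hb
  have key : ∀ x : ℝ → M, IsSolutionOn G a b x → MapsTo x (Icc a b)
      (φ.source ∩ φ ⁻¹' ball (φ p₀) (2 * r)) →
      ContinuousOn (fun t => φ (x t)) (Icc a b) ∧
      IntegrableOn (fun t => chartVelocity G p₀ t (φ.symm (φ (x t)))) (Icc a b) ∧
      ∀ t ∈ Icc a b, φ (x t) - φ (x a) =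
        ∫ τ in a..t, chartVelocity G p₀ τ (φ.symm (φ (x τ))) := by
    intro x hx hxU
    obtain ⟨h3, h4⟩ := hx.integral_eq hab (p := p₀) fun t ht => (hxU ht).1
    have h5 : EqOn (fun t => chartVelocity G p₀ t (x t))
        (fun t => chartVelocity G p₀ t (φ.symm (φ (x t)))) (Icc a b) := fun t ht => by
      simp only [φ.left_inv (hxU ht).1]
    refine ⟨φ.continuousOn.comp hx.continuousOn fun t ht => (hxU ht).1,
      h3.congr_fun h5 measurableSet_Icc, fun t ht => (h4 a ⟨le_rfl, hab⟩ t ht).trans ?_⟩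
    refine intervalIntegral.integral_congr fun τ hτ => h5 ?_
    rw [uIcc_of_le ht.1] at hτ
    exact ⟨hτ.1, hτ.2.trans ht.2⟩
  obtain ⟨hxc, hxi, hxe⟩ := key x hx hxU
  obtain ⟨hyc, hyi, hye⟩ := key y hy hyU
  have := eqOn_of_integral_equation hr hC0 hCi hCs hv hxc hyc (fun t ht => (hxU ht).2)
    (fun t ht => (hyU ht).2) hxi hyi hxe hye (by rw [h0])
  have hb : b ∈ Icc a b := ⟨hab, le_rfl⟩
  exact φ.injOn (hxU hb).1 (hyU hb).1 (this hb)

theorem exists_abs_lt_mem_of_continuousOn {X : Type*} [TopologicalSpace X] {x : ℝ → X} {a b t : ℝ}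
    (hx : ContinuousOn x (Icc a b)) (ht : t ∈ Icc a b) {U : Set X} (hU : U ∈ 𝓝 (x t)) :
    ∃ δ > 0, ∀ s ∈ Icc a b, t - δ < s → s < t + δ → x s ∈ U := by
  obtain ⟨δ, hδ, hsub⟩ := Metric.mem_nhdsWithin_iff.1 ((hx t ht).preimage_mem_nhdsWithin hU)
  refine ⟨δ, hδ, fun s hs h1 h2 => hsub ⟨?_, hs⟩⟩
  rw [Metric.mem_ball, Real.dist_eq, abs_lt]
  constructor <;> linarith

/-- Solutions are determined by their initial value. -/
theorem IsWeakHolomorphicVectorField.eqOn [T2Space M] (hG : IsWeakHolomorphicVectorField h d G)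
    (hd : 1 ≤ d) {a b : ℝ} (ha : 0 ≤ a) {x y : ℝ → M} (hx : IsSolutionOn G a b x)
    (hy : IsSolutionOn G a b y) (h0 : x a = y a) : EqOn x y (Icc a b) := by
  intro c hc
  refine rel_of_locally (R := fun s t => x s = y s → x t = y t) hc.1
    (fun _ _ _ _ _ _ _ h1 h2 h3 => h2 (h1 h3)) (fun t ht => ?_) h0
  have ht' : t ∈ Icc a b := ⟨ht.1, ht.2.trans hc.2⟩
  by_cases hxy : x t = y t
  · obtain ⟨δ, hδ, U, hU, H⟩ := hG.exists_local_uniqueness hd (x t) (ha.trans ht.1)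
    obtain ⟨δ₁, hδ₁, H₁⟩ := exists_abs_lt_mem_of_continuousOn hx.continuousOn ht' hU
    obtain ⟨δ₂, hδ₂, H₂⟩ := exists_abs_lt_mem_of_continuousOn hy.continuousOn ht' (hxy ▸ hU)
    refine ⟨min δ (min δ₁ δ₂), lt_min hδ (lt_min hδ₁ hδ₂), fun u w hu huw hw h1 h2 => ?_⟩
    have e1 : min δ (min δ₁ δ₂) ≤ δ := min_le_left _ _
    have e2 : min δ (min δ₁ δ₂) ≤ δ₁ := (min_le_right _ _).trans (min_le_left _ _)
    have e3 : min δ (min δ₁ δ₂) ≤ δ₂ := (min_le_right _ _).trans (min_le_right _ _)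
    have hwb := hw.trans hc.2
    refine H u w (ha.trans hu) (by linarith) huw (by linarith) x y (hx.mono hu hwb)
      (hy.mono hu hwb) (fun s hs => H₁ s ⟨hu.trans hs.1, hs.2.trans hwb⟩ ?_ ?_)
      (fun s hs => H₂ s ⟨hu.trans hs.1, hs.2.trans hwb⟩ ?_ ?_) <;> linarith [hs.1, hs.2]
  -- Where the curves differ they are separated nearby, so the implication to be propagated holds
  -- vacuously.
  · obtain ⟨A, B, hA, hB, hxA, hyB, hAB⟩ := t2_separation hxy
    obtain ⟨δ₁, hδ₁, H₁⟩ := exists_abs_lt_mem_of_continuousOn hx.continuousOn ht' (hA.mem_nhds hxA)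
    obtain ⟨δ₂, hδ₂, H₂⟩ := exists_abs_lt_mem_of_continuousOn hy.continuousOn ht' (hB.mem_nhds hyB)
    refine ⟨min δ₁ δ₂, lt_min hδ₁ hδ₂, fun u w hu huw hw h1 h2 h3 => ?_⟩
    have e2 : min δ₁ δ₂ ≤ δ₁ := min_le_left _ _
    have e3 : min δ₁ δ₂ ≤ δ₂ := min_le_right _ _
    have hum : u ∈ Icc a b := ⟨hu, huw.trans (hw.trans hc.2)⟩
    have m1 := H₁ u hum (by linarith) (by linarith)
    have m2 := H₂ u hum (by linarith) (by linarith)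
    rw [← h3] at m2
    exact (disjoint_left.1 hAB m1 m2).elim

/-- Solutions starting near the initial value of a solution exist on the same time interval and
depend holomorphically on the initial value. -/
theorem IsWeakHolomorphicVectorField.exists_flow_near [T2Space M]
    (hG : IsWeakHolomorphicVectorField h d G)
    (hd : 1 ≤ d) {a b : ℝ} (ha : 0 ≤ a) (hab : a ≤ b) {x : ℝ → M} (hx : IsSolutionOn G a b x) :
    ∃ U ∈ 𝓝 (x a), ∃ Φ : M → M, MDifferentiableOn 𝓘(ℂ, E) 𝓘(ℂ, E) Φ U ∧ Φ (x a) = x b ∧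
      ∀ z ∈ U, ∃ y : ℝ → M, IsSolutionOn G a b y ∧ y a = z ∧ y b = Φ z := by
  refine rel_of_locally (R := fun s t => ∃ U ∈ 𝓝 (x s), ∃ Φ : M → M,
    MDifferentiableOn 𝓘(ℂ, E) 𝓘(ℂ, E) Φ U ∧ Φ (x s) = x t ∧
      ∀ z ∈ U, ∃ y : ℝ → M, IsSolutionOn G s t y ∧ y s = z ∧ y t = Φ z) hab ?_ fun t ht => ?_
  · rintro s t u - hst htu - ⟨U₁, hU₁, Φ₁, hd₁, he₁, h₁⟩ ⟨U₂, hU₂, Φ₂, hd₂, he₂, h₂⟩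
    have hc : ContinuousAt Φ₁ (x s) := (hd₁.continuousOn).continuousAt hU₁
    refine ⟨U₁ ∩ Φ₁ ⁻¹' U₂, inter_mem hU₁ (hc.preimage_mem_nhds (he₁ ▸ hU₂)), Φ₂ ∘ Φ₁,
      hd₂.comp (hd₁.mono inter_subset_left) fun z hz => hz.2, by simp [he₁, he₂], fun z hz => ?_⟩
    obtain ⟨y₁, hy₁, hys, hyt⟩ := h₁ z hz.1
    obtain ⟨y₂, hy₂, hyt', hyu⟩ := h₂ _ hz.2
    obtain ⟨w, hw, hw1, hw2⟩ := hy₁.exists_concat hy₂ hst htu (hyt.trans hyt'.symm)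
    exact ⟨w, hw, (hw1 ⟨le_rfl, hst⟩).trans hys, (hw2 ⟨htu, le_rfl⟩).trans hyu⟩
  · obtain ⟨δ, hδ, U, hU, H⟩ := hG.exists_local_flow hd (x t) (ha.trans ht.1) univ_mem
    -- The interior is needed because `U` must be a neighbourhood of `x u`, not only of `x t`.
    obtain ⟨δ₁, hδ₁, H₁⟩ := exists_abs_lt_mem_of_continuousOn hx.continuousOn ht
      (interior_mem_nhds.2 hU)
    refine ⟨min δ δ₁, lt_min hδ hδ₁, fun u w hu huw hw h1 h2 => ?_⟩
    have e1 : min δ δ₁ ≤ δ := min_le_left _ _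
    have e2 : min δ δ₁ ≤ δ₁ := min_le_right _ _
    obtain ⟨Φ, hΦ, hΦd⟩ := H u (ha.trans hu) (by linarith) (by linarith)
    have hxu : x u ∈ interior U := H₁ u ⟨hu, huw.trans hw⟩ (by linarith) (by linarith)
    have hsol : ∀ z ∈ U, IsSolutionOn G u w (Φ z) := fun z hz =>
      (hΦ z hz).1.mono le_rfl (by linarith)
    refine ⟨U, mem_interior_iff_mem_nhds.1 hxu, fun z => Φ z w, hΦd w ⟨huw, by linarith⟩, ?_,
      fun z hz => ⟨Φ z, hsol z hz, (hΦ z hz).2.1, rfl⟩⟩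
    have hxu' := interior_subset hxu
    exact hG.eqOn hd (ha.trans hu) (hsol _ hxu') (hx.mono hu hw) (hΦ _ hxu').2.1 ⟨huw, le_rfl⟩

end LocalFlow

/-! ### Solutions do not move apart for the Kobayashi distance -/

section Contraction

variable {E : Type*} [NormedAddCommGroup E] [NormedSpace ℂ E]
  {M : Type*} [TopologicalSpace M] [ChartedSpace E M]
  {G : (z : M) → ℝ → TangentSpace 𝓘(ℂ, E) z}

theorem KobayashiC1OffDiag.contMDiffAt [T2Space M] (hk : KobayashiC1OffDiag E M) {p q : M}
    (hpq : p ≠ q) : ContMDiffAt (𝓘(ℝ, E).prod 𝓘(ℝ, E)) 𝓘(ℝ, ℝ) 1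
      (fun p : M × M => kobayashiDist E p.1 p.2) (p, q) :=
  ContMDiffOn.contMDiffAt hk ((isOpen_ne_fun continuous_fst continuous_snd).mem_nhds hpq)

theorem KobayashiC1OffDiag.exists_lipschitzOnWith [T2Space M] (hk : KobayashiC1OffDiag E M)
    {p q : M} (hpq : p ≠ q) : ∃ K, ∃ s ∈ 𝓝 (chartAt E p p, chartAt E q q),
      LipschitzOnWith K (fun e : E × E =>
        kobayashiDist E ((chartAt E p).symm e.1) ((chartAt E q).symm e.2)) s := by
  have h1 := (contMDiffAt_iff.1 (hk.contMDiffAt hpq)).2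
  have h2 : ContDiffAt ℝ 1 (fun e : E × E =>
      kobayashiDist E ((chartAt E p).symm e.1) ((chartAt E q).symm e.2))
      (chartAt E p p, chartAt E q q) := by
    have h3 : range (𝓘(ℝ, E).prod 𝓘(ℝ, E)) = univ := by
      rw [modelWithCornersSelf_prod.symm]
      exact range_id
    rw [h3, contDiffWithinAt_univ] at h1
    exact h1
  exact h2.exists_lipschitzOnWith

theorem KobayashiC1OffDiag.hasDerivAt [T2Space M] (hk : KobayashiC1OffDiag E M) {x y : ℝ → M}
    {t : ℝ} (hx : HasVelocityAt G x t) (hy : HasVelocityAt G y t) (hxy : x t ≠ y t) :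
    HasDerivAt (fun τ => kobayashiDist E (x τ) (y τ))
      (kobayashiDifferential (G (x t) t) (G (y t) t)) t := by
  have h1 := ((hk.contMDiffAt hxy).mdifferentiableAt one_ne_zero).hasMFDerivAt
  have h2 : HasFDerivAt (fun τ => kobayashiDist E (x τ) (y τ))
      ((mfderiv (𝓘(ℝ, E).prod 𝓘(ℝ, E)) 𝓘(ℝ, ℝ)
        (fun p : M × M => kobayashiDist E p.1 p.2) (x t, y t)).comp
        (((1 : ℝ →L[ℝ] ℝ).smulRight (toRealTangent (G (x t) t))).prod
          ((1 : ℝ →L[ℝ] ℝ).smulRight (toRealTangent (G (y t) t))))) t :=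
    (HasMFDerivAt.comp (f := fun τ => (x τ, y τ))
      (g := fun p : M × M => kobayashiDist E p.1 p.2) (I' := 𝓘(ℝ, E).prod 𝓘(ℝ, E))
      t h1 (HasMFDerivAt.prodMk hx hy)).hasFDerivAt
  refine hasDerivAt_iff_hasFDerivAt.2 (h2.congr_fderiv (ContinuousLinearMap.ext fun c => ?_))
  have h3 : ∀ c : ℝ, mfderiv (𝓘(ℝ, E).prod 𝓘(ℝ, E)) 𝓘(ℝ, ℝ)
      (fun p : M × M => kobayashiDist E p.1 p.2) (x t, y t)
        (c • ((toRealTangent (G (x t) t), toRealTangent (G (y t) t)) : E × E)) =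
      c • kobayashiDifferential (G (x t) t) (G (y t) t) := fun c => map_smul _ _ _
  exact h3 c

variable [FiniteDimensional ℂ E] [IsManifold 𝓘(ℂ, E) ω M] {h : HermitianMetric E M} {d : ℝ≥0∞}

/-- The Kobayashi distance of two solutions does not increase. -/
theorem IsHerglotzVectorField.kobayashiDist_le [T2Space M] (hk : KobayashiC1OffDiag E M)
    (hG : IsHerglotzVectorField h d G) (hd : 1 ≤ d) {a b : ℝ} (ha : 0 ≤ a) (hab : a ≤ b)
    {x y : ℝ → M} (hx : IsSolutionOn G a b x) (hy : IsSolutionOn G a b y) :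
    kobayashiDist E (x b) (y b) ≤ kobayashiDist E (x a) (y a) := by
  -- If the curves agree at `b` there is nothing to prove. Otherwise uniqueness keeps them apart on
  -- all of `[a, b]`, so only the region off the diagonal, where the distance is of class C¹,
  -- matters.
  by_cases hb : x b = y b
  · rw [hb, kobayashiDist, kobayashiEDist_self]
    exact ENNReal.toReal_nonneg
  have hne : ∀ t ∈ Icc a b, x t ≠ y t := fun t ht hxy =>
    hb (hG.toIsWeakHolomorphicVectorField.eqOn hd (ha.trans ht.1) (hx.mono ht.1 le_rfl)
      (hy.mono ht.1 le_rfl) hxy ⟨ht.2, le_rfl⟩)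
  refine rel_of_locally (R := fun s t => kobayashiDist E (x t) (y t) ≤ kobayashiDist E (x s) (y s))
    hab (fun _ _ _ _ _ _ _ h1 h2 => h2.trans h1) fun t ht => ?_
  obtain ⟨K, s, hs, hK⟩ := hk.exists_lipschitzOnWith (hne t ht)
  have hcx : ContinuousWithinAt (fun τ => chartAt E (x t) (x τ)) (Icc a b) t :=
    ((chartAt E (x t)).continuousAt (mem_chart_source E (x t))).comp_continuousWithinAt
      (hx.continuousOn t ht)
  have hcy : ContinuousWithinAt (fun τ => chartAt E (y t) (y τ)) (Icc a b) t :=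
    ((chartAt E (y t)).continuousAt (mem_chart_source E (y t))).comp_continuousWithinAt
      (hy.continuousOn t ht)
  obtain ⟨δ, hδ, hsub⟩ := Metric.mem_nhdsWithin_iff.1 ((hcx.prodMk hcy).preimage_mem_nhdsWithin hs)
  obtain ⟨δ₁, hδ₁, H₁⟩ := exists_abs_lt_mem_of_continuousOn hx.continuousOn ht
    (chart_source_mem_nhds E (x t))
  obtain ⟨δ₂, hδ₂, H₂⟩ := exists_abs_lt_mem_of_continuousOn hy.continuousOn ht
    (chart_source_mem_nhds E (y t))
  refine ⟨min δ (min δ₁ δ₂), lt_min hδ (lt_min hδ₁ hδ₂), fun u w hu huw hw h1 h2 => ?_⟩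
  have e1 : min δ (min δ₁ δ₂) ≤ δ := min_le_left _ _
  have e2 : min δ (min δ₁ δ₂) ≤ δ₁ := (min_le_right _ _).trans (min_le_left _ _)
  have e3 : min δ (min δ₁ δ₂) ≤ δ₂ := (min_le_right _ _).trans (min_le_right _ _)
  have hI : Icc u w ⊆ Icc a b := Icc_subset_Icc hu hw
  have hsx : MapsTo x (Icc u w) (chartAt E (x t)).source := fun τ hτ =>
    H₁ τ (hI hτ) (by linarith [hτ.1]) (by linarith [hτ.2])
  have hsy : MapsTo y (Icc u w) (chartAt E (y t)).source := fun τ hτ =>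
    H₂ τ (hI hτ) (by linarith [hτ.1]) (by linarith [hτ.2])
  -- A C¹ function is locally Lipschitz in charts, so the distance inherits domination from the two
  -- curves and is the integral of its derivative.
  have hdom : HasDominatedVariation (fun τ => kobayashiDist E (x τ) (y τ)) u w := by
    refine (((hx.dominated (x t) u w hu huw hw hsx).prodMk
      (hy.dominated (y t) u w hu huw hw hsy)).lipschitz_comp hK fun τ hτ =>
        hsub ⟨?_, hI hτ⟩).congr fun τ hτ => ?_
    · rw [Metric.mem_ball, Real.dist_eq, abs_lt]
      constructor <;> linarith [hτ.1, hτ.2]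
    · simp only [(chartAt E (x t)).left_inv (hsx hτ), (chartAt E (y t)).left_inv (hsy hτ)]
  have hder : ∀ᵐ τ ∂volume.restrict (Icc u w), HasDerivAt
      (fun τ => kobayashiDist E (x τ) (y τ))
      (kobayashiDifferential (G (x τ) τ) (G (y τ) τ)) τ := by
    filter_upwards [ae_restrict_of_ae_restrict_of_subset hI hx.equation,
      ae_restrict_of_ae_restrict_of_subset hI hy.equation,
      ae_restrict_mem measurableSet_Icc] with τ h3 h4 hτ
    exact hk.hasDerivAt h3 h4 (hne τ (hI hτ))
  have hint := (hdom.integral_eq_sub huw hder).2 u ⟨le_rfl, huw⟩ w ⟨huw, le_rfl⟩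
  have hnonpos : ∫ τ in u..w, kobayashiDifferential (G (x τ) τ) (G (y τ) τ) ≤ 0 := by
    rw [intervalIntegral.integral_of_le huw]
    refine integral_nonpos_of_ae ?_
    have h5 : Ioc u w ⊆ Ici 0 := fun τ hτ => ha.trans (hu.trans hτ.1.le)
    filter_upwards [ae_restrict_of_ae_restrict_of_subset h5 hG.nonexpansive,
      ae_restrict_mem measurableSet_Ioc] with τ h3 hτ
    exact h3 _ _ (hne τ (hI ⟨hτ.1.le, hτ.2⟩))
  linarith

theorem IsHerglotzVectorField.kobayashiEDist_le [T2Space M] [ConnectedSpace M]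
    (hk : KobayashiC1OffDiag E M)
    (hG : IsHerglotzVectorField h d G) (hd : 1 ≤ d) {a b : ℝ} (ha : 0 ≤ a) (hab : a ≤ b)
    {x y : ℝ → M} (hx : IsSolutionOn G a b x) (hy : IsSolutionOn G a b y) :
    kobayashiEDist E (x b) (y b) ≤ kobayashiEDist E (x a) (y a) :=
  (ENNReal.toReal_le_toReal (kobayashiEDist_ne_top _ _) (kobayashiEDist_ne_top _ _)).1
    (hG.kobayashiDist_le hk hd ha hab hx hy)

end Contraction

/-! ### Existence for all times -/

section GlobalExistence

variable {E : Type*} [NormedAddCommGroup E] [NormedSpace ℂ E]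
  {M : Type*} [TopologicalSpace M] [ChartedSpace E M] [IsManifold 𝓘(ℂ, E) ω M]
  {h : HermitianMetric E M} {d : ℝ≥0∞} {G : (z : M) → ℝ → TangentSpace 𝓘(ℂ, E) z}

/-- A curve on `[s, t)` which is a uniform limit of curves extending continuously to `[s, t]`
accumulates at some point at the time `t`. -/
theorem IsCompleteHyperbolic.exists_accumulation [LocallyCompactSpace M] [T2Space M]
    (hM : IsCompleteHyperbolic E M) {s t : ℝ} (hst : s < t) {X : ℝ → M}
    (H : ∀ ε > 0, ∃ y : ℝ → M, ContinuousOn y (Icc s t) ∧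
      ∀ τ ∈ Ico s t, kobayashiEDist E (X τ) (y τ) < ε) :
    ∃ p, ∀ U ∈ 𝓝 p, ∀ δ > 0, ∃ τ ∈ Ico s t, t - δ < τ ∧ X τ ∈ U := by
  obtain ⟨τ, -, hτ, hlim⟩ := exists_seq_strictMono_tendsto' hst
  obtain ⟨p, hp⟩ := hM.complete (fun n => X (τ n)) fun ε hε => by
    -- Both `X (τ n)` to `y (τ n)` and `y (τ n)` to `y t` cost a quarter of `ε`; comparing two
    -- indices through `y t` costs `ε`.
    have hε4 : 0 < ε / 2 / 2 := ENNReal.half_pos (ENNReal.half_pos hε.ne').ne'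
    obtain ⟨y, hyc, hy⟩ := H _ hε4
    obtain ⟨δ, hδ, hyδ⟩ := exists_abs_lt_mem_of_continuousOn hyc (right_mem_Icc.2 hst.le)
      ((tendsto_kobayashiEDist_nhds (E := E) (y t)).eventually (gt_mem_nhds hε4))
    obtain ⟨N, hN⟩ := eventually_atTop.1 (hlim.eventually (lt_mem_nhds (sub_lt_self t hδ)))
    refine ⟨N, fun m hm n hn => ?_⟩
    have key : ∀ n ≥ N, kobayashiEDist E (X (τ n)) (y t) < ε / 2 := fun n hn => by
      have h1 := hy (τ n) ⟨(hτ n).1.le, (hτ n).2⟩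
      have h2 : kobayashiEDist E (y t) (y (τ n)) < ε / 2 / 2 :=
        hyδ (τ n) ⟨(hτ n).1.le, (hτ n).2.le⟩ (hN n hn) (by linarith [(hτ n).2])
      rw [kobayashiEDist_comm] at h2
      calc _ ≤ _ := kobayashiEDist_triangle _ (y (τ n)) _
        _ < ε / 2 / 2 + ε / 2 / 2 := ENNReal.add_lt_add h1 h2
        _ = ε / 2 := ENNReal.add_halves _
    have h2 := key n hn
    rw [kobayashiEDist_comm] at h2
    calc _ ≤ _ := kobayashiEDist_triangle _ (y t) _
      _ < ε / 2 + ε / 2 := ENNReal.add_lt_add (key m hm) h2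
      _ = ε := ENNReal.add_halves _
  refine ⟨p, fun U hU δ hδ => ?_⟩
  obtain ⟨ε, hε, hεU⟩ := exists_kobayashiEDist_lt_subset hM.eq_of_kobayashiEDist_eq_zero hU
  obtain ⟨n, h1, h2⟩ := ((hp.eventually (gt_mem_nhds hε)).and
    (hlim.eventually (lt_mem_nhds (sub_lt_self t hδ)))).exists
  rw [kobayashiEDist_comm] at h1
  exact ⟨τ n, ⟨(hτ n).1.le, (hτ n).2⟩, h2, hεU _ h1⟩

variable [FiniteDimensional ℂ E] [T2Space M] [ConnectedSpace M]

/-- Contraction against solutions from nearby initial values, which exist up to `b`, rules out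
escape before `b`. The times reached from `z` are therefore a closed set, and the local flow allows
a further step from each of them. -/
theorem IsHerglotzVectorField.exists_solution_of_mem_closure (hM : IsCompleteHyperbolic E M)
    (hk : KobayashiC1OffDiag E M) (hG : IsHerglotzVectorField h d G) (hd : 1 ≤ d) {a b : ℝ}
    (ha : 0 ≤ a) (hab : a ≤ b) {z : M}
    (hz : z ∈ closure {z : M | ∃ x, IsSolutionOn G a b x ∧ x a = z}) :
    ∃ x, IsSolutionOn G a b x ∧ x a = z := by
  have : ProperSpace E := FiniteDimensional.proper ℂ E
  have : LocallyCompactSpace M := ChartedSpace.locallyCompactSpace E M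
  set I : Set ℝ := {t | ∃ x, IsSolutionOn G a t x ∧ x a = z} with hI
  have hlow : ∀ t ∈ I, ∀ t' ≤ t, t' ∈ I := fun t ⟨x, hx, hx0⟩ t' ht' =>
    ⟨x, hx.mono le_rfl ht', hx0⟩
  refine IsClosed.Icc_subset_of_forall_exists_gt (s := I) (a := a) (b := b) ?_
    ⟨fun _ => z, .const _ _, rfl⟩ ?_ ⟨hab, le_rfl⟩
  · refine isClosed_of_closure_subset fun t ht => ?_
    have htI : t ∈ Icc a b := closure_minimal inter_subset_right isClosed_Icc ht
    refine ⟨?_, htI⟩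
    have hlt : ∀ t' < t, t' ∈ I := fun t' ht' => by
      obtain ⟨c, hc, hcI⟩ := mem_closure_iff.1 ht _ isOpen_Ioi ht'
      exact hlow c hcI.1 t' (le_of_lt hc)
    rcases htI.1.eq_or_lt with rfl | hat
    · exact ⟨fun _ => z, .const _ _, rfl⟩
    have hex : ∀ t', ∃ x : ℝ → M, t' < t → IsSolutionOn G a t' x ∧ x a = z := fun t' => by
      by_cases h1 : t' < t
      · obtain ⟨x, hx⟩ := hlt t' h1
        exact ⟨x, fun _ => hx⟩
      · exact ⟨fun _ => z, fun h2 => (h1 h2).elim⟩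
    choose x hx using hex
    -- The diagonal `x t' t'` is the trajectory from `z` on `[a, t)`; it stays within `ε` of the
    -- continuous curve `y`.
    obtain ⟨p, hp⟩ := hM.exists_accumulation hat (X := fun t' => x t' t') fun ε hε => by
      obtain ⟨w, hw, y, hy, rfl⟩ := mem_closure_iff_nhds.1 hz _
        ((tendsto_kobayashiEDist_nhds (E := E) z).eventually (gt_mem_nhds hε))
      refine ⟨y, (hy.mono le_rfl htI.2).continuousOn, fun τ hτ => ?_⟩
      refine (hG.kobayashiEDist_le hk hd ha hτ.1 (hx τ hτ.2).1
        (hy.mono le_rfl (hτ.2.le.trans htI.2))).trans_lt ?_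
      rw [(hx τ hτ.2).2]
      exact hw
    -- Since `δ` and `U` do not depend on the starting time, the solution can be restarted at a time
    -- `τ > t - δ` at which it visits `U`, and then passes `t`.
    obtain ⟨δ, hδ, U, hU, H⟩ := hG.exists_local_flow hd p (ha.trans htI.1) univ_mem
    obtain ⟨τ, hτ, hτδ, hτU⟩ := hp U hU δ hδ
    obtain ⟨Φ, hΦ, -⟩ := H τ (ha.trans hτ.1) hτδ.le (by linarith [hτ.2])
    obtain ⟨h1, h2, -⟩ := hΦ _ hτU
    obtain ⟨w, hw, hwx, -⟩ := (hx τ hτ.2).1.exists_concat (h1.mono (b' := t) le_rfl (by linarith))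
      hτ.1 hτ.2.le h2.symm
    exact ⟨w, hw, (hwx ⟨le_rfl, hτ.1⟩).trans (hx τ hτ.2).2⟩
  · rintro t ⟨⟨x, hx, hx0⟩, hta, htb⟩ y (hy : t < y)
    obtain ⟨δ, hδ, U, hU, H⟩ := hG.exists_local_flow hd (x t) (ha.trans hta) univ_mem
    obtain ⟨Φ, hΦ, -⟩ := H t (ha.trans hta) (by linarith) (by linarith)
    obtain ⟨h1, h2, -⟩ := hΦ _ (mem_of_mem_nhds hU)
    obtain ⟨w, hw, hwx, -⟩ := hx.exists_concat h1 hta (by linarith) h2.symm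
    exact ⟨min y (t + δ), ⟨w, hw.mono le_rfl (min_le_right _ _), (hwx ⟨le_rfl, hta⟩).trans hx0⟩,
      lt_min hy (by linarith), min_le_left _ _⟩

/-- Solutions exist for all times. -/
theorem IsHerglotzVectorField.exists_solution (hM : IsCompleteHyperbolic E M)
    (hk : KobayashiC1OffDiag E M) (hG : IsHerglotzVectorField h d G) (hd : 1 ≤ d) {a b : ℝ}
    (ha : 0 ≤ a) (hab : a ≤ b) (z : M) : ∃ x, IsSolutionOn G a b x ∧ x a = z := by
  refine rel_of_locally (R := fun s t => ∀ z : M, ∃ x, IsSolutionOn G s t x ∧ x s = z) hab ?_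
    (fun t ht => ?_) z
  · intro s t u _ hst htu _ h1 h2 z
    obtain ⟨x, hx, hxs⟩ := h1 z
    obtain ⟨y, hy, hyt⟩ := h2 (x t)
    obtain ⟨w, hw, hwx, -⟩ := hx.exists_concat hy hst htu hyt.symm
    exact ⟨w, hw, (hwx ⟨le_rfl, hst⟩).trans hxs⟩
  -- Any point `p` will do: its local flow sets the length of the time window and makes the clopen
  -- set nonempty.
  · obtain ⟨p⟩ := ‹ConnectedSpace M›.toNonempty
    obtain ⟨δ, hδ, U, hU, H⟩ := hG.exists_local_flow hd p (ha.trans ht.1) univ_mem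
    refine ⟨δ, hδ, fun s u hs hsu hu h1 h2 => ?_⟩
    have hs0 := ha.trans hs
    have hclopen : IsClopen {z : M | ∃ x, IsSolutionOn G s u x ∧ x s = z} := by
      refine ⟨isClosed_of_closure_subset fun z hz =>
        hG.exists_solution_of_mem_closure hM hk hd hs0 hsu hz, isOpen_iff_mem_nhds.2 ?_⟩
      rintro _ ⟨x, hx, rfl⟩
      obtain ⟨W, hW, Φ, -, -, HW⟩ := hG.exists_flow_near hd hs0 hsu hx
      filter_upwards [hW] with z hz
      obtain ⟨y, hy, hys, -⟩ := HW z hz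
      exact ⟨y, hy, hys⟩
    have huniv := hclopen.eq_univ ⟨p, by
      obtain ⟨Φ, hΦ, -⟩ := H s hs0 (by linarith) (by linarith)
      obtain ⟨h3, h4, -⟩ := hΦ p (mem_of_mem_nhds hU)
      exact ⟨Φ p, h3.mono le_rfl h2.le, h4⟩⟩
    exact fun z => huniv.ge (mem_univ z)

end GlobalExistence

/-! ### The global flow and its compactness properties -/

section Flow

variable {E : Type*} [NormedAddCommGroup E] [NormedSpace ℂ E]
  {M : Type*} [TopologicalSpace M] [ChartedSpace E M]
  {G : (z : M) → ℝ → TangentSpace 𝓘(ℂ, E) z} {φ : ℝ → ℝ → M → M}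

/-- The family `φ` consists of the solutions for all times, indexed by initial time, time and
initial value. -/
structure IsSolutionFlow (G : (z : M) → ℝ → TangentSpace 𝓘(ℂ, E) z) (φ : ℝ → ℝ → M → M) :
    Prop where
  solution : ∀ s t, 0 ≤ s → s ≤ t → ∀ z, IsSolutionOn G s t (fun τ => φ s τ z)
  initial : ∀ s, 0 ≤ s → ∀ z, φ s s z = z

variable [FiniteDimensional ℂ E]

theorem IsCaratheodorySolution.isSolutionOn {s : ℝ} {b : EReal} {z : M} {x : ℝ → M}
    (hx : IsCaratheodorySolution G s b z x) {t : ℝ} (ht : (t : EReal) < b) :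
    IsSolutionOn G s t x := by
  have hsub : Icc s t ⊆ {τ : ℝ | s ≤ τ ∧ (τ : EReal) < b} := fun τ hτ =>
    ⟨hτ.1, (EReal.coe_le_coe_iff.2 hτ.2).trans_lt ht⟩
  have : FiniteDimensional ℝ E := .complexToReal E
  exact ⟨hx.continuousOn.mono hsub, fun p u w hu huw hw hp =>
    (hx.absolutelyContinuous p u w hu huw (hsub ⟨hu.trans huw, hw⟩).2 hp).hasDominatedVariation huw,
    ae_restrict_of_ae_restrict_of_subset hsub hx.equation⟩

omit [FiniteDimensional ℂ E] in
theorem ae_restrict_Ici_of_forall_Icc {p : ℝ → Prop} {s : ℝ}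
    (H : ∀ t, s ≤ t → ∀ᵐ τ ∂volume.restrict (Icc s t), p τ) :
    ∀ᵐ τ ∂volume.restrict (Ici s), p τ := by
  have h1 : Ici s = ⋃ n : ℕ, Icc s (s + n) := by
    ext τ
    simp only [mem_Ici, mem_iUnion, mem_Icc, exists_and_left, iff_self_and]
    intro _
    obtain ⟨n, hn⟩ := exists_nat_ge (τ - s)
    exact ⟨n, by linarith⟩
  rw [h1, ae_restrict_iUnion_iff]
  exact fun n => H _ (by simp)

namespace IsSolutionFlow

omit [FiniteDimensional ℂ E] in
theorem solvesLoewner (hφ : IsSolutionFlow G φ) : SolvesLoewner G φ := fun s hs z =>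
  ae_restrict_Ici_of_forall_Icc fun t ht => (hφ.solution s t hs ht z).equation

omit [FiniteDimensional ℂ E] in
theorem isCaratheodorySolution (hφ : IsSolutionFlow G φ) {s : ℝ} (hs : 0 ≤ s) (z : M) :
    IsCaratheodorySolution G s ⊤ z (fun t => φ s t z) := by
  have h1 : {t : ℝ | s ≤ t ∧ (t : EReal) < ⊤} = Ici s := by
    ext t
    simp [EReal.coe_lt_top]
  refine ⟨?_, fun p t t' ht htt' _ hp => ?_, hφ.initial s hs z, ?_⟩
  · rw [h1]
    intro t (ht : s ≤ t)
    have h2 := (hφ.solution s (t + 1) hs (by linarith) z).continuousOn t ⟨ht, by linarith⟩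
    rw [← Ici_inter_Iic] at h2
    exact (continuousWithinAt_inter (Iic_mem_nhds (by linarith))).1 h2
  · exact ((hφ.solution s t' hs (ht.trans htt') z).dominated p t t' ht htt' le_rfl
      hp).absolutelyContinuousOnInterval htt'
  · rw [h1]
    exact hφ.solvesLoewner s hs z

variable [IsManifold 𝓘(ℂ, E) ω M] {h : HermitianMetric E M} {d : ℝ≥0∞} [T2Space M]

theorem eq_of_isSolutionOn (hφ : IsSolutionFlow G φ) (hG : IsWeakHolomorphicVectorField h d G)
    (hd : 1 ≤ d) {s t : ℝ} (hs : 0 ≤ s) (hst : s ≤ t) {x : ℝ → M} (hx : IsSolutionOn G s t x) :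
    x t = φ s t (x s) :=
  hG.eqOn hd hs hx (hφ.solution s t hs hst _) (hφ.initial s hs _).symm ⟨hst, le_rfl⟩

theorem comp_apply (hφ : IsSolutionFlow G φ) (hG : IsWeakHolomorphicVectorField h d G)
    (hd : 1 ≤ d) {s u t : ℝ} (hs : 0 ≤ s) (hsu : s ≤ u) (hut : u ≤ t) (z : M) :
    φ s t z = φ u t (φ s u z) :=
  hφ.eq_of_isSolutionOn hG hd (hs.trans hsu) hut
    ((hφ.solution s t hs (hsu.trans hut) z).mono hsu le_rfl)

theorem mdifferentiable (hφ : IsSolutionFlow G φ) (hG : IsWeakHolomorphicVectorField h d G)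
    (hd : 1 ≤ d) {s t : ℝ} (hs : 0 ≤ s) (hst : s ≤ t) :
    MDifferentiable 𝓘(ℂ, E) 𝓘(ℂ, E) (φ s t) := by
  intro z
  obtain ⟨U, hU, Φ, hΦ, -, H⟩ := hG.exists_flow_near hd hs hst (hφ.solution s t hs hst z)
  rw [hφ.initial s hs] at hU
  refine (hΦ.mdifferentiableAt hU).congr_of_eventuallyEq ?_
  filter_upwards [hU] with w hw
  obtain ⟨y, hy, rfl, hyt⟩ := H w hw
  rw [← hyt, hφ.eq_of_isSolutionOn hG hd hs hst hy]

/-- Nonexpansiveness in the initial value, uniform in time, combines with continuity in time of a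
single trajectory. -/
theorem continuousOn_uncurry [LocallyCompactSpace M] [ConnectedSpace M]
    (hφ : IsSolutionFlow G φ)
    (hM : IsCompleteHyperbolic E M) (hk : KobayashiC1OffDiag E M)
    (hG : IsHerglotzVectorField h d G) (hd : 1 ≤ d) {s T : ℝ} (hs : 0 ≤ s) :
    ContinuousOn (fun p : ℝ × M => φ s p.1 p.2) (Icc s T ×ˢ univ) := by
  rintro ⟨t, z⟩ ⟨ht, -⟩
  intro U hU
  obtain ⟨ε, hε, hεU⟩ := exists_kobayashiEDist_lt_subset hM.eq_of_kobayashiEDist_eq_zero hU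
  have hε2 : 0 < ε / 2 := ENNReal.half_pos hε.ne'
  rw [nhdsWithin_prod_eq, nhdsWithin_univ]
  have h1 : ∀ᶠ τ in 𝓝[Icc s T] t, kobayashiEDist E (φ s t z) (φ s τ z) < ε / 2 :=
    ((hφ.solution s T hs (ht.1.trans ht.2) z).continuousOn t ht).eventually
      ((tendsto_kobayashiEDist_nhds (E := E) (φ s t z)).eventually (gt_mem_nhds hε2))
  have h2 : ∀ᶠ w in 𝓝 z, kobayashiEDist E z w < ε / 2 :=
    (tendsto_kobayashiEDist_nhds (E := E) z).eventually (gt_mem_nhds hε2)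
  refine mem_map.2 ?_
  filter_upwards [(h1.and self_mem_nhdsWithin).prod_mk h2] with p hp
  refine hεU _ ?_
  have h3 := hG.kobayashiEDist_le hk hd hs hp.1.2.1 (hφ.solution s p.1 hs hp.1.2.1 z)
    (hφ.solution s p.1 hs hp.1.2.1 p.2)
  simp only [hφ.initial s hs] at h3
  calc _ ≤ _ := kobayashiEDist_triangle _ (φ s p.1 z) _
    _ < ε / 2 + ε / 2 := ENNReal.add_lt_add hp.1.1 (h3.trans_lt hp.2)
    _ = ε := ENNReal.add_halves _

/-- The solutions which start in a compact set at a time of a compact interval stay in a compact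
set during this interval. -/
theorem exists_isCompact_mapsTo [ConnectedSpace M] (hφ : IsSolutionFlow G φ)
    (hM : IsCompleteHyperbolic E M) (hk : KobayashiC1OffDiag E M)
    (hG : IsHerglotzVectorField h d G) (hd : 1 ≤ d) (T : ℝ) {K : Set M} (hK : IsCompact K) :
    ∃ K' : Set M, IsCompact K' ∧ ∀ s t, 0 ≤ s → s ≤ t → t ≤ T → ∀ z ∈ K, φ s t z ∈ K' := by
  have : ProperSpace E := FiniteDimensional.proper ℂ E
  have : LocallyCompactSpace M := ChartedSpace.locallyCompactSpace E M
  suffices H : ∃ K' : Set M, IsCompact K' ∧ ∀ p ∈ Icc 0 T ×ˢ K, 0 ≤ p.1 → ∀ t, p.1 ≤ t → t ≤ T →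
      φ p.1 t p.2 ∈ K' by
    obtain ⟨K', hK', H⟩ := H
    exact ⟨K', hK', fun s t hs hst ht z hz => H (s, z) ⟨⟨hs, hst.trans ht⟩, hz⟩ hs t hst ht⟩
  refine (isCompact_Icc.prod hK).induction_on (p := fun S : Set (ℝ × M) => ∃ K' : Set M,
    IsCompact K' ∧ ∀ p ∈ S, 0 ≤ p.1 → ∀ t, p.1 ≤ t → t ≤ T → φ p.1 t p.2 ∈ K') ?_ ?_ ?_ ?_
  · exact ⟨∅, isCompact_empty, by simp⟩
  · rintro S S' hSS' ⟨K', hK', H⟩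
    exact ⟨K', hK', fun p hp => H p (hSS' hp)⟩
  · rintro S S' ⟨K₁, hK₁, H₁⟩ ⟨K₂, hK₂, H₂⟩
    refine ⟨K₁ ∪ K₂, hK₁.union hK₂, ?_⟩
    rintro p (hp | hp) h0 t h1 h2
    · exact Or.inl (H₁ p hp h0 t h1 h2)
    · exact Or.inr (H₂ p hp h0 t h1 h2)
  · rintro ⟨s₀, z₀⟩ ⟨hs₀, hz₀⟩
    obtain ⟨V, hVc, hV⟩ := exists_compact_mem_nhds z₀
    obtain ⟨δ, hδ, U, hU, H⟩ := hG.exists_local_flow hd z₀ hs₀.1 hV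
    have hsδ : 0 ≤ s₀ + δ := add_nonneg hs₀.1 hδ.le
    -- Up to time `s₀ + δ` the trajectories stay in the compact set `V`; afterwards they follow the
    -- flow from the fixed initial time `s₀ + δ`. Thus no continuity in the initial time is needed.
    refine ⟨Ioo (s₀ - δ) (s₀ + δ) ×ˢ U, mem_nhdsWithin_of_mem_nhds
      (prod_mem_nhds (Ioo_mem_nhds (by linarith) (by linarith)) hU),
      V ∪ (fun p : ℝ × M => φ (s₀ + δ) p.1 p.2) '' (Icc (s₀ + δ) T ×ˢ V),
      hVc.union ((isCompact_Icc.prod hVc).image_of_continuousOn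
        ((hφ.continuousOn_uncurry hM hk hG hd hsδ).mono
          (prod_mono le_rfl (subset_univ _)))), ?_⟩
    rintro ⟨s, z⟩ ⟨hs, hz⟩ (hs0 : 0 ≤ s) t (hst : s ≤ t) htT
    change φ s t z ∈ _
    obtain ⟨Φ, hΦ, -⟩ := H s hs0 hs.1.le hs.2.le
    obtain ⟨h1, h2, h3⟩ := hΦ z hz
    have h4 : ∀ τ ∈ Icc s (s₀ + δ), φ s τ z ∈ V := fun τ hτ => by
      have h5 := hφ.eq_of_isSolutionOn hG.toIsWeakHolomorphicVectorField hd hs0 hτ.1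
        (h1.mono le_rfl hτ.2)
      rw [h2] at h5
      rw [← h5]
      exact h3 hτ
    rcases le_total t (s₀ + δ) with h5 | h5
    · exact Or.inl (h4 t ⟨hst, h5⟩)
    · refine Or.inr ⟨(t, φ s (s₀ + δ) z), ⟨⟨h5, htT⟩, h4 _ ⟨hs.2.le, le_rfl⟩⟩, ?_⟩
      exact (hφ.comp_apply hG.toIsWeakHolomorphicVectorField hd hs0 hs.2.le h5 z).symm

end IsSolutionFlow

/-- The solutions of the differential equation of a Herglotz vector field form a flow. -/
theorem IsHerglotzVectorField.exists_isSolutionFlow [IsManifold 𝓘(ℂ, E) ω M]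
    {h : HermitianMetric E M} {d : ℝ≥0∞} [T2Space M] [ConnectedSpace M]
    (hM : IsCompleteHyperbolic E M) (hk : KobayashiC1OffDiag E M)
    (hG : IsHerglotzVectorField h d G) (hd : 1 ≤ d) : ∃ φ, IsSolutionFlow G φ := by
  have hex : ∀ s t z, ∃ x : ℝ → M, 0 ≤ s → s ≤ t → IsSolutionOn G s t x ∧ x s = z := by
    intro s t z
    by_cases hst : 0 ≤ s ∧ s ≤ t
    · obtain ⟨x, hx⟩ := hG.exists_solution hM hk hd hst.1 hst.2 z
      exact ⟨x, fun _ _ => hx⟩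
    · exact ⟨fun _ => z, fun h1 h2 => (hst ⟨h1, h2⟩).elim⟩
  choose x hx using hex
  -- Each value is taken at the end of its own solution on `[s, t]`; uniqueness makes these choices
  -- coherent.
  refine ⟨fun s t z => x s t z t, ⟨fun s t hs hst z => ?_, fun s hs z => (hx s s z hs le_rfl).2⟩⟩
  refine (hx s t z hs hst).1.congr fun τ hτ => ?_
  exact hG.eqOn hd hs ((hx s t z hs hst).1.mono le_rfl hτ.2) (hx s τ z hs hτ.1).1
    ((hx s t z hs hst).2.trans (hx s τ z hs hτ.1).2.symm) ⟨hτ.1, le_rfl⟩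

end Flow

/-! ### Displacement bounds for evolution families -/

section EvolutionFamily

variable {E : Type*} [NormedAddCommGroup E] [NormedSpace ℂ E] [FiniteDimensional ℂ E]
  {M : Type*} [TopologicalSpace M] [ChartedSpace E M] [IsManifold 𝓘(ℂ, E) ω M]
  {h : HermitianMetric E M} {d : ℝ≥0∞} {G : (z : M) → ℝ → TangentSpace 𝓘(ℂ, E) z}

open scoped Bundle in
omit [FiniteDimensional ℂ E] in
theorem HermitianMetric.edist_comm (h : HermitianMetric E M) (x y : M) :
    h.edist x y = h.edist y x := by
  let : Bundle.RiemannianBundle (fun z : M => TangentSpace 𝓘(ℝ, E) z) :=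
    ⟨h.toContMDiffRiemannianMetric.toRiemannianMetric⟩
  exact Manifold.riemannianEDist_comm (I := 𝓘(ℝ, E))

omit [FiniteDimensional ℂ E] in
theorem HermitianMetric.edist_le_integral_of_locally (h : HermitianMetric E M) {c : ℝ → ℝ}
    {x : ℝ → M} {a b : ℝ} (hab : a ≤ b) (hc0 : ∀ t, 0 ≤ c t) (hc : IntegrableOn c (Icc a b))
    (loc : ∀ t ∈ Icc a b, ∃ δ > 0, ∀ u w, a ≤ u → u ≤ w → w ≤ b → t - δ < u → w < t + δ →
      h.edist (x u) (x w) ≤ ENNReal.ofReal (∫ τ in u..w, c τ)) :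
    h.edist (x a) (x b) ≤ ENNReal.ofReal (∫ τ in a..b, c τ) := by
  refine rel_of_locally (R := fun u w => h.edist (x u) (x w) ≤ ENNReal.ofReal (∫ τ in u..w, c τ))
    hab (fun u v w hu huv hvw hw h1 h2 => ?_) loc
  have m1 : u ∈ Icc a b := ⟨hu, huv.trans (hvw.trans hw)⟩
  have m2 : v ∈ Icc a b := ⟨hu.trans huv, hvw.trans hw⟩
  have m3 : w ∈ Icc a b := ⟨hu.trans (huv.trans hvw), hw⟩
  rw [← intervalIntegral.integral_add_adjacent_intervals
    (intervalIntegrable_of_integrableOn_Icc hc m1 m2)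
    (intervalIntegrable_of_integrableOn_Icc hc m2 m3),
    ENNReal.ofReal_add (intervalIntegral.integral_nonneg huv fun t _ => hc0 t)
      (intervalIntegral.integral_nonneg hvw fun t _ => hc0 t)]
  exact (h.edist_triangle _ _ _).trans (add_le_add h1 h2)

theorem IsSolutionOn.edist_le_of_mapsTo {p : M} {L₁ : NNReal} {L₂ : ℝ} {W K : Set M}
    (hWs : W ⊆ (chartAt E p).source)
    (hL₁ : ∀ x ∈ W, ∀ y ∈ W, h.edist x y ≤ L₁ * edist (chartAt E p x) (chartAt E p y))
    (hL₂ : 0 ≤ L₂) (hW₂ : ∀ q ∈ W, ∀ v : TangentSpace 𝓘(ℂ, E) q,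
      @Norm.norm E _ (mfderiv 𝓘(ℝ, E) 𝓘(ℝ, E) (chartAt E p) q (toRealTangent v)) ≤ L₂ * h.norm v)
    {C : ℝ → ℝ} {a b : ℝ} (hab : a ≤ b) (hC : IntegrableOn C (Icc a b))
    (hGC : ∀ᵐ t ∂volume.restrict (Icc a b), ∀ z ∈ K, h.norm (G z t) ≤ C t) {x : ℝ → M}
    (hx : IsSolutionOn G a b x) (hxW : MapsTo x (Icc a b) (W ∩ K)) :
    h.edist (x a) (x b) ≤ ENNReal.ofReal (L₁ * L₂ * ∫ t in a..b, C t) := by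
  have ha : a ∈ Icc a b := ⟨le_rfl, hab⟩
  have hb : b ∈ Icc a b := ⟨hab, le_rfl⟩
  obtain ⟨hi, he⟩ := hx.integral_eq hab (p := p) fun t ht => hWs (hxW ht).1
  have h1 : ‖∫ t in a..b, chartVelocity G p t (x t)‖ ≤ ∫ t in a..b, L₂ * C t := by
    refine intervalIntegral.norm_integral_le_of_norm_le hab ?_
      ((intervalIntegrable_of_integrableOn_Icc hC ha hb).const_mul L₂)
    have h2 := ae_restrict_of_ae_restrict_of_subset Ioc_subset_Icc_self hGC
    rw [ae_restrict_iff' measurableSet_Ioc] at h2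
    filter_upwards [h2] with t ht htm
    have h3 := hxW (Ioc_subset_Icc_self htm)
    exact (hW₂ _ h3.1 _).trans (mul_le_mul_of_nonneg_left (ht htm _ h3.2) hL₂)
  rw [intervalIntegral.integral_const_mul] at h1
  refine (hL₁ _ (hxW ha).1 _ (hxW hb).1).trans ?_
  rw [edist_comm, edist_eq_enorm_sub, he a ha b hb, ← ofReal_norm,
    ← ENNReal.ofReal_coe_nnreal, ← ENNReal.ofReal_mul L₁.coe_nonneg, mul_assoc]
  exact ENNReal.ofReal_le_ofReal (mul_le_mul_of_nonneg_left h1 L₁.coe_nonneg)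

/-- Compactness gives one constant `L` valid in a neighbourhood of each point of `K`. The triangle
inequality and additivity of the integral then pass from short pieces to the whole curve. -/
theorem exists_edist_le_integral {K : Set M} (hK : IsCompact K) {C : ℝ → ℝ} {a b : ℝ}
    (hC0 : ∀ t, 0 ≤ C t) (hC : IntegrableOn C (Icc a b))
    (hGC : ∀ᵐ t ∂volume.restrict (Icc a b), ∀ z ∈ K, h.norm (G z t) ≤ C t) :
    ∃ L : NNReal, ∀ u w, a ≤ u → u ≤ w → w ≤ b → ∀ x : ℝ → M, IsSolutionOn G u w x →
      MapsTo x (Icc u w) K → h.edist (x u) (x w) ≤ ENNReal.ofReal (∫ t in u..w, L * C t) := by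
  obtain ⟨L, hL⟩ : ∃ L : NNReal, ∀ q ∈ K, ∃ W ∈ 𝓝 q, ∀ u w, a ≤ u → u ≤ w → w ≤ b →
      ∀ x : ℝ → M, IsSolutionOn G u w x → MapsTo x (Icc u w) (W ∩ K) →
        h.edist (x u) (x w) ≤ ENNReal.ofReal (L * ∫ t in u..w, C t) := by
    refine hK.induction_on (p := fun S : Set M => ∃ L : NNReal, ∀ q ∈ S, ∃ W ∈ 𝓝 q, ∀ u w,
      a ≤ u → u ≤ w → w ≤ b → ∀ x : ℝ → M, IsSolutionOn G u w x → MapsTo x (Icc u w) (W ∩ K) →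
        h.edist (x u) (x w) ≤ ENNReal.ofReal (L * ∫ t in u..w, C t)) ⟨0, by simp⟩ ?_ ?_ ?_
    · rintro S S' hSS' ⟨L, hL⟩
      exact ⟨L, fun q hq => hL q (hSS' hq)⟩
    · rintro S S' ⟨L, hL⟩ ⟨L', hL'⟩
      have key : ∀ L₁ L₂ : NNReal, L₁ ≤ L₂ → ∀ u w, u ≤ w →
          ENNReal.ofReal (L₁ * ∫ t in u..w, C t) ≤ ENNReal.ofReal (L₂ * ∫ t in u..w, C t) :=
        fun L₁ L₂ hL u w huw => ENNReal.ofReal_le_ofReal (mul_le_mul_of_nonneg_right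
          (NNReal.coe_le_coe.2 hL) (intervalIntegral.integral_nonneg huw fun t _ => hC0 t))
      refine ⟨max L L', ?_⟩
      rintro q (hq | hq)
      · obtain ⟨W, hW, H⟩ := hL q hq
        exact ⟨W, hW, fun u w hu huw hw x hx hm =>
          (H u w hu huw hw x hx hm).trans (key _ _ (le_max_left _ _) u w huw)⟩
      · obtain ⟨W, hW, H⟩ := hL' q hq
        exact ⟨W, hW, fun u w hu huw hw x hx hm =>
          (H u w hu huw hw x hx hm).trans (key _ _ (le_max_right _ _) u w huw)⟩
    · intro p _
      obtain ⟨L₁, W₁, hW₁, hL₁⟩ := h.exists_edist_le_edist_chartAt p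
      obtain ⟨L₂, hL₂, W₂, hW₂, H₂⟩ := h.exists_norm_mfderiv_chartAt_le p
      set W := (chartAt E p).source ∩ W₁ ∩ W₂ with hWdef
      have hW : W ∈ 𝓝 p := inter_mem (inter_mem (chart_source_mem_nhds E p) hW₁) hW₂
      refine ⟨interior W, mem_nhdsWithin_of_mem_nhds (interior_mem_nhds.2 hW),
        L₁ * ⟨L₂, hL₂.le⟩, fun q hq => ⟨W, mem_interior_iff_mem_nhds.1 hq,
        fun u w hu huw hw x hx hm => ?_⟩⟩
      have hI : Icc u w ⊆ Icc a b := Icc_subset_Icc hu hw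
      exact hx.edist_le_of_mapsTo (fun q hq => hq.1.1)
        (fun x hx y hy => hL₁ x hx.1.2 y hy.1.2) hL₂.le (fun q hq => H₂ q hq.2) huw
        (hC.mono_set hI) (ae_restrict_of_ae_restrict_of_subset hI hGC) hm
  refine ⟨L, fun u w hu huw hw x hx hm => ?_⟩
  have hI : Icc u w ⊆ Icc a b := Icc_subset_Icc hu hw
  refine h.edist_le_integral_of_locally huw (fun t => mul_nonneg L.2 (hC0 t))
    ((hC.mono_set hI).const_mul _) fun t ht => ?_
  obtain ⟨W, hW, H⟩ := hL (x t) (hm ht)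
  obtain ⟨δ, hδ, Hδ⟩ := exists_abs_lt_mem_of_continuousOn hx.continuousOn ht hW
  refine ⟨δ, hδ, fun u' w' hu' huw' hw' h1 h2 => ?_⟩
  rw [intervalIntegral.integral_const_mul]
  refine H u' w' (hu.trans hu') huw' (hw'.trans hw) x (hx.mono hu' hw') fun τ hτ => ?_
  have hτ' : τ ∈ Icc u w := ⟨hu'.trans hτ.1, hτ.2.trans hw'⟩
  exact ⟨Hδ τ hτ' (by linarith [hτ.1]) (by linarith [hτ.2]), hm hτ'⟩

/-- The flow of a Herglotz vector field of order `d` is an evolution family of order `d`. -/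
theorem IsSolutionFlow.isEvolutionFamily [T2Space M] [ConnectedSpace M] {φ : ℝ → ℝ → M → M}
    (hφ : IsSolutionFlow G φ)
    (hM : IsCompleteHyperbolic E M) (hk : KobayashiC1OffDiag E M)
    (hG : IsHerglotzVectorField h d G) (hd : 1 ≤ d) : IsEvolutionFamily h d φ := by
  have hG' := hG.toIsWeakHolomorphicVectorField
  refine ⟨fun s hs => funext (hφ.initial s hs), fun s u t hs hsu hut =>
    funext (hφ.comp_apply hG' hd hs hsu hut), fun s t hs hst => hφ.mdifferentiable hG' hd hs hst,
    fun T hT K hK => ?_⟩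
  obtain ⟨K', hK', hmaps⟩ := hφ.exists_isCompact_mapsTo hM hk hG hd T hK
  obtain ⟨C, hC0, hCd, hCb⟩ := hG.bound K' hK' T hT
  obtain ⟨L, hL⟩ := exists_edist_le_integral hK' hC0 (hCd.integrable hd) hCb
  refine ⟨fun t => L * C t, fun t => mul_nonneg L.2 (hC0 t), hCd.const_mul _,
    fun s t' t hs hst' ht't htT z hz => ?_⟩
  exact hL t' t (hs.trans hst') ht't htT (fun τ => φ s τ z)
    ((hφ.solution s t hs (hst'.trans ht't) z).mono hst' le_rfl)
    fun τ hτ => hmaps s τ hs (hst'.trans hτ.1) (hτ.2.trans htT) z hz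

-- Small balls of the Hermitian distance lie in any given neighbourhood, and integrals over short
-- intervals are small.
omit [FiniteDimensional ℂ E] in
theorem continuousOn_of_edist_le_integral [RegularSpace M] {c : ℝ → ℝ} {x : ℝ → M} {a b : ℝ}
    (hc : IntegrableOn c (Icc a b))
    (H : ∀ u w, a ≤ u → u ≤ w → w ≤ b →
      h.edist (x u) (x w) ≤ ENNReal.ofReal (∫ τ in u..w, c τ)) : ContinuousOn x (Icc a b) := by
  intro t ht U hU
  obtain ⟨ε, hε, hεU⟩ := h.exists_edist_lt_subset hU
  have h1 : Tendsto (fun τ => ENNReal.ofReal |∫ ξ in t..τ, c ξ|) (𝓝[Icc a b] t) (𝓝 0) := by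
    have h2 : ContinuousOn (fun τ => ∫ ξ in t..τ, c ξ) (Icc a b) := by
      have h3 := intervalIntegral.continuousOn_primitive_interval' (μ := volume)
        (intervalIntegrable_of_integrableOn_Icc hc ⟨le_rfl, ht.1.trans ht.2⟩
          ⟨ht.1.trans ht.2, le_rfl⟩) (a := t) (by rwa [uIcc_of_le (ht.1.trans ht.2)])
      rwa [uIcc_of_le (ht.1.trans ht.2)] at h3
    simpa using ENNReal.tendsto_ofReal ((h2 t ht).tendsto.abs)
  refine mem_map.2 ?_
  filter_upwards [h1.eventually (gt_mem_nhds hε), self_mem_nhdsWithin] with τ hτ hm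
  refine hεU (lt_of_le_of_lt ?_ hτ)
  rcases le_total t τ with h2 | h2
  · exact (H t τ ht.1 h2 hm.2).trans (ENNReal.ofReal_le_ofReal (le_abs_self _))
  · rw [h.edist_comm, intervalIntegral.integral_symm, abs_neg]
    exact (H τ t hm.1 h2 ht.2).trans (ENNReal.ofReal_le_ofReal (le_abs_self _))

-- Needed for uniqueness of the family: its displacement bound becomes domination in charts by local
-- comparison of distances.
omit [FiniteDimensional ℂ E] in
theorem hasDominatedVariation_of_edist_le_integral [RegularSpace M] {c : ℝ → ℝ} {x : ℝ → M}
    {a b : ℝ} (hab : a ≤ b) (hc0 : ∀ t, 0 ≤ c t) (hc : IntegrableOn c (Icc a b))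
    (H : ∀ u w, a ≤ u → u ≤ w → w ≤ b →
      h.edist (x u) (x w) ≤ ENNReal.ofReal (∫ τ in u..w, c τ)) {p : M}
    (hp : MapsTo x (Icc a b) (chartAt E p).source) :
    HasDominatedVariation (fun τ => chartAt E p (x τ)) a b := by
  have hx := continuousOn_of_edist_le_integral hc H
  refine .of_locally hab fun t ht => ?_
  obtain ⟨L, W, hW, hL⟩ := h.exists_edist_chartAt_le_edist (x t)
  obtain ⟨δ, hδ, Hδ⟩ := exists_abs_lt_mem_of_continuousOn hx ht
    (inter_mem hW (chart_source_mem_nhds E (x t)))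
  refine ⟨δ, hδ, fun u w hu huw hw h1 h2 => ?_⟩
  have hI : Icc u w ⊆ Icc a b := Icc_subset_Icc hu hw
  have hm : ∀ τ ∈ Icc u w, x τ ∈ W ∩ (chartAt E (x t)).source := fun τ hτ =>
    Hδ τ (hI hτ) (by linarith [hτ.1]) (by linarith [hτ.2])
  refine HasDominatedVariation.chart_change huw (hx.mono hI) (hp.mono_left hI)
    (fun τ hτ => (hm τ hτ).2) ⟨fun τ => L * c τ, fun τ => mul_nonneg L.2 (hc0 τ),
      (hc.mono_set hI).const_mul _, fun u' w' hu' huw' hw' => ?_⟩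
  have h3 := hL _ (hm u' ⟨hu', huw'.trans hw'⟩).1 _ (hm w' ⟨hu'.trans huw', hw'⟩).1
  have h4 := h3.trans (mul_le_mul_right (H u' w' (hu.trans hu') huw' (hw'.trans hw)) _)
  rw [← ENNReal.ofReal_coe_nnreal, ← ENNReal.ofReal_mul L.coe_nonneg,
    ← intervalIntegral.integral_const_mul, edist_dist] at h4
  exact (ENNReal.ofReal_le_ofReal_iff (intervalIntegral.integral_nonneg huw'
    fun t _ => mul_nonneg L.2 (hc0 t))).1 h4

omit [FiniteDimensional ℂ E] in
/-- The trajectories of an evolution family which solves the differential equation are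
solutions. -/
theorem IsEvolutionFamily.isSolutionOn [RegularSpace M] {ψ : ℝ → ℝ → M → M}
    (hψ : IsEvolutionFamily h d ψ) (hGψ : SolvesLoewner G ψ) (hd : 1 ≤ d) {s t : ℝ} (hs : 0 ≤ s)
    (hst : s ≤ t) (z : M) : IsSolutionOn G s t (fun τ => ψ s τ z) := by
  -- The horizon is `t + 1` because the bound requires a positive time, while `t` may be 0.
  obtain ⟨c, hc0, hcd, hc⟩ := hψ.bound (t + 1) (by linarith) {z} isCompact_singleton
  have hci : IntegrableOn c (Icc s t) :=
    IntegrableOn.mono_set (hcd.integrable hd) (Icc_subset_Icc hs (by linarith))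
  have H : ∀ u w, s ≤ u → u ≤ w → w ≤ t →
      h.edist (ψ s u z) (ψ s w z) ≤ ENNReal.ofReal (∫ τ in u..w, c τ) := fun u w hu huw hw =>
    hc s u w hs hu huw (by linarith) z rfl
  refine ⟨continuousOn_of_edist_le_integral hci H, fun p u w hu huw hw hp =>
    hasDominatedVariation_of_edist_le_integral huw hc0 (hci.mono_set (Icc_subset_Icc hu hw))
      (fun u' w' hu' huw' hw' => H u' w' (hu.trans hu') huw' (hw'.trans hw)) hp,
    ae_restrict_of_ae_restrict_of_subset Icc_subset_Ici_self (hGψ s hs z)⟩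

end EvolutionFamily

/-! ### The main theorem -/

theorem proposition3p1
    {E : Type*} [NormedAddCommGroup E] [NormedSpace ℂ E] [FiniteDimensional ℂ E]
    {M : Type*} [TopologicalSpace M] [T2Space M] [SecondCountableTopology M] [ConnectedSpace M]
    [ChartedSpace E M] [IsManifold 𝓘(ℂ, E) ω M]
    (hM : IsCompleteHyperbolic E M) (hk : KobayashiC1OffDiag E M)
    (h : HermitianMetric E M) (d : ℝ≥0∞) (hd : 1 ≤ d)
    (G : (z : M) → ℝ → TangentSpace 𝓘(ℂ, E) z) (hG : IsHerglotzVectorField h d G) :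
    ∃ φ : ℝ → ℝ → M → M,
      IsEvolutionFamily h d φ ∧ SolvesLoewner G φ ∧
      (∀ ψ : ℝ → ℝ → M → M, IsEvolutionFamily h d ψ → SolvesLoewner G ψ →
        ∀ s t, 0 ≤ s → s ≤ t → ψ s t = φ s t) ∧
      (∀ s, 0 ≤ s → ∀ z : M,
        IsCaratheodorySolution G s ⊤ z (fun t => φ s t z) ∧
        ∀ (b : EReal) (x : ℝ → M), IsCaratheodorySolution G s b z x →
          ∀ t : ℝ, s ≤ t → (t : EReal) < b → x t = φ s t z) := by
  have : ProperSpace E := FiniteDimensional.proper ℂ E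
  have : LocallyCompactSpace M := ChartedSpace.locallyCompactSpace E M
  have hG' := hG.toIsWeakHolomorphicVectorField
  obtain ⟨φ, hφ⟩ := hG.exists_isSolutionFlow hM hk hd
  refine ⟨φ, hφ.isEvolutionFamily hM hk hG hd, hφ.solvesLoewner, fun ψ hψ hGψ s t hs hst => ?_,
    fun s hs z => ⟨hφ.isCaratheodorySolution hs z, fun b x hx t hst ht => ?_⟩⟩
  · funext z
    have h1 := hφ.eq_of_isSolutionOn hG' hd hs hst (hψ.isSolutionOn hGψ hd hs hst z)
    rwa [hψ.refl s hs] at h1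
  · have h1 := hφ.eq_of_isSolutionOn hG' hd hs hst (hx.isSolutionOn ht)
    rwa [hx.initial] at h1
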